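/- Let $\mathbb K$ be a structure in a language $L$ that expands a field of characteristic $0$, let $T$ be the complete $L$-theory of $\mathbb K$, and let $F=\mathrm{dcl}(\emptyset)\subseteq\mathbb K$. Assume that $\mathbb K$ is algebraically bounded over $F$: for every $L$-formula $\varphi(\bar x,y)$ there are finitely many $p_1,\dots,p_m\in F[\bar x,y]$ such that, for all $\bar a$, if $\varphi(\bar a,\mathbb K)$ is finite, then it is contained in the zero set of some $p_i(\bar a,y)$ that is not the zero polynomial. Fix a derivation $\eta$ on $F$. Let $L^\delta=L\cup\{\delta\}$ with $\delta$ a unary function symbol, and let $T^\delta$ be the $L^\delta$-theory consisting of $T$ and the axioms saying that $\delta$ is a derivation extending $\eta$. For a model $M$ of $T$ and a set $X\subseteq M^n$ that is $L$-definable with parameters from $M$, let $\dim X$ be the maximum of $\mathrm{rk}(\bar a/M)$ over the points $\bar a$ of $X$ in elementary extensions of $M$, where $\mathrm{rk}$ is the rank with respect to the model-theoretic algebraic closure in $T$, and $\dim\emptyset=-\infty$. Let $\Pi_n$ denote the projection to the first $n$ coordinates. Consider the following schemes for $(M,\delta)\models T^\delta$, in which "definable" means $L$-definable with parameters from $M$.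 - (deep) For every $n$ and every definable $Z\subseteq M^{n+1}$ with $\dim\Pi_n(Z)=n$ there is $c\in M$ with $(c,\delta c,\dots,\delta^n c)\in Z$. - (wide) For every $n$ and every definable $X\subseteq M^n\times M^n$ with $\dim\Pi_n(X)=n$ there is $\bar c\in M^n$ with $(\bar c,\delta\bar c)\in X$. - (PP) Let $\bar p=(p_1,\dots,p_m)$ be a tuple of polynomials in $M[x_1,\dots,x_n]$ of degree at most $d$ whose zero set $W=V(\bar p)\subseteq M^n$ is nonempty. Let $\tau^\delta(\bar p)$ be the set of all $(\bar c,\bar y)\in W\times M^n$ with $p_i^{\delta}(\bar c)+\sum_j\frac{\partial p_i}{\partial x_j}(\bar c)\,y_j=0$ for all $i$, where $p_i^\delta$ arises from $p_i$ by applying $\delta$ to the coefficients. Let $\mathrm{Reg}(\bar p)$ be the set of $\bar c\in W$ at which the tangent space $\{\bar y\in M^n:\sum_j\frac{\partial p_i}{\partial x_j}(\bar c)\,y_j=0\text{ for all }i\}$ has linear dimension $\dim W$. Let $X\subseteq\tau^\delta(\bar p)$ be definable with $\Pi_n(X)\subseteq\mathrm{Reg}(\bar p)$ and $\dim\Pi_n(X)=\dim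 W$. Then there is $\bar c\in M^n$ with $(\bar c,\delta\bar c)\in X$. **Theorem.** Each of the three schemes is first order modulo $T^\delta$: for each choice of the $L$-formula defining $Z$ or $X$ (with parameters varying), and in (PP) also of $m$ and $d$, the corresponding instance is expressed by an $L^\delta$-sentence in all models of $T^\delta$. The theory $T^\delta_{\mathrm{PP}}:=T^\delta\cup(\mathrm{PP})$ is an axiomatization of $T^\delta_g$, that is: $T^\delta_{\mathrm{PP}}$ has the same models as $T^\delta\cup(\mathrm{wide})$ and as $T^\delta\cup(\mathrm{deep})$, and, if $T$ is model complete, $T^\delta_{\mathrm{PP}}$ is the model completion of $T^\delta$. -/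

import Mathlib

open FirstOrder FirstOrder.Language

universe u v w

namespace GenericDerivation

/-! ### Algebraic closure, definable closure, rank and dimension -/

section Dimension

variable (L : FirstOrder.Language.{u, v})

/-- The model-theoretic algebraic closure of `A` in `N`: the union of all finite subsets of `N`
that are `L`-definable with parameters from `A`. -/
def acl {N : Type w} [L.Structure N] (A : Set N) : Set N :=
  {x | ∃ S : Set N, A.Definable₁ L S ∧ S.Finite ∧ x ∈ S}

/-- The subtuple of `a` indexed by `s` is `acl`-independent over `A`. -/
def AclIndependent {N : Type w} [L.Structure N] (A : Set N) {n : ℕ} (a : Fin n → N)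
    (s : Finset (Fin n)) : Prop :=
  ∀ i ∈ s, a i ∉ acl L (A ∪ a '' {j | j ∈ s ∧ j ≠ i})

open Classical in
/-- The rank `rk(a / A)` of a finite tuple in the matroid `acl`: the largest size of a subtuple
that is `acl`-independent over `A`. -/
noncomputable def rk {N : Type w} [L.Structure N] (A : Set N) {n : ℕ} (a : Fin n → N) : ℕ :=
  (Finset.univ.filter (AclIndependent L A a)).sup Finset.card

/-- The dimension of a set `X ⊆ Mⁿ` that is `L`-definable with parameters: the largest value of
`rk(a / M)`, where `a` ranges over the points of (the interpretation of) `X` in elementary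
extensions `N` of `M`. The dimension of the empty set is `⊥` (that is, `-∞`). -/
noncomputable def dim {M : Type w} [L.Structure M] {n : ℕ} (X : Set (Fin n → M)) : WithBot ℕ∞ :=
  sSup {r | ∃ (k : ℕ) (ψ : L.Formula (Fin n ⊕ Fin k)) (b : Fin k → M),
    X = {x | ψ.Realize (Sum.elim x b)} ∧
    ∃ (N : Type w) (_ : L.Structure N) (f : M ↪ₑ[L] N) (a : Fin n → N),
      ψ.Realize (Sum.elim a (f ∘ b)) ∧
      r = ((rk L (Set.range f) a : ℕ∞) : WithBot ℕ∞)}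

end Dimension

/-! ### Algebraically bounded structures -/

section AlgebraicallyBounded

variable {L : FirstOrder.Language.{u, v}}

theorem definable_singleton_term (ι : FirstOrder.Language.ring →ᴸ L) {K : Type w} [Field K]
    [Ring.CompatibleRing K] [L.Structure K] [ι.IsExpansionOn K] (t : FirstOrder.Language.ring.Term (Fin 2))
    {a b : K} (ha : (∅ : Set K).Definable₁ L {a}) (hb : (∅ : Set K).Definable₁ L {b}) :
    (∅ : Set K).Definable₁ L {t.realize ![a, b]} := by
  have h1 : (∅ : Set K).Definable L
      {g : Fin 1 ⊕ Fin 2 → K | g (Sum.inr 0) = a} := by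
    have := ha.preimage_comp (fun _ : Fin 1 => (Sum.inr 0 : Fin 1 ⊕ Fin 2))
    exact this
  have h2 : (∅ : Set K).Definable L
      {g : Fin 1 ⊕ Fin 2 → K | g (Sum.inr 1) = b} := by
    have := hb.preimage_comp (fun _ : Fin 1 => (Sum.inr 1 : Fin 1 ⊕ Fin 2))
    exact this
  have h3 : (∅ : Set K).Definable L
      {g : Fin 1 ⊕ Fin 2 → K | g (Sum.inl 0) = t.realize (g ∘ Sum.inr)} := by
    have : (∅ : Set K).Definable FirstOrder.Language.ring
        {g : Fin 1 ⊕ Fin 2 → K | g (Sum.inl 0) = t.realize (g ∘ Sum.inr)} := by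
      rw [Set.empty_definable_iff]
      refine ⟨(Term.var (Sum.inl 0)).equal (t.relabel Sum.inr), ?_⟩
      ext g
      simp [Formula.realize_equal]
    exact this.map_expansion ι
  have h := ((h1.inter h2).inter h3).exists_of_finite
  unfold Set.Definable₁
  convert! h using 1
  ext x
  simp only [Set.mem_singleton_iff, Set.mem_ofPred_eq, Set.mem_inter_iff, Sum.elim_inl,
    Sum.elim_inr, Sum.elim_comp_inr]
  constructor
  · intro hx
    exact ⟨![a, b], ⟨rfl, rfl⟩, hx⟩
  · rintro ⟨y, ⟨h0, h1⟩, hx⟩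
    have : y = ![a, b] := by
      ext i
      fin_cases i
      · exact h0
      · exact h1
    rw [hx, this]

/-- The definable closure `F = dcl(∅)` of the empty set in an `L`-structure `K` expanding a field,
as a subring of `K`. -/
def dclEmpty (ι : FirstOrder.Language.ring →ᴸ L) (K : Type w) [Field K]
    [Ring.CompatibleRing K] [L.Structure K] [ι.IsExpansionOn K] : Subring K where
  carrier := {a | (∅ : Set K).Definable₁ L {a}}
  mul_mem' ha hb := by
    have h := definable_singleton_term ι (Term.var 0 * Term.var 1) ha hb
    rw [Ring.realize_mul] at h
    exact h
  add_mem' ha hb := by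
    have h := definable_singleton_term ι (Term.var 0 + Term.var 1) ha hb
    rw [Ring.realize_add] at h
    exact h
  neg_mem' ha := by
    simpa using definable_singleton_term ι (-Term.var 0) ha ha
  zero_mem' := by
    have h : (∅ : Set K).Definable₁ L {(0 : K)} := by
      have : (∅ : Set K).Definable FirstOrder.Language.ring {x : Fin 1 → K | x 0 ∈ ({0} : Set K)} := by
        rw [Set.empty_definable_iff]
        refine ⟨(Term.var 0).equal 0, ?_⟩
        ext g
        simp [Formula.realize_equal]
      exact this.map_expansion ι
    exact h
  one_mem' := by
    have h : (∅ : Set K).Definable₁ L {(1 : K)} := by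
      have : (∅ : Set K).Definable FirstOrder.Language.ring {x : Fin 1 → K | x 0 ∈ ({1} : Set K)} := by
        rw [Set.empty_definable_iff]
        refine ⟨(Term.var 0).equal 1, ?_⟩
        ext g
        simp [Formula.realize_equal]
      exact this.map_expansion ι
    exact h

/-- `K` is algebraically bounded over the subring `F`: for every `L`-formula `φ(x, y)` there are
finitely many polynomials `p₁, …, pₘ ∈ F[x][y]` such that, whenever `φ(a, K)` is finite, it is
contained in the zero set of some `pᵢ(a, y)` that is not the zero polynomial. -/
def IsAlgebraicallyBounded (L : FirstOrder.Language.{u, v}) {K : Type w} [Field K] [L.Structure K]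
    (F : Subring K) : Prop :=
  ∀ (n : ℕ) (φ : L.Formula (Fin n ⊕ Fin 1)),
    ∃ (m : ℕ) (p : Fin m → Polynomial (MvPolynomial (Fin n) F)),
      ∀ a : Fin n → K, {y : K | φ.Realize (Sum.elim a fun _ => y)}.Finite →
        ∃ i, (p i).map (MvPolynomial.aeval a : MvPolynomial (Fin n) F →ₐ[F] K).toRingHom ≠ 0 ∧
          ∀ y : K, φ.Realize (Sum.elim a fun _ => y) →
            ((p i).map (MvPolynomial.aeval a : MvPolynomial (Fin n) F →ₐ[F] K).toRingHom).eval y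
              = 0

end AlgebraicallyBounded

/-! ### The language with a derivation and the theory of derivations extending `η` -/

/-- The function symbols of the language `{δ}`, with `δ` unary. -/
inductive DerFunc : ℕ → Type
  | delta : DerFunc 1

/-- The language with a single unary function symbol `δ`. -/
def derLang : FirstOrder.Language.{0, 0} where
  Functions := DerFunc
  Relations := fun _ => Empty

/-- The symbol `δ`, as a function symbol of `derLang`. -/
abbrev deltaSymbol : derLang.Functions 1 := DerFunc.delta

/-- The language `Lᵟ`: the expansion of `L` by a new unary function symbol `δ`. -/
abbrev withDelta (L : FirstOrder.Language.{u, v}) : FirstOrder.Language.{u, v} := L.sum derLang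

/-- The interpretation of the symbol `δ`. -/
def delta (M : Type w) [derLang.Structure M] (x : M) : M :=
  Structure.funMap deltaSymbol ![x]

section Tdelta

variable {L : FirstOrder.Language.{u, v}}

/-- The `Lᵟ`-term `δ t`. -/
def deltaTerm {α : Type} (t : (withDelta L).Term α) : (withDelta L).Term α :=
  ((LHom.sumInr : derLang →ᴸ withDelta L).onFunction deltaSymbol).apply₁ t

/-- The `Lᵟ`-term `s + t`. -/
def addTerm (ι : FirstOrder.Language.ring →ᴸ L) {α : Type} (s t : (withDelta L).Term α) :
    (withDelta L).Term α :=
  ((LHom.sumInl : L →ᴸ withDelta L).onFunction (ι.onFunction Ring.addFunc)).apply₂ s t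

/-- The `Lᵟ`-term `s * t`. -/
def mulTerm (ι : FirstOrder.Language.ring →ᴸ L) {α : Type} (s t : (withDelta L).Term α) :
    (withDelta L).Term α :=
  ((LHom.sumInl : L →ᴸ withDelta L).onFunction (ι.onFunction Ring.mulFunc)).apply₂ s t

/-- The sentence `∀ x₀ … xₙ₋₁, θ`. -/
noncomputable def forallClosure {L' : FirstOrder.Language.{u, v}} {n : ℕ} (θ : L'.Formula (Fin n)) :
    L'.Sentence :=
  Formula.iAlls (Fin n) (θ.relabel (Sum.inr : Fin n → Empty ⊕ Fin n))

/-- The sentence `∀ x y, δ(x + y) = δx + δy`. -/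
noncomputable def deltaAdd (ι : FirstOrder.Language.ring →ᴸ L) : (withDelta L).Sentence :=
  forallClosure (n := 2)
    ((deltaTerm (addTerm ι (Term.var 0) (Term.var 1))).equal
      (addTerm ι (deltaTerm (Term.var 0)) (deltaTerm (Term.var 1))))

/-- The sentence `∀ x y, δ(x * y) = x * δy + y * δx`. -/
noncomputable def deltaMul (ι : FirstOrder.Language.ring →ᴸ L) : (withDelta L).Sentence :=
  forallClosure (n := 2)
    ((deltaTerm (mulTerm ι (Term.var 0) (Term.var 1))).equal
      (addTerm ι (mulTerm ι (Term.var 0) (deltaTerm (Term.var 1)))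
        (mulTerm ι (Term.var 1) (deltaTerm (Term.var 0)))))

/-- The sentence `∀ x y, α(x) → β(y) → δx = y`. -/
noncomputable def deltaSends (α β : L.Formula (Fin 1)) : (withDelta L).Sentence :=
  forallClosure (n := 2)
    (((LHom.sumInl : L →ᴸ withDelta L).onFormula (α.relabel fun _ => (0 : Fin 2))).imp
      (((LHom.sumInl : L →ᴸ withDelta L).onFormula (β.relabel fun _ => (1 : Fin 2))).imp
        ((deltaTerm (Term.var 0)).equal (Term.var 1))))

/-- The `Lᵟ`-theory `Tᵟ`, where `T` is the complete `L`-theory of `K`: the theory `T` together with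
the axioms saying that `δ` is a derivation extending the given derivation `η` on `F = dcl(∅)`.
The latter means that, whenever the `L`-formulas `α` and `β` define (in `K`) an element `a` of `F`
and the element `η a`, the derivation sends the element defined by `α` to the one defined
by `β`. -/
def Tdelta (ι : FirstOrder.Language.ring →ᴸ L) {K : Type w} [Field K]
    [Ring.CompatibleRing K] [L.Structure K] [ι.IsExpansionOn K]
    (η : Derivation ℤ (dclEmpty ι K) (dclEmpty ι K)) : (withDelta L).Theory :=
  (LHom.sumInl : L →ᴸ withDelta L).onTheory (L.completeTheory K) ∪
    {deltaAdd ι, deltaMul ι} ∪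
    {σ | ∃ (a : dclEmpty ι K) (α β : L.Formula (Fin 1)),
      (∀ x : K, α.Realize (fun _ => x) ↔ x = (a : K)) ∧
      (∀ x : K, β.Realize (fun _ => x) ↔ x = (η a : K)) ∧
      σ = deltaSends α β}

end Tdelta

/-! ### Twisted tangent bundles -/

section TwistedTangent

open MvPolynomial

variable {M : Type w} [Field M] {n m : ℕ}

/-- `p^δ`: the polynomial obtained from `p` by applying `δ` to every coefficient. -/
noncomputable def coeffDelta (δ : M → M) (p : MvPolynomial (Fin n) M) : MvPolynomial (Fin n) M :=
  ∑ s ∈ p.support, monomial s (δ (p.coeff s))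

/-- `p^[δ] ∈ M[x, y]`, the image of `p ∈ M[x]` under the derivation `M[x] → M[x, y]` that
extends `δ` and sends `xⱼ` to `yⱼ`; explicitly `p^δ(x) + ∑ⱼ (∂p/∂xⱼ)(x) yⱼ`. -/
noncomputable def twist (δ : M → M) (p : MvPolynomial (Fin n) M) :
    MvPolynomial (Fin n ⊕ Fin n) M :=
  rename Sum.inl (coeffDelta δ p) + ∑ j, rename Sum.inl (pderiv j p) * X (Sum.inr j)

/-- `V(p)`, the set of common zeros in `Mⁿ` of the tuple of polynomials `p`. -/
def zeroSet (p : Fin m → MvPolynomial (Fin n) M) : Set (Fin n → M) :=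
  {c | ∀ i, eval c (p i) = 0}

/-- The twisted tangent bundle `τ^δ(p) ⊆ Mⁿ × Mⁿ` of a tuple of polynomials `p`. -/
def twistedTangentBundle (δ : M → M) (p : Fin m → MvPolynomial (Fin n) M) :
    Set ((Fin n → M) × (Fin n → M)) :=
  {z | z.1 ∈ zeroSet p ∧ ∀ i, eval (Sum.elim z.1 z.2) (twist δ (p i)) = 0}

/-- The tangent space `τ⁰_c(p)` at `c`: the vectors `y` with `∑ⱼ (∂pᵢ/∂xⱼ)(c) yⱼ = 0` for
all `i`. -/
noncomputable def tangentSpace (p : Fin m → MvPolynomial (Fin n) M) (c : Fin n → M) :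
    Submodule M (Fin n → M) :=
  LinearMap.ker (Matrix.mulVecLin (Matrix.of fun i j => eval c (pderiv j (p i))))

/-- The regular locus `Reg(p)`: the points `c` of `W = V(p)` at which the linear dimension of the
tangent space is equal to `dim W`. -/
def reg (L : FirstOrder.Language.{u, v}) [L.Structure M] (p : Fin m → MvPolynomial (Fin n) M) :
    Set (Fin n → M) :=
  {c | c ∈ zeroSet p ∧
    ((Module.finrank M (tangentSpace p c) : ℕ∞) : WithBot ℕ∞) = dim L (zeroSet p)}

end TwistedTangent

/-! ### The axiom schemes -/

section Schemes

/-- A property of fields `M` carrying an `L`-structure and a function `δ : M → M`. -/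
def DiffProperty (L : FirstOrder.Language.{u, v}) : Type _ :=
  ∀ (M : Type w) [Field M] [L.Structure M], (M → M) → Prop

variable {L : FirstOrder.Language.{u, v}}

/-- The subset of `Mⁿ × Mⁿ` defined by the formula `ψ(x, y, b)` with parameters `b`. Every subset
of `Mⁿ × Mⁿ` that is `L`-definable with parameters is of this form. -/
def fibre {M : Type w} [L.Structure M] {n k : ℕ} (ψ : L.Formula ((Fin n ⊕ Fin n) ⊕ Fin k))
    (b : Fin k → M) : Set ((Fin n → M) × (Fin n → M)) :=
  {z | ψ.Realize (Sum.elim (Sum.elim z.1 z.2) b)}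

/-- The instance of the scheme "deep" for the family of sets `Z ⊆ Mⁿ⁺¹` given by `ψ`: if the
projection of `Z` to the first `n` coordinates has dimension `n`, then `(c, δc, …, δⁿc) ∈ Z` for
some `c`. -/
def deepInstance {n k : ℕ} (ψ : L.Formula (Fin (n + 1) ⊕ Fin k)) : DiffProperty.{u, v, w} L :=
  fun M _ _ δ => ∀ b : Fin k → M,
    dim L {x : Fin n → M | ∃ y : M, ψ.Realize (Sum.elim (Fin.snoc x y : Fin (n + 1) → M) b)}
      = ((n : ℕ∞) : WithBot ℕ∞) →
    ∃ c : M, ψ.Realize (Sum.elim (fun i : Fin (n + 1) => δ^[(i : ℕ)] c) b)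

/-- The instance of the scheme "wide" for the family of sets `X ⊆ Mⁿ × Mⁿ` given by `ψ`: if the
projection of `X` to the first `n` coordinates has dimension `n`, then `(c, δc) ∈ X` for
some `c ∈ Mⁿ`. -/
def wideInstance {n k : ℕ} (ψ : L.Formula ((Fin n ⊕ Fin n) ⊕ Fin k)) : DiffProperty.{u, v, w} L :=
  fun M _ _ δ => ∀ b : Fin k → M,
    dim L (Prod.fst '' fibre ψ b) = ((n : ℕ∞) : WithBot ℕ∞) →
    ∃ c : Fin n → M, (c, δ ∘ c) ∈ fibre ψ b

/-- The instance of the Pierce-Pillay scheme for `m`-tuples `p` of polynomials in `n` variables of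
degree at most `d` and for the family of sets `X ⊆ Mⁿ × Mⁿ` given by `ψ`: if `W = V(p)` is
nonempty, `X` is a subset of the twisted tangent bundle of `p`, and the projection of `X` to the
first `n` coordinates is contained in the regular locus of `p` and has the same dimension as `W`,
then `(c, δc) ∈ X` for some `c ∈ Mⁿ`. -/
def ppInstance (m d : ℕ) {n k : ℕ} (ψ : L.Formula ((Fin n ⊕ Fin n) ⊕ Fin k)) :
    DiffProperty.{u, v, w} L :=
  fun M _ _ δ => ∀ (p : Fin m → MvPolynomial (Fin n) M) (b : Fin k → M),
    (∀ i, (p i).totalDegree ≤ d) →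
    (zeroSet p).Nonempty →
    fibre ψ b ⊆ twistedTangentBundle δ p →
    Prod.fst '' fibre ψ b ⊆ reg L p →
    dim L (Prod.fst '' fibre ψ b) = dim L (zeroSet p) →
    ∃ c : Fin n → M, (c, δ ∘ c) ∈ fibre ψ b

variable (L)

def deepScheme : Set (DiffProperty.{u, v, w} L) :=
  {P | ∃ (n k : ℕ) (ψ : L.Formula (Fin (n + 1) ⊕ Fin k)), P = deepInstance ψ}

def wideScheme : Set (DiffProperty.{u, v, w} L) :=
  {P | ∃ (n k : ℕ) (ψ : L.Formula ((Fin n ⊕ Fin n) ⊕ Fin k)), P = wideInstance ψ}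

def ppScheme : Set (DiffProperty.{u, v, w} L) :=
  {P | ∃ (m d n k : ℕ) (ψ : L.Formula ((Fin n ⊕ Fin n) ⊕ Fin k)), P = ppInstance m d ψ}

variable {L}

/-- The `Lᵟ`-sentence `σ` expresses the property `P` in all models `(M, δ)` of the
`Lᵟ`-theory `U`. -/
def Expresses (ι : FirstOrder.Language.ring →ᴸ L) (U : (withDelta L).Theory) (σ : (withDelta L).Sentence)
    (P : DiffProperty.{u, v, w} L) : Prop :=
  ∀ (M : Type w) [Field M] [Ring.CompatibleRing M] [L.Structure M] [derLang.Structure M]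
    [ι.IsExpansionOn M], M ⊨ U → (M ⊨ σ ↔ P M (delta M))

/-- Modulo `U`, every instance of the scheme `S` is expressed by an `Lᵟ`-sentence. -/
def IsFirstOrder (ι : FirstOrder.Language.ring →ᴸ L) (U : (withDelta L).Theory)
    (S : Set (DiffProperty.{u, v, w} L)) : Prop :=
  ∀ P ∈ S, ∃ σ : (withDelta L).Sentence, Expresses ι U σ P

/-- The `Lᵟ`-theory `U ∪ S`: the theory `U` together with the sentences that express (modulo `U`)
the instances of the scheme `S`. -/
def withScheme (ι : FirstOrder.Language.ring →ᴸ L) (U : (withDelta L).Theory)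
    (S : Set (DiffProperty.{u, v, w} L)) : (withDelta L).Theory :=
  U ∪ {σ | ∃ P ∈ S, Expresses ι U σ P}

variable (ι : FirstOrder.Language.ring →ᴸ L) {K : Type w} [Field K] [Ring.CompatibleRing K] [L.Structure K]
  [ι.IsExpansionOn K] (η : Derivation ℤ (dclEmpty ι K) (dclEmpty ι K))

/-- `Tᵟ` together with the scheme "deep". -/
def TDeep : (withDelta L).Theory :=
  withScheme ι (Tdelta ι η) (deepScheme.{u, v, max u v w} L)

/-- `Tᵟ` together with the scheme "wide". -/
def TWide : (withDelta L).Theory :=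
  withScheme ι (Tdelta ι η) (wideScheme.{u, v, max u v w} L)

/-- `Tᵟ` together with the Pierce-Pillay scheme. -/
def TPP : (withDelta L).Theory :=
  withScheme ι (Tdelta ι η) (ppScheme.{u, v, max u v w} L)

end Schemes

/-! ### Model completeness and model completions -/

section ModelCompletion

variable {L : FirstOrder.Language.{u, v}}

/-- `U` is model complete: all embeddings between models of `U` are elementary. -/
def IsModelComplete (U : L.Theory) : Prop :=
  ∀ (A B : Type w) [L.Structure A] [L.Structure B], A ⊨ U → B ⊨ U →
    ∀ (f : A ↪[L] B) (n : ℕ) (ψ : L.Formula (Fin n)) (a : Fin n → A),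
      ψ.Realize (f ∘ a) ↔ ψ.Realize a

/-- `U'` is a model completion of `U`. -/
structure IsModelCompletion (U U' : L.Theory) : Prop where
  models : ∀ (A : Type w) [L.Structure A], A ⊨ U' → A ⊨ U
  extends_to : ∀ (A : Type w) [L.Structure A], A ⊨ U →
    ∃ (B : Type w) (_ : L.Structure B), B ⊨ U' ∧ Nonempty (A ↪[L] B)
  elementarilyEquivalent_over : ∀ (A B C : Type w) [L.Structure A] [L.Structure B]
    [L.Structure C], A ⊨ U → B ⊨ U' → C ⊨ U' → ∀ (f : A ↪[L] B) (g : A ↪[L] C)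
      (n : ℕ) (ψ : L.Formula (Fin n)) (a : Fin n → A),
      ψ.Realize (f ∘ a) ↔ ψ.Realize (g ∘ a)

/-- The theories `U` and `U'` have the same models. -/
def SameModels (U U' : L.Theory) : Prop :=
  ∀ (M : Type w) [L.Structure M], M ⊨ U ↔ M ⊨ U'

end ModelCompletion

end GenericDerivation

open GenericDerivation

universe u' v'

set_option linter.unusedSectionVars false

/-! ### A calculus of uniformly definable predicates and functions. -/

namespace GenericDerivation

/-! ### Uniformly definable predicates on a family of structures -/

section UniformlyDefinable

variable {L : FirstOrder.Language.{u, v}} {I : Type*} {C : I → Type*} [∀ i, L.Structure (C i)]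
  {α β γ : Type*}

/-! Everything is reduced to one condition on a model of `Tᵟ`, namely `DM.IsDeep`. The geometric
input is as follows. By algebraic boundedness "there are infinitely many" is definable uniformly in
all models of `T`, hence so are full dimension (described recursively by `Big`) and dimension itself
(`le_dim_iff`, `UDef.le_dim`). Over an elementary submodel, `acl` is relative algebraic closure in
the sense of fields. Big sets are Zariski dense, so by compactness they have points, in an
elementary extension, whose coordinates are algebraically independent over the base. In
characteristic 0 a derivation extends to any larger field, with arbitrary values on algebraically
independent elements (`exists_derivation_extension`).

Deep extensions: all instances of "deep" whose hypothesis holds in `M` are realized at once by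
tuples whose non-final coordinates are jointly independent over `M`, and the new derivation moves
each such coordinate to the next one. Repeating this ω times and taking the union of the elementary
chain gives `DM.exists_deep_extension`.

Elimination: in deep models every `Lᵟ`-formula is an `L`-formula in the jets of its variables
(`jetDef_realize`). Consider `∃ c, S(x, δx, …, c, δc, …, δᵐc)`. If the projection of `S` to the
first `m` coordinates is big, "deep" supplies `c`. Otherwise some `δᵏc` with `k < m` lies in a
finite set definable over the jet of `x` and `c, …, δᵏ⁻¹c`. Differentiating a polynomial equation
for it makes all higher derivatives definable from the jet of `x` and `c, …, δᵏc`, so the order of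
the problem drops. Consequently an `L`-elementary extension of deep models that respects `δ` is
`Lᵟ`-elementary (`UDef.iff_of_elementary`).

Comparison: "PP" with no polynomials is "wide", and "wide" gives "deep" by coding jets as pairs.
Conversely, let `M` be deep and let an instance of "PP" be given. A generic point `a` of the
projection of `X`, in an elementary extension, has `dim W` independent coordinates, which is also
the dimension of the tangent space at the regular point `a`. So a derivation is determined on `a` by
its values on these coordinates, and every `y` in the twisted fibre is `Da` for some extension `D`
(`exists_derivation_of_twistedMem`). A deep extension of this differential field contains `M`
elementarily, so the solution descends to `M`.

The schemes are first order because dimension and tangent spaces are definable. For the model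
completion, existence is the deep extension and uniqueness is the elimination, since model
completeness of `T` makes `L`-embeddings elementary. -/

/-- A predicate on `α`-tuples of the members of a family of `L`-structures is uniformly definable if
it is defined by one `L`-formula in all members of the family. -/
def UDef (L : FirstOrder.Language.{u, v}) {I : Type*} (C : I → Type*) [∀ i, L.Structure (C i)]
    {α : Type*} (R : ∀ i, (α → C i) → Prop) : Prop :=
  ∃ φ : L.Formula α, ∀ i a, φ.Realize a ↔ R i a

/-- A function of `α`-tuples is uniformly definable if its graph is. -/
def UFun (L : FirstOrder.Language.{u, v}) {I : Type*} (C : I → Type*) [∀ i, L.Structure (C i)]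
    {α : Type*} (g : ∀ i, (α → C i) → C i) : Prop :=
  UDef L C (fun i (v : α ⊕ Unit → C i) => v (Sum.inr ()) = g i (v ∘ Sum.inl))

theorem UDef.congr {R S : ∀ i, (α → C i) → Prop} (h : UDef L C R) (e : ∀ i a, R i a ↔ S i a) :
    UDef L C S := by
  obtain ⟨φ, hφ⟩ := h
  exact ⟨φ, fun i a => (hφ i a).trans (e i a)⟩

theorem UDef.comap {R : ∀ i, (α → C i) → Prop} (h : UDef L C R) (g : α → β) :
    UDef L C (fun i (v : β → C i) => R i (v ∘ g)) := by
  obtain ⟨φ, hφ⟩ := h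
  refine ⟨φ.relabel g, fun i a => ?_⟩
  rw [Formula.realize_relabel, hφ]

theorem UDef.restrict {J : Type*} {R : ∀ i, (α → C i) → Prop} (h : UDef L C R) (g : J → I) :
    UDef L (fun j => C (g j)) (fun j v => R (g j) v) := by
  obtain ⟨φ, hφ⟩ := h
  exact ⟨φ, fun i a => hφ _ _⟩

theorem UDef.formula (φ : L.Formula α) : UDef L C (fun _ v => φ.Realize v) := ⟨φ, fun _ _ => Iff.rfl⟩

theorem UDef.not {R : ∀ i, (α → C i) → Prop} (h : UDef L C R) : UDef L C (fun i v => ¬ R i v) := by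
  obtain ⟨φ, hφ⟩ := h
  exact ⟨φ.not, fun i a => by rw [Formula.realize_not, hφ]⟩

theorem UDef.and {R S : ∀ i, (α → C i) → Prop} (h : UDef L C R) (h' : UDef L C S) :
    UDef L C (fun i v => R i v ∧ S i v) := by
  obtain ⟨φ, hφ⟩ := h
  obtain ⟨ψ, hψ⟩ := h'
  exact ⟨φ ⊓ ψ, fun i a => by rw [Formula.realize_inf, hφ, hψ]⟩

theorem UDef.or {R S : ∀ i, (α → C i) → Prop} (h : UDef L C R) (h' : UDef L C S) :
    UDef L C (fun i v => R i v ∨ S i v) := by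
  obtain ⟨φ, hφ⟩ := h
  obtain ⟨ψ, hψ⟩ := h'
  exact ⟨φ ⊔ ψ, fun i a => by rw [Formula.realize_sup, hφ, hψ]⟩

theorem UDef.imp {R S : ∀ i, (α → C i) → Prop} (h : UDef L C R) (h' : UDef L C S) :
    UDef L C (fun i v => R i v → S i v) := by
  obtain ⟨φ, hφ⟩ := h
  obtain ⟨ψ, hψ⟩ := h'
  exact ⟨φ.imp ψ, fun i a => by rw [Formula.realize_imp, hφ, hψ]⟩

theorem UDef.iff {R S : ∀ i, (α → C i) → Prop} (h : UDef L C R) (h' : UDef L C S) :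
    UDef L C (fun i v => R i v ↔ S i v) :=
  ((h.imp h').and (h'.imp h)).congr fun _ _ => iff_iff_implies_and_implies.symm

theorem UDef.false : UDef L C (fun i (_ : α → C i) => False) :=
  ⟨⊥, fun _ _ => by simp⟩

theorem UDef.const (p : Prop) : UDef L C (fun i (_ : α → C i) => p) := by
  by_cases hp : p
  · exact UDef.false.not.congr fun _ _ => by simp [hp]
  · exact UDef.false.congr fun _ _ => by simp [hp]

theorem UDef.ex [Finite β] {R : ∀ i, (α → C i) → (β → C i) → Prop}
    (h : UDef L C (fun i (v : α ⊕ β → C i) => R i (v ∘ Sum.inl) (v ∘ Sum.inr))) :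
    UDef L C (fun i v => ∃ b : β → C i, R i v b) := by
  obtain ⟨φ, hφ⟩ := h
  refine ⟨φ.iExs β, fun i a => ?_⟩
  rw [Formula.realize_iExs]
  simp [hφ]

theorem UDef.all [Finite β] {R : ∀ i, (α → C i) → (β → C i) → Prop}
    (h : UDef L C (fun i (v : α ⊕ β → C i) => R i (v ∘ Sum.inl) (v ∘ Sum.inr))) :
    UDef L C (fun i v => ∀ b : β → C i, R i v b) :=
  (UDef.ex (R := fun i v b => ¬ R i v b) h.not).not.congr fun _ _ => by simp

theorem UDef.ex1 {R : ∀ i, (α → C i) → C i → Prop}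
    (h : UDef L C (fun i (v : α ⊕ Unit → C i) => R i (v ∘ Sum.inl) (v (Sum.inr ())))) :
    UDef L C (fun i v => ∃ b : C i, R i v b) :=
  (UDef.ex (β := Unit) (R := fun i v b => R i v (b ())) h).congr fun _ _ =>
    ⟨fun ⟨_, hb⟩ => ⟨_, hb⟩, fun ⟨b, hb⟩ => ⟨fun _ => b, hb⟩⟩

theorem UDef.all1 {R : ∀ i, (α → C i) → C i → Prop}
    (h : UDef L C (fun i (v : α ⊕ Unit → C i) => R i (v ∘ Sum.inl) (v (Sum.inr ())))) :
    UDef L C (fun i v => ∀ b : C i, R i v b) :=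
  (UDef.ex1 (R := fun i v b => ¬ R i v b) h.not).not.congr fun _ _ => by simp

theorem UDef.iEx {J : Type*} [Finite J] {R : J → ∀ i, (α → C i) → Prop}
    (h : ∀ j, UDef L C (R j)) : UDef L C (fun i v => ∃ j, R j i v) := by
  choose φ hφ using h
  exact ⟨Formula.iSup φ, fun i a => by simp [Formula.realize_iSup, hφ]⟩

theorem UDef.iAll {J : Type*} [Finite J] {R : J → ∀ i, (α → C i) → Prop}
    (h : ∀ j, UDef L C (R j)) : UDef L C (fun i v => ∀ j, R j i v) := by
  choose φ hφ using h
  exact ⟨Formula.iInf φ, fun i a => by simp [Formula.realize_iInf, hφ]⟩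

theorem UDef.of_ufun {g : ∀ i, (α → C i) → C i} (h : UFun L C g) (a : α) :
    UDef L C (fun i v => v a = g i v) :=
  UDef.comap h (Sum.elim id fun _ => a)

theorem UFun.term (t : L.Term α) : UFun L C (fun _ v => t.realize v) :=
  ⟨(Term.var (Sum.inr ())).equal (t.relabel Sum.inl), fun i a => by
    simp [Formula.realize_equal]⟩

theorem UFun.var (a : α) : UFun L C (fun _ v => v a) := UFun.term (Term.var a)

theorem UFun.comap {g : ∀ i, (α → C i) → C i} (h : UFun L C g) (f : α → β) :
    UFun L C (fun i v => g i (v ∘ f)) :=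
  UDef.comap h (Sum.map f id)

/-- The values of the functions are quantified existentially, which is why only finitely many may be
substituted. -/
theorem UDef.subst [Finite β] {R : ∀ i, (β → C i) → Prop} (h : UDef L C R)
    {g : β → ∀ i, (α → C i) → C i} (hg : ∀ b, UFun L C (g b)) :
    UDef L C (fun i v => R i (fun b => g b i v)) := by
  have h1 : UDef L C (fun i (v : α ⊕ β → C i) =>
      (∀ b, v (Sum.inr b) = g b i (v ∘ Sum.inl)) ∧ R i (v ∘ Sum.inr)) := by
    refine UDef.and (UDef.iAll fun b => ?_) (h.comap _)
    exact UDef.of_ufun ((hg b).comap Sum.inl) (Sum.inr b)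
  refine (UDef.ex (R := fun i v c => (∀ b, c b = g b i v) ∧ R i c) h1).congr fun i v => ?_
  constructor
  · rintro ⟨c, hc, hR⟩
    rwa [funext hc] at hR
  · exact fun hR => ⟨_, fun _ => rfl, hR⟩

theorem UFun.subst [Finite β] {f : ∀ i, (β → C i) → C i} (h : UFun L C f)
    {g : β → ∀ i, (α → C i) → C i} (hg : ∀ b, UFun L C (g b)) :
    UFun L C (fun i v => f i (fun b => g b i v)) :=
  UDef.subst h (g := fun b => Sum.elim (fun b i (v : α ⊕ Unit → C i) => g b i (v ∘ Sum.inl))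
    (fun u i v => v (Sum.inr u)) b) (by
      rintro (b | u)
      · exact (hg b).comap _
      · exact UFun.var _)

theorem UDef.eq {f g : ∀ i, (α → C i) → C i} (hf : UFun L C f) (hg : UFun L C g) :
    UDef L C (fun i v => f i v = g i v) := by
  have := UDef.subst (C := C) (α := α) (L := L) (β := Fin 2) (R := fun i v => v 0 = v 1)
    (UDef.of_ufun (UFun.var 1) 0) (g := ![f, g]) (fun b => by fin_cases b <;> assumption)
  exact this

theorem UFun.map₂ {f : ∀ i, C i → C i → C i} (h : UFun L C (fun i (v : Fin 2 → C i) => f i (v 0) (v 1)))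
    {a b : ∀ i, (α → C i) → C i} (ha : UFun L C a) (hb : UFun L C b) :
    UFun L C (fun i v => f i (a i v) (b i v)) :=
  UFun.subst h (g := ![a, b]) (fun b => by fin_cases b <;> assumption)

/-- A formula has finitely many free variables. This makes it possible to work with infinite index
types such as jets or whole parameter sets and to return to finite tuples when quantifying. -/
theorem UDef.finite_support {R : ∀ i, (α → C i) → Prop} (h : UDef L C R) :
    ∃ (s : Finset α) (R' : ∀ i, (s → C i) → Prop), UDef L C R' ∧
      ∀ i v, R i v ↔ R' i (fun a => v a) := by
  classical
  obtain ⟨φ, hφ⟩ := h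
  refine ⟨φ.freeVarFinset, fun i v => Formula.Realize (φ.restrictFreeVar id) v, ⟨_, fun _ _ => Iff.rfl⟩,
    fun i v => ?_⟩
  rw [← hφ]
  exact (BoundedFormula.realize_restrictFreeVar v (by simp)).symm

/-- Transfer of definability along an expansion of languages. -/
theorem UDef.lhom {L' : FirstOrder.Language.{u', v'}} [∀ i, L'.Structure (C i)] (j : L →ᴸ L')
    [∀ i, j.IsExpansionOn (C i)] {R : ∀ i, (α → C i) → Prop} (h : UDef L C R) : UDef L' C R := by
  obtain ⟨φ, hφ⟩ := h
  exact ⟨j.onFormula φ, fun i a => by rw [LHom.realize_onFormula, hφ]⟩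

theorem UFun.lhom {L' : FirstOrder.Language.{u', v'}} [∀ i, L'.Structure (C i)] (j : L →ᴸ L')
    [∀ i, j.IsExpansionOn (C i)] {g : ∀ i, (α → C i) → C i} (h : UFun L C g) : UFun L' C g :=
  UDef.lhom j h

end UniformlyDefinable

end GenericDerivation

/-! ### Models of `T` as expanded fields, and transfer between them. -/

namespace GenericDerivation

/-! ### Models of the theory of an expansion of a field -/

section Models

variable {L : FirstOrder.Language.{u, v}}

/-- A model of the complete `L`-theory of `K`, with its field structure. -/
structure TM (ι : FirstOrder.Language.ring →ᴸ L) (K : Type w) [L.Structure K] where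
  carrier : Type (max u v w)
  [fld : Field carrier]
  [cring : Ring.CompatibleRing carrier]
  [str : L.Structure carrier]
  [expn : ι.IsExpansionOn carrier]
  model : carrier ⊨ L.completeTheory K

attribute [instance] TM.fld TM.cring TM.str TM.expn

instance {ι : FirstOrder.Language.ring →ᴸ L} {K : Type w} [L.Structure K] :
    CoeSort (TM ι K) (Type (max u v w)) := ⟨TM.carrier⟩

variable (ι : FirstOrder.Language.ring →ᴸ L) {K : Type w} [Field K] [Ring.CompatibleRing K]
  [L.Structure K] [ι.IsExpansionOn K]

theorem field_model_reduct {M : Type*} [L.Structure M] (h : M ⊨ L.completeTheory K) :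
    @Theory.Model FirstOrder.Language.ring M (ι.reduct M) Theory.field := by
  let _ := ι.reduct M
  have := LHom.isExpansionOn_reduct ι M
  refine ⟨fun φ hφ => ?_⟩
  rw [← LHom.realize_onSentence M ι φ]
  refine h.realize_of_mem _ ?_
  rw [mem_completeTheory, LHom.realize_onSentence]
  exact Theory.realize_sentence_of_mem Theory.field hφ

/-- Every model of the complete theory of `K` carries a field structure. -/
noncomputable abbrev TM.ofModel {M : Type (max u v w)} [S : L.Structure M]
    (h : M ⊨ L.completeTheory K) : TM ι K :=
  letI := ι.reduct M
  letI := field_model_reduct ι h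
  { carrier := M
    fld := FirstOrder.Field.fieldOfModelField M
    cring := FirstOrder.Field.compatibleRingOfModelField M
    str := S
    expn := LHom.isExpansionOn_reduct ι M
    model := h }

/-- A copy of `K` in the universe of the models. -/
theorem exists_tm_equiv (K : Type w) [Field K] [Ring.CompatibleRing K]
    [L.Structure K] [ι.IsExpansionOn K] : ∃ A : TM ι K, Nonempty (K ≃[L] A) := by
  let e : K ≃ ULift.{max u v} K := Equiv.ulift.symm
  let _ : L.Structure (ULift.{max u v} K) := Equiv.inducedStructure e
  have e' : K ≃[L] ULift.{max u v} K := Equiv.inducedStructureEquiv e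
  have h : ULift.{max u v} K ⊨ L.completeTheory K :=
    (e'.toElementaryEmbedding.theory_model_iff _).1 inferInstance
  exact ⟨TM.ofModel (M := ULift.{max u v} K) ι h, ⟨e'⟩⟩

variable {ι} {α : Type*}

/-- With no variables the predicate is a sentence, and a complete theory decides it. Together with
`exists_tm_equiv` this carries facts from `K` to all models. -/
theorem UDef.transfer {R : ∀ M : TM ι K, (Empty → M) → Prop} (h : UDef L (fun M : TM ι K => M) R)
    (M N : TM ι K) {a : Empty → M} {b : Empty → N} (hM : R M a) : R N b := by
  obtain ⟨φ, hφ⟩ := h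
  obtain rfl : a = default := Subsingleton.elim _ _
  obtain rfl : b = default := Subsingleton.elim _ _
  rw [← hφ] at hM ⊢
  have hK : φ ∈ L.completeTheory K := by
    by_contra hn
    rw [mem_completeTheory] at hn
    have : M.carrier ⊨ (Formula.not φ : L.Sentence) := M.model.realize_of_mem _ (by
      rw [mem_completeTheory]; simpa [Sentence.Realize] using hn)
    rw [Sentence.Realize, Formula.realize_not] at this
    exact this hM
  exact N.model.realize_of_mem _ hK

theorem UDef.elementary {R : ∀ M : TM ι K, (α → M) → Prop} (h : UDef L (fun M : TM ι K => M) R)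
    {M N : TM ι K} (f : M ↪ₑ[L] N) (a : α → M) : R N (f ∘ a) ↔ R M a := by
  obtain ⟨φ, hφ⟩ := h
  rw [← hφ, ← hφ, f.map_formula]

/-! ### Ring operations are uniformly definable -/

section RingOps

variable {I : Type*} {T : I → TM ι K}

theorem UFun.add {f g : ∀ i, (α → T i) → T i} (hf : UFun L (fun i => T i) f)
    (hg : UFun L (fun i => T i) g) : UFun L (fun i => T i) (fun i v => f i v + g i v) := by
  refine UFun.map₂ (f := fun i a b => a + b) ?_ hf hg
  have := UFun.lhom ι (UFun.term (C := fun i => T i)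
    (Term.var 0 + Term.var 1 : FirstOrder.Language.ring.Term (Fin 2)))
  simpa using this

theorem UFun.mul {f g : ∀ i, (α → T i) → T i} (hf : UFun L (fun i => T i) f)
    (hg : UFun L (fun i => T i) g) : UFun L (fun i => T i) (fun i v => f i v * g i v) := by
  refine UFun.map₂ (f := fun i a b => a * b) ?_ hf hg
  have := UFun.lhom ι (UFun.term (C := fun i => T i)
    (Term.var 0 * Term.var 1 : FirstOrder.Language.ring.Term (Fin 2)))
  simpa using this

theorem UFun.zero : UFun L (fun i => T i) (fun i (_ : α → T i) => 0) := by
  have := UFun.lhom ι (UFun.term (C := fun i => T i) (0 : FirstOrder.Language.ring.Term α))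
  simpa using this

theorem UFun.one : UFun L (fun i => T i) (fun i (_ : α → T i) => 1) := by
  have := UFun.lhom ι (UFun.term (C := fun i => T i) (1 : FirstOrder.Language.ring.Term α))
  simpa using this

theorem UFun.pow {f : ∀ i, (α → T i) → T i} (hf : UFun L (fun i => T i) f) (n : ℕ) :
    UFun L (fun i => T i) (fun i v => f i v ^ n) := by
  induction n with
  | zero => simpa using UFun.one
  | succ n ih => simpa [pow_succ] using ih.mul hf

theorem UFun.sum {β : Type*} (s : Finset β) {f : β → ∀ i, (α → T i) → T i}
    (hf : ∀ b ∈ s, UFun L (fun i => T i) (f b)) :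
    UFun L (fun i => T i) (fun i v => ∑ b ∈ s, f b i v) := by
  classical
  induction s using Finset.induction_on with
  | empty => simpa using UFun.zero
  | insert b s hb ih =>
    simp only [Finset.sum_insert hb]
    exact (hf b (by simp)).add (ih fun c hc => hf c (by simp [hc]))

theorem UFun.prod {β : Type*} (s : Finset β) {f : β → ∀ i, (α → T i) → T i}
    (hf : ∀ b ∈ s, UFun L (fun i => T i) (f b)) :
    UFun L (fun i => T i) (fun i v => ∏ b ∈ s, f b i v) := by
  classical
  induction s using Finset.induction_on with
  | empty => simpa using UFun.one
  | insert b s hb ih =>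
    simp only [Finset.prod_insert hb]
    exact (hf b (by simp)).mul (ih fun c hc => hf c (by simp [hc]))

theorem UFun.natCast (n : ℕ) : UFun L (fun i => T i) (fun i (_ : α → T i) => (n : T i)) := by
  induction n with
  | zero => simpa using UFun.zero
  | succ n ih => simpa using ih.add UFun.one

end RingOps

/-- A homomorphism of expansions of fields is a ring homomorphism. -/
def ringHomOfHom {M N : Type*} [Field M] [Ring.CompatibleRing M] [L.Structure M]
    [ι.IsExpansionOn M] [Field N] [Ring.CompatibleRing N] [L.Structure N] [ι.IsExpansionOn N]
    (f : M →[L] N) : M →+* N :=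
  have h {n : ℕ} (s : Language.ring.Functions n) (x : Fin n → M) :
      f (Structure.funMap s x) = Structure.funMap s (f ∘ x) := by
    have := f.map_fun (ι.onFunction s) x
    rwa [LHom.map_onFunction, LHom.map_onFunction] at this
  { toFun := f
    map_add' := fun x y => by simpa using h Ring.addFunc ![x, y]
    map_mul' := fun x y => by simpa using h Ring.mulFunc ![x, y]
    map_zero' := by
      have := h Ring.zeroFunc ![]
      rwa [Ring.CompatibleRing.funMap_zero, Ring.CompatibleRing.funMap_zero] at this
    map_one' := by
      have := h Ring.oneFunc ![]
      rwa [Ring.CompatibleRing.funMap_one, Ring.CompatibleRing.funMap_one] at this }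

theorem TM.charZero [CharZero K] (M : TM ι K) : CharZero M := by
  obtain ⟨A, ⟨e⟩⟩ := exists_tm_equiv ι K
  refine charZero_of_inj_zero fun n hn => ?_
  by_contra h0
  have : UDef L (fun M : TM ι K => M) (fun M (_ : Empty → M) => (n : M) = 0) :=
    UDef.eq (UFun.natCast (T := fun M : TM ι K => M) n) (UFun.zero (T := fun M : TM ι K => M))
  have h1 : (n : A) = 0 := this.transfer M A (a := default) (b := default) hn
  rw [← map_natCast (ringHomOfHom (ι := ι) e.toHom), map_eq_zero] at h1
  exact h0 (by exact_mod_cast h1)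

end Models
end GenericDerivation

/-! ### Transfer of algebraic boundedness from `K` to all models. -/

namespace GenericDerivation

section AlgebraicBoundedness

variable {L : FirstOrder.Language.{u, v}} {ι : FirstOrder.Language.ring →ᴸ L} {K : Type w} [Field K]
  [Ring.CompatibleRing K] [L.Structure K] [ι.IsExpansionOn K] {α β : Type*}

/-! ### The interpretation of `dcl(∅)` in all models -/

theorem exists_formula_of_mem_dclEmpty (a : dclEmpty ι K) :
    ∃ φ : L.Formula (Fin 1), ∀ x : K, φ.Realize (fun _ => x) ↔ x = a := by
  have h : (∅ : Set K).Definable L {x : Fin 1 → K | x 0 ∈ ({(a : K)} : Set K)} := a.2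
  obtain ⟨φ, hφ⟩ := Set.empty_definable_iff.1 h
  exact ⟨φ, fun x => (Set.ext_iff.1 hφ fun _ => x).symm⟩

/-- A formula that defines the element `a` of `dcl(∅)`. -/
noncomputable def dclFormula (a : dclEmpty ι K) : L.Formula (Fin 1) :=
  (exists_formula_of_mem_dclEmpty a).choose

theorem realize_dclFormula (a : dclEmpty ι K) (x : K) :
    (dclFormula a).Realize (fun _ => x) ↔ x = a :=
  (exists_formula_of_mem_dclEmpty a).choose_spec x

theorem realize_equiv_of_defines {φ : L.Formula (Fin 1)} {a : K}
    (h : ∀ x : K, φ.Realize (fun _ => x) ↔ x = a) {A : TM ι K} (e : K ≃[L] A) (y : A) :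
    φ.Realize (fun _ => y) ↔ y = e a := by
  obtain ⟨x, rfl⟩ := e.surjective y
  rw [show (fun _ : Fin 1 => e x) = e ∘ (fun _ => x) from rfl, StrongHomClass.realize_formula, h]
  exact e.injective.eq_iff.symm

theorem existsUnique_of_defines (M : TM ι K) {φ : L.Formula (Fin 1)} {a : K}
    (h : ∀ x : K, φ.Realize (fun _ => x) ↔ x = a) : ∃! y : M, φ.Realize (fun _ => y) := by
  obtain ⟨A, ⟨e⟩⟩ := exists_tm_equiv ι K
  have h1 : UDef L (fun M : TM ι K => M) (fun M (_ : Empty → M) =>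
      ∃ y : M, φ.Realize (fun _ => y) ∧ ∀ z : M, φ.Realize (fun _ => z) → z = y) := by
    refine UDef.ex1 (UDef.and ((UDef.formula φ).comap fun _ => Sum.inr ()) (UDef.all1 ?_))
    exact UDef.imp ((UDef.formula φ).comap fun _ => Sum.inr ())
      (UDef.eq (UFun.var (Sum.inr ())) (UFun.var (Sum.inl (Sum.inr ()))))
  refine h1.transfer A M (a := default) (b := default) ⟨e a, ?_, fun z hz => ?_⟩
  · exact (realize_equiv_of_defines h e _).2 rfl
  · exact (realize_equiv_of_defines h e _).1 hz

/-- The element of `M` that corresponds to the element `a` of `dcl(∅)`. -/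
noncomputable def TM.sigmaFun (M : TM ι K) (a : dclEmpty ι K) : M :=
  (existsUnique_of_defines M (realize_dclFormula a)).choose

theorem TM.sigmaFun_iff (M : TM ι K) (a : dclEmpty ι K) (y : M) :
    (dclFormula a).Realize (fun _ => y) ↔ y = M.sigmaFun a :=
  ⟨fun h => (existsUnique_of_defines M (realize_dclFormula a)).choose_spec.2 y h,
    fun h => h ▸ (existsUnique_of_defines M (realize_dclFormula a)).choose_spec.1⟩

theorem TM.sigmaFun_equiv {A : TM ι K} (e : K ≃[L] A) (a : dclEmpty ι K) :
    A.sigmaFun a = e a :=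
  ((A.sigmaFun_iff a _).1 ((realize_equiv_of_defines (realize_dclFormula a) e _).2 rfl)).symm

theorem UFun.sigmaFun (a : dclEmpty ι K) :
    UFun L (fun M : TM ι K => M) (fun M (_ : α → M) => M.sigmaFun a) :=
  ((UDef.formula (dclFormula a)).comap fun _ => Sum.inr ()).congr fun M _ => M.sigmaFun_iff a _

theorem TM.sigmaFun_add (M : TM ι K) (a b : dclEmpty ι K) :
    M.sigmaFun (a + b) = M.sigmaFun a + M.sigmaFun b := by
  obtain ⟨A, ⟨e⟩⟩ := exists_tm_equiv ι K
  have h := UDef.eq (α := Empty) (UFun.sigmaFun (a + b))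
    (UFun.add (T := fun M : TM ι K => M) (UFun.sigmaFun a) (UFun.sigmaFun b))
  refine h.transfer A M (a := default) (b := default) ?_
  simp only [sigmaFun_equiv e]
  exact map_add (ringHomOfHom (ι := ι) e.toHom) _ _

theorem TM.sigmaFun_mul (M : TM ι K) (a b : dclEmpty ι K) :
    M.sigmaFun (a * b) = M.sigmaFun a * M.sigmaFun b := by
  obtain ⟨A, ⟨e⟩⟩ := exists_tm_equiv ι K
  have h := UDef.eq (α := Empty) (UFun.sigmaFun (a * b))
    (UFun.mul (T := fun M : TM ι K => M) (UFun.sigmaFun a) (UFun.sigmaFun b))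
  refine h.transfer A M (a := default) (b := default) ?_
  simp only [sigmaFun_equiv e]
  exact map_mul (ringHomOfHom (ι := ι) e.toHom) _ _

theorem TM.sigmaFun_one (M : TM ι K) : M.sigmaFun (1 : dclEmpty ι K) = 1 := by
  obtain ⟨A, ⟨e⟩⟩ := exists_tm_equiv ι K
  have h := UDef.eq (α := Empty) (UFun.sigmaFun (1 : dclEmpty ι K))
    (UFun.one (T := fun M : TM ι K => M))
  refine h.transfer A M (a := default) (b := default) ?_
  simp only [sigmaFun_equiv e]
  exact map_one (ringHomOfHom (ι := ι) e.toHom)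

/-- The embedding of `dcl(∅)` into a model. -/
noncomputable def TM.sigma (M : TM ι K) : dclEmpty ι K →+* M :=
  RingHom.mk' { toFun := M.sigmaFun, map_one' := M.sigmaFun_one, map_mul' := M.sigmaFun_mul }
    M.sigmaFun_add

theorem TM.sigma_equiv {A : TM ι K} (e : K ≃[L] A) (a : dclEmpty ι K) :
    A.sigma a = e a := TM.sigmaFun_equiv e a

theorem UFun.sigma (a : dclEmpty ι K) :
    UFun L (fun M : TM ι K => M) (fun M (_ : α → M) => M.sigma a) := UFun.sigmaFun a

/-- The interpretation of `a` does not depend on the chosen `dclFormula`. This is needed because the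
axioms of `Tdelta` range over all defining formulas. -/
theorem TM.sigma_iff (M : TM ι K) {φ : L.Formula (Fin 1)} {a : dclEmpty ι K}
    (h : ∀ x : K, φ.Realize (fun _ => x) ↔ x = a) (y : M) :
    φ.Realize (fun _ => y) ↔ y = M.sigma a := by
  obtain ⟨A, ⟨e⟩⟩ := exists_tm_equiv ι K
  have h1 : UDef L (fun M : TM ι K => M) (fun M (_ : Empty → M) =>
      ∀ y : M, φ.Realize (fun _ => y) ↔ y = M.sigma a) :=
    UDef.all1 (UDef.iff ((UDef.formula φ).comap fun _ => Sum.inr ())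
      (UDef.eq (UFun.var (Sum.inr ())) (UFun.sigma a)))
  refine h1.transfer A M (a := default) (b := default) ?_ y
  intro y
  rw [TM.sigma_equiv e, realize_equiv_of_defines h e]

theorem TM.map_sigma {M N : TM ι K} (f : M ↪ₑ[L] N) (a : dclEmpty ι K) :
    f (M.sigma a) = N.sigma a := by
  rw [← N.sigma_iff (realize_dclFormula a)]
  have := (f.map_formula (dclFormula a) (fun _ => M.sigma a)).2
    ((M.sigma_iff (realize_dclFormula a) _).2 rfl)
  exact this

/-! ### Algebraic boundedness in all models -/

/-- The univariate polynomial over `M` obtained by substituting `x` in the coefficients. -/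
noncomputable def TM.spec (M : TM ι K) (x : β → M) (p : Polynomial (MvPolynomial β (dclEmpty ι K))) :
    Polynomial M := p.map (MvPolynomial.eval₂Hom M.sigma x)

theorem UFun.eval₂ (c : MvPolynomial β (dclEmpty ι K)) :
    UFun L (fun M : TM ι K => M) (fun M (x : β → M) => MvPolynomial.eval₂Hom M.sigma x c) := by
  induction c using MvPolynomial.induction_on with
  | C a => simpa using UFun.sigma a
  | add p q hp hq => simpa using UFun.add (T := fun M : TM ι K => M) hp hq
  | mul_X p b hp => simpa using UFun.mul (T := fun M : TM ι K => M) hp (UFun.var b)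

theorem UFun.eval_spec (p : Polynomial (MvPolynomial β (dclEmpty ι K))) :
    UFun L (fun M : TM ι K => M)
      (fun M (v : β ⊕ Unit → M) => (M.spec (v ∘ Sum.inl) p).eval (v (Sum.inr ()))) := by
  simp only [TM.spec, Polynomial.eval_map, Polynomial.eval₂_eq_sum_range]
  exact UFun.sum (T := fun M : TM ι K => M) _ fun k _ =>
    UFun.mul (T := fun M : TM ι K => M) ((UFun.eval₂ _).comap Sum.inl)
      (UFun.pow (T := fun M : TM ι K => M) (UFun.var _) k)

theorem UDef.spec_ne_zero (p : Polynomial (MvPolynomial β (dclEmpty ι K))) :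
    UDef L (fun M : TM ι K => M) (fun M (x : β → M) => M.spec x p ≠ 0) := by
  have h : UDef L (fun M : TM ι K => M) (fun M (x : β → M) =>
      ∀ k : Fin (p.natDegree + 1), MvPolynomial.eval₂Hom M.sigma x (p.coeff k) = 0) :=
    UDef.iAll fun k => UDef.eq (UFun.eval₂ _) (UFun.zero (T := fun M : TM ι K => M))
  refine h.not.congr fun M x => not_congr ⟨fun h => ?_, fun h k => ?_⟩
  · ext k
    rw [TM.spec, Polynomial.coeff_map, Polynomial.coeff_zero]
    by_cases hk : k < p.natDegree + 1
    · exact h ⟨k, hk⟩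
    · rw [Polynomial.coeff_eq_zero_of_natDegree_lt (by omega), map_zero]
  · rw [← Polynomial.coeff_map]
    exact (congrArg (fun q => q.coeff k) h).trans (Polynomial.coeff_zero _)

theorem TM.natDegree_spec_le (M : TM ι K) (x : β → M)
    (p : Polynomial (MvPolynomial β (dclEmpty ι K))) : (M.spec x p).natDegree ≤ p.natDegree :=
  Polynomial.natDegree_map_le

/-- The set `S` has at least `k` elements. -/
def HasMany {M : Type*} (k : ℕ) (S : Set M) : Prop :=
  ∃ y : Fin k → M, Function.Injective y ∧ ∀ j, y j ∈ S

theorem hasMany_of_infinite {M : Type*} {S : Set M} (h : S.Infinite) (k : ℕ) : HasMany k S := by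
  have := h.to_subtype
  obtain ⟨f⟩ : Nonempty (ℕ ↪ S) := ⟨Infinite.natEmbedding S⟩
  exact ⟨fun j => f j, fun a b hab => Fin.ext (f.injective (Subtype.ext hab)), fun j => (f j).2⟩

theorem HasMany.le_ncard {M : Type*} {S : Set M} {k : ℕ} (h : HasMany k S) (hS : S.Finite) :
    k ≤ S.ncard := by
  obtain ⟨y, hy, hyS⟩ := h
  have : (Set.range y).ncard = k := by
    rw [← Set.image_univ, Set.ncard_image_of_injective _ hy, Set.ncard_univ, Nat.card_fin]
  rw [← this]
  exact Set.ncard_le_ncard (by rintro _ ⟨j, rfl⟩; exact hyS j) hS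

theorem UDef.hasMany (k : ℕ) {R : ∀ M : TM ι K, (β ⊕ Unit → M) → Prop}
    (h : UDef L (fun M : TM ι K => M) R) :
    UDef L (fun M : TM ι K => M)
      (fun M (x : β → M) => HasMany k {y | R M (Sum.elim x fun _ => y)}) := by
  refine UDef.ex (R := fun M x y => Function.Injective y ∧
    ∀ j, y j ∈ {y | R M (Sum.elim x fun _ => y)}) (UDef.and ?_ ?_)
  · refine (UDef.iAll (J := Fin k) fun i => UDef.iAll (J := Fin k) fun j =>
      UDef.imp (UDef.eq (UFun.var (Sum.inr i)) (UFun.var (Sum.inr j))) (UDef.const (i = j))).congr ?_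
    intro M v
    exact Iff.rfl
  · refine UDef.iAll fun j => (h.comap (Sum.elim Sum.inl fun _ => Sum.inr j)).congr fun M v => ?_
    rw [Set.mem_ofPred_eq]
    refine iff_of_eq (congrArg (R M) ?_)
    ext (b | u) <;> rfl

theorem UDef.finite_support_fibre {R : ∀ M : TM ι K, (β ⊕ Unit → M) → Prop}
    (h : UDef L (fun M : TM ι K => M) R) :
    ∃ (n : ℕ) (g : Fin n → β) (φ : L.Formula (Fin n ⊕ Fin 1)), ∀ (M : TM ι K) x y,
      R M (Sum.elim x fun _ => y) ↔ φ.Realize (Sum.elim (x ∘ g) fun _ => y) := by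
  classical
  obtain ⟨s, R', ⟨φ, hφ⟩, hR⟩ := h.finite_support
  let e := Fintype.equivFin s.toLeft
  refine ⟨_, fun i => (e.symm i : β), φ.relabel (fun a : s => match a with
    | ⟨Sum.inl b, hb⟩ => Sum.inl (e ⟨b, by simpa using hb⟩)
    | ⟨Sum.inr _, _⟩ => Sum.inr 0), fun M x y => ?_⟩
  rw [hR, ← hφ, Formula.realize_relabel]
  refine iff_of_eq (congrArg φ.Realize ?_)
  ext ⟨b | u, hb⟩ <;> simp

/-- Finiteness of a fibre is not visibly first order, so it is replaced by "fewer than `N`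
elements". In a copy of `K` a finite fibre consists of roots of one of finitely many polynomials,
hence is bounded in size. Both "`N` elements imply `k` elements", for each `k`, and "fewer than `N`
elements imply containment in a root set" are sentences and transfer. -/
theorem exists_polynomials (hK : IsAlgebraicallyBounded L (dclEmpty ι K))
    {R : ∀ M : TM ι K, (β ⊕ Unit → M) → Prop} (h : UDef L (fun M : TM ι K => M) R) :
    ∃ (m N : ℕ) (p : Fin m → Polynomial (MvPolynomial β (dclEmpty ι K))),
      ∀ (M : TM ι K) (x : β → M),
        (HasMany N {y | R M (Sum.elim x fun _ => y)} →
          {y | R M (Sum.elim x fun _ => y)}.Infinite) ∧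
        ({y | R M (Sum.elim x fun _ => y)}.Finite →
          ∃ i, M.spec x (p i) ≠ 0 ∧
            ∀ y, R M (Sum.elim x fun _ => y) → (M.spec x (p i)).eval y = 0) := by
  obtain ⟨n, g, φ, hφ⟩ := h.finite_support_fibre
  obtain ⟨m, p, hp⟩ := hK n φ
  let Q : ∀ M : TM ι K, (Fin n ⊕ Unit → M) → Prop :=
    fun M v => φ.Realize (Sum.elim (v ∘ Sum.inl) fun _ => v (Sum.inr ()))
  have hQ : UDef L (fun M : TM ι K => M) Q :=
    ((UDef.formula φ).comap (Sum.map id fun _ => ())).congr fun M v =>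
      iff_of_eq (congrArg φ.Realize (by ext (i | i) <;> rfl))
  -- One more than every degree, so that no nonzero specialization of a `p i` has `N` roots.
  let N := (Finset.univ.sup fun i => (p i).natDegree) + 1
  obtain ⟨A, ⟨e⟩⟩ := exists_tm_equiv ι K
  have key : ∀ (M : TM ι K) (x : Fin n → M),
      ({y | Q M (Sum.elim x fun _ => y)}.Finite →
          ∃ i, M.spec x (p i) ≠ 0 ∧
            ∀ y, Q M (Sum.elim x fun _ => y) → (M.spec x (p i)).eval y = 0) →
      HasMany N {y | Q M (Sum.elim x fun _ => y)} →
        {y | Q M (Sum.elim x fun _ => y)}.Infinite := by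
    intro M x h1 h2 hf
    obtain ⟨i, hi, hz⟩ := h1 hf
    have h3 := h2.le_ncard hf
    have h4 : {y | Q M (Sum.elim x fun _ => y)}.ncard ≤ (M.spec x (p i)).natDegree := by
      classical
      calc _ ≤ ((M.spec x (p i)).roots.toFinset : Set M).ncard :=
            Set.ncard_le_ncard (fun y hy => by simpa [hi] using hz y hy) (Finset.finite_toSet _)
        _ = (M.spec x (p i)).roots.toFinset.card := Set.ncard_coe_finset _
        _ ≤ _ := (Multiset.toFinset_card_le _).trans (Polynomial.card_roots' _)
    have h5 := M.natDegree_spec_le x (p i)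
    have h6 : (p i).natDegree ≤ Finset.univ.sup fun i => (p i).natDegree :=
      Finset.le_sup (f := fun i => (p i).natDegree) (Finset.mem_univ i)
    omega
  have hA : ∀ x : Fin n → A, {y | Q A (Sum.elim x fun _ => y)}.Finite →
      ∃ i, A.spec x (p i) ≠ 0 ∧
        ∀ y, Q A (Sum.elim x fun _ => y) → (A.spec x (p i)).eval y = 0 := by
    intro x hx
    let f : K →+* A := ringHomOfHom (ι := ι) e.toHom
    have hf : ∀ a, f a = e a := fun _ => rfl
    obtain ⟨a, rfl⟩ : ∃ a : Fin n → K, x = e ∘ a :=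
      ⟨e.symm ∘ x, by ext i; simp⟩
    have hre : ∀ y, Q A (Sum.elim (e ∘ a) fun _ => e y) ↔ φ.Realize (Sum.elim a fun _ => y) := by
      intro y
      rw [← StrongHomClass.realize_formula e φ]
      refine iff_of_eq (congrArg φ.Realize ?_)
      ext (i | i) <;> rfl
    have hspec : ∀ i, A.spec (e ∘ a) (p i) = ((p i).map
        (MvPolynomial.aeval a : MvPolynomial (Fin n) (dclEmpty ι K) →ₐ[_] K).toRingHom).map f := by
      intro i
      rw [Polynomial.map_map, TM.spec]
      congr 1
      refine MvPolynomial.ringHom_ext (fun r => ?_) fun j => ?_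
      · simpa using! TM.sigma_equiv e r
      · simp [hf]
    obtain ⟨i, hi, hz⟩ := hp a (by
      refine Set.Finite.of_finite_image (f := e) (hx.subset ?_) e.injective.injOn
      rintro _ ⟨y, hy, rfl⟩
      exact (hre y).2 hy)
    refine ⟨i, ?_, fun y hy => ?_⟩
    · rw [hspec, Ne, Polynomial.map_eq_zero_iff f.injective]
      exact hi
    · obtain ⟨y, rfl⟩ := e.surjective y
      rw [hspec, ← hf, Polynomial.eval_map_apply, hz y ((hre y).1 hy), map_zero]
  -- Infinitude of fibres with `N` elements is transferred as a scheme of sentences, one for each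
  -- `k`.
  have hmany : ∀ (M : TM ι K) (x : Fin n → M) (k : ℕ),
      HasMany N {y | Q M (Sum.elim x fun _ => y)} →
      HasMany k {y | Q M (Sum.elim x fun _ => y)} := by
    intro M x k
    have hu : UDef L (fun M : TM ι K => M) (fun M (_ : Empty → M) => ∀ x : Fin n → M,
        HasMany N {y | Q M (Sum.elim x fun _ => y)} →
        HasMany k {y | Q M (Sum.elim x fun _ => y)}) :=
      UDef.all (R := fun (M : TM ι K) (_ : Empty → M) (x : Fin n → M) =>
        HasMany N {y | Q M (Sum.elim x fun _ => y)} → HasMany k {y | Q M (Sum.elim x fun _ => y)})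
        (UDef.imp ((UDef.hasMany N hQ).comap Sum.inr) ((UDef.hasMany k hQ).comap Sum.inr))
    exact hu.transfer A M (a := default) (b := default)
      (fun x hx => hasMany_of_infinite (key A x (hA x) hx) k) x
  have hbound : ∀ (M : TM ι K) (x : Fin n → M), ¬ HasMany N {y | Q M (Sum.elim x fun _ => y)} →
      ∃ i, M.spec x (p i) ≠ 0 ∧
        ∀ y, Q M (Sum.elim x fun _ => y) → (M.spec x (p i)).eval y = 0 := by
    intro M x
    have hu : UDef L (fun M : TM ι K => M) (fun M (_ : Empty → M) => ∀ x : Fin n → M,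
        ¬ HasMany N {y | Q M (Sum.elim x fun _ => y)} → ∃ i, M.spec x (p i) ≠ 0 ∧
        ∀ y, Q M (Sum.elim x fun _ => y) → (M.spec x (p i)).eval y = 0) := by
      refine UDef.all (R := fun (M : TM ι K) (_ : Empty → M) (x : Fin n → M) =>
        ¬ HasMany N {y | Q M (Sum.elim x fun _ => y)} → ∃ i, M.spec x (p i) ≠ 0 ∧
        ∀ y, Q M (Sum.elim x fun _ => y) → (M.spec x (p i)).eval y = 0)
        (UDef.imp ((UDef.hasMany N hQ).comap Sum.inr).not (UDef.iEx fun i =>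
          UDef.and ((UDef.spec_ne_zero (p i)).comap Sum.inr) ?_))
      refine UDef.all1 (R := fun (M : TM ι K) v y => Q M (Sum.elim (v ∘ Sum.inr) fun _ => y) →
        (M.spec (v ∘ Sum.inr) (p i)).eval y = 0) (UDef.imp ?_ (UDef.eq ?_
          (UFun.zero (T := fun M : TM ι K => M))))
      · exact (hQ.comap (Sum.map Sum.inr id)).congr fun M v =>
          iff_of_eq (congrArg (Q M) (by ext (i | i) <;> rfl))
      · exact (UFun.eval_spec (p i)).comap (Sum.map Sum.inr id)
    exact hu.transfer A M (a := default) (b := default) (fun x hx => hA x (by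
      by_contra hinf
      exact hx (hasMany_of_infinite hinf N))) x
  refine ⟨m, N, fun i => (p i).map (MvPolynomial.rename g).toRingHom, fun M x => ?_⟩
  have hset : {y | R M (Sum.elim x fun _ => y)} = {y | Q M (Sum.elim (x ∘ g) fun _ => y)} := by
    ext y; exact hφ M x y
  have hsp : ∀ i, M.spec x ((p i).map (MvPolynomial.rename g).toRingHom) =
      M.spec (x ∘ g) (p i) := by
    intro i
    rw [TM.spec, TM.spec, Polynomial.map_map]
    congr 1
    refine MvPolynomial.ringHom_ext (fun r => ?_) fun j => ?_ <;> simp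
  have hAB : {y | Q M (Sum.elim (x ∘ g) fun _ => y)}.Finite →
      ∃ i, M.spec (x ∘ g) (p i) ≠ 0 ∧
        ∀ y, Q M (Sum.elim (x ∘ g) fun _ => y) → (M.spec (x ∘ g) (p i)).eval y = 0 := by
    intro hf
    refine hbound M _ fun hN => ?_
    have := (hmany M _ ({y | Q M (Sum.elim (x ∘ g) fun _ => y)}.ncard + 1) hN).le_ncard hf
    omega
  rw [hset]
  refine ⟨key M _ hAB, fun hf => ?_⟩
  obtain ⟨i, hi, hz⟩ := hAB hf
  exact ⟨i, by rw [hsp]; exact hi, fun y hy => by rw [hsp]; exact hz y ((hφ M x y).1 hy)⟩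

/-- In an algebraically bounded theory, the quantifier "there are infinitely many" can be
eliminated. -/
theorem UDef.infinite (hK : IsAlgebraicallyBounded L (dclEmpty ι K))
    {R : ∀ M : TM ι K, (β ⊕ Unit → M) → Prop} (h : UDef L (fun M : TM ι K => M) R) :
    UDef L (fun M : TM ι K => M)
      (fun M (x : β → M) => {y | R M (Sum.elim x fun _ => y)}.Infinite) := by
  obtain ⟨m, N, p, hp⟩ := exists_polynomials hK h
  exact (UDef.hasMany N h).congr fun M x => ⟨(hp M x).1, fun hi => hasMany_of_infinite hi N⟩

end AlgebraicBoundedness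
end GenericDerivation

/-! ### Compactness, Zariski density of big sets, and `acl`. -/

namespace GenericDerivation

section Realization

variable {L : FirstOrder.Language.{u, v}} {ι : FirstOrder.Language.ring →ᴸ L} {K : Type w} [Field K]
  [Ring.CompatibleRing K] [L.Structure K] [ι.IsExpansionOn K] {α β : Type*}

/-! ### Realizing types in elementary extensions -/

/-- Compactness: finite satisfiability in `M` itself yields a realization in an elementary
extension. The elements of `M` and the variables in `V` all become constants. -/
theorem TM.exists_realization (M : TM ι K) {V : Type (max u v w)} (Γ : Set (L.Formula (M ⊕ V)))
    (h : ∀ Γ₀ : Finset (L.Formula (M ⊕ V)), ↑Γ₀ ⊆ Γ →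
      ∃ a : V → M, ∀ γ ∈ Γ₀, γ.Realize (Sum.elim id a)) :
    ∃ (N : TM ι K) (f : M ↪ₑ[L] N) (a : V → N), ∀ γ ∈ Γ, γ.Realize (Sum.elim f a) := by
  classical
  -- The elementary diagram of `M`, which forces the map from `M` to be elementary.
  let D : Set (L.Formula (M ⊕ V)) := {γ | ∃ φ : L.Formula M, φ.Realize id ∧ γ = φ.relabel Sum.inl}
  let U : L[[M ⊕ V]].Theory := Formula.equivSentence '' (Γ ∪ D)
  have hU : U.IsSatisfiable := by
    rw [Theory.isSatisfiable_iff_isFinitelySatisfiable]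
    intro T₀ hT₀
    let Γ₀ : Finset (L.Formula (M ⊕ V)) :=
      (T₀.image Formula.equivSentence.symm).filter (· ∈ Γ)
    obtain ⟨a, ha⟩ := h Γ₀ (by intro γ hγ; simpa using (Finset.mem_filter.1 hγ).2)
    let _ : (constantsOn (M ⊕ V)).Structure M := constantsOn.structure (Sum.elim id a)
    have hc : (fun x : M ⊕ V => (↑(L.con x) : M)) = Sum.elim id a := rfl
    have : M.carrier ⊨ (T₀ : L[[M ⊕ V]].Theory) := by
      refine ⟨fun φ hφ => ?_⟩
      obtain ⟨γ, hγ, rfl⟩ := hT₀ hφ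
      rw [Formula.realize_equivSentence, hc]
      by_cases hΓ : γ ∈ Γ
      · refine ha γ (Finset.mem_filter.2 ⟨Finset.mem_image.2 ⟨_, hφ, ?_⟩, hΓ⟩)
        simp
      · obtain ⟨φ, hφ, rfl⟩ := hγ.resolve_left hΓ
        rwa [Formula.realize_relabel]
    exact Theory.Model.isSatisfiable M.carrier
  obtain ⟨N'⟩ := hU
  let N₀ : Type (max u v w) := N'
  let _ : L.Structure N₀ := (L.lhomWithConstants (M ⊕ V)).reduct N₀
  have := LHom.isExpansionOn_reduct (L.lhomWithConstants (M ⊕ V)) N₀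
  let g : M ⊕ V → N₀ := fun x => (↑(L.con x) : N₀)
  have hg : ∀ γ ∈ Γ ∪ D, γ.Realize g := fun γ hγ => by
    rw [← Formula.realize_equivSentence]
    exact N'.is_model.realize_of_mem _ ⟨γ, hγ, rfl⟩
  have hmap : ∀ (φ : L.Formula M), φ.Realize (g ∘ Sum.inl) ↔ φ.Realize id := by
    have h1 : ∀ φ : L.Formula M, φ.Realize id → φ.Realize (g ∘ Sum.inl) := fun φ hφ => by
      rw [← Formula.realize_relabel]
      exact hg _ (Or.inr ⟨φ, hφ, rfl⟩)
    refine fun φ => ⟨fun h => ?_, h1 φ⟩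
    by_contra hn
    exact (Formula.realize_not.1 (h1 φ.not (Formula.realize_not.2 hn))) h
  let f : M ↪ₑ[L] N₀ := ⟨g ∘ Sum.inl, fun n φ x => by
    rw [Function.comp_assoc, show (g ∘ Sum.inl ∘ x) = (g ∘ Sum.inl) ∘ x from rfl,
      ← Formula.realize_relabel, hmap, Formula.realize_relabel, Function.id_comp]⟩
  let N : TM ι K := TM.ofModel (M := N₀) ι ((f.theory_model_iff _).1 M.model)
  refine ⟨N, f, g ∘ Sum.inr, fun γ hγ => ?_⟩
  have : Sum.elim (f : M → N₀) (g ∘ Sum.inr) = g := by ext (x | x) <;> rfl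
  have h2 := hg γ (Or.inl hγ)
  rw [← this] at h2
  exact h2

/-- The ring homomorphism underlying an elementary embedding. -/
noncomputable def TM.hom {M N : TM ι K} (f : M ↪ₑ[L] N) : M →+* N := ringHomOfHom (ι := ι) f.toHom

theorem TM.hom_apply {M N : TM ι K} (f : M ↪ₑ[L] N) (x : M) : TM.hom f x = f x := rfl

theorem TM.exists_ufun_eval₂ (M : TM ι K) {V : Type*} (p : MvPolynomial V M) :
    ∃ g : ∀ N : TM ι K, (M ⊕ V → N) → N, UFun L (fun N : TM ι K => N) g ∧
      ∀ (N : TM ι K) (f : M →+* N) (a : V → N), g N (Sum.elim f a) = p.eval₂ f a := by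
  induction p using MvPolynomial.induction_on with
  | C c => exact ⟨_, UFun.var (Sum.inl c), by simp⟩
  | add p q hp hq =>
    obtain ⟨g, hg, hg'⟩ := hp
    obtain ⟨k, hk, hk'⟩ := hq
    exact ⟨_, UFun.add (T := fun N : TM ι K => N) hg hk, by simp [hg', hk']⟩
  | mul_X p i hp =>
    obtain ⟨g, hg, hg'⟩ := hp
    exact ⟨_, UFun.mul (T := fun N : TM ι K => N) hg (UFun.var (Sum.inr i)), by simp [hg']⟩

theorem TM.exists_formula_eval₂_ne_zero (M : TM ι K) {V : Type*} (p : MvPolynomial V M) :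
    ∃ φ : L.Formula (M ⊕ V), ∀ (N : TM ι K) (f : M →+* N) (a : V → N),
      φ.Realize (Sum.elim f a) ↔ p.eval₂ f a ≠ 0 := by
  obtain ⟨g, hg, hg'⟩ := M.exists_ufun_eval₂ p
  obtain ⟨φ, hφ⟩ := (UDef.eq hg (UFun.zero (T := fun N : TM ι K => N))).not
  exact ⟨φ, fun N f a => by simp only [hφ, hg', ne_eq]⟩

/-- The conditions that nonzero polynomials do not vanish are added to `Γ`. Finitely many of them
amount to one, for the product of the polynomials. The map `e` picks the coordinates that are to
become algebraically independent; the others stay unconstrained. -/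
theorem TM.exists_generic_realization (M : TM ι K) {V V' : Type (max u v w)} (e : V' → V)
    (Γ : Set (L.Formula (M ⊕ V)))
    (h : ∀ p : MvPolynomial V' M, p ≠ 0 → ∃ a : V → M,
      (∀ γ ∈ Γ, γ.Realize (Sum.elim id a)) ∧ MvPolynomial.eval (a ∘ e) p ≠ 0) :
    ∃ (N : TM ι K) (f : M ↪ₑ[L] N) (a : V → N), (∀ γ ∈ Γ, γ.Realize (Sum.elim f a)) ∧
      ∀ p : MvPolynomial V' M, p ≠ 0 → p.eval₂ (TM.hom f) (a ∘ e) ≠ 0 := by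
  classical
  choose φ hφ using fun p : MvPolynomial V' M => M.exists_formula_eval₂_ne_zero p
  have hφ' : ∀ p, ∀ (N : TM ι K) (f : M →+* N) (a : V → N),
      ((φ p).relabel (Sum.map id e)).Realize (Sum.elim f a) ↔ p.eval₂ f (a ∘ e) ≠ 0 := by
    intro p N f a
    rw [Formula.realize_relabel, ← hφ]
    refine iff_of_eq (congrArg (φ p).Realize ?_)
    ext (x | x) <;> rfl
  obtain ⟨N, f, a, ha⟩ := M.exists_realization (V := V)
    (Γ ∪ {γ | ∃ p : MvPolynomial V' M, p ≠ 0 ∧ γ = (φ p).relabel (Sum.map id e)}) (by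
      intro Γ₀ hΓ₀
      let P : L.Formula (M ⊕ V) → MvPolynomial V' M := fun γ =>
        if hγ : ∃ p : MvPolynomial V' M, p ≠ 0 ∧ γ = (φ p).relabel (Sum.map id e) then hγ.choose
        else 1
      have hP : ∀ γ, P γ ≠ 0 := fun γ => by
        by_cases hγ : ∃ p : MvPolynomial V' M, p ≠ 0 ∧ γ = (φ p).relabel (Sum.map id e)
        · simp only [P, dif_pos hγ]; exact hγ.choose_spec.1
        · simp [P, dif_neg hγ]
      -- `P` returns a polynomial behind a nonvanishing condition and the harmless value `1` for all
      -- other formulas.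
      obtain ⟨a, ha, hne⟩ := h (∏ γ ∈ Γ₀, P γ) (Finset.prod_ne_zero_iff.2 fun γ _ => hP γ)
      refine ⟨a, fun γ hγ => ?_⟩
      rcases hΓ₀ hγ with h1 | h1
      · exact ha γ h1
      · have h2 : γ = (φ (P γ)).relabel (Sum.map id e) := by
          have h1' : ∃ p : MvPolynomial V' M, p ≠ 0 ∧ γ = (φ p).relabel (Sum.map id e) := h1
          simp only [P, dif_pos h1']
          exact h1'.choose_spec.2
        rw [map_prod, Finset.prod_ne_zero_iff] at hne
        rw [h2]
        exact (hφ' (P γ) M (RingHom.id M) a).2 (hne γ hγ))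
  refine ⟨N, f, a, fun γ hγ => ha γ (Or.inl hγ), fun p hp => ?_⟩
  exact (hφ' p N (TM.hom f) a).1 (ha _ (Or.inr ⟨p, hp, rfl⟩))

end Realization

/-! ### Big sets -/

/-- A recursive description of the subsets of `Mⁿ` of dimension `n`. -/
def Big {M : Type*} : ∀ n, Set (Fin n → M) → Prop
  | 0, X => X.Nonempty
  | n + 1, X => Big n {x | {y | (Fin.snoc x y : Fin (n + 1) → M) ∈ X}.Infinite}

theorem Big.mono {M : Type*} : ∀ {n} {X Y : Set (Fin n → M)}, X ⊆ Y → Big n X → Big n Y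
  | 0, _, _, h, hX => Set.Nonempty.mono h hX
  | n + 1, X, Y, h, hX => Big.mono (n := n)
      (X := {x | {y | (Fin.snoc x y : Fin (n + 1) → M) ∈ X}.Infinite})
      (Y := {x | {y | (Fin.snoc x y : Fin (n + 1) → M) ∈ Y}.Infinite})
      (fun _ hx => Set.Infinite.mono (fun _ hy => h hy) hx) hX

/-- Big sets are Zariski dense: some coefficient of `p`, as a polynomial in the last variable, is
nonzero at a point with infinite fibre by induction, and a nonzero univariate polynomial cannot
vanish on that fibre. -/
theorem Big.exists_eval_ne_zero {M : Type*} [Field M] : ∀ {n} {X : Set (Fin n → M)}, Big n X →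
    ∀ p : MvPolynomial (Fin n) M, p ≠ 0 → ∃ x ∈ X, MvPolynomial.eval x p ≠ 0
  | 0, X, ⟨x, hx⟩, p, hp => ⟨x, hx, by
      rw [MvPolynomial.eq_C_of_isEmpty p, MvPolynomial.eval_C]
      intro h0
      exact hp (by rw [MvPolynomial.eq_C_of_isEmpty p, h0, map_zero])⟩
  | n + 1, X, h, p, hp => by
      -- `finSuccEquiv` splits off variable `0` whereas `Big` splits off the last one; the rotation
      -- moves the last variable to the front.
      let q := MvPolynomial.finSuccEquiv M n (MvPolynomial.rename (finRotate (n + 1)) p)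
      have hq : q ≠ 0 := by
        simp only [q, Ne, EmbeddingLike.map_eq_zero_iff]
        rw [← map_zero (MvPolynomial.rename (finRotate (n + 1)))]
        exact fun h0 => hp (MvPolynomial.rename_injective _ (finRotate (n + 1)).injective h0)
      have hev : ∀ (x : Fin n → M) (y : M), MvPolynomial.eval (Fin.snoc x y : Fin (n + 1) → M) p =
          (q.map (MvPolynomial.eval x)).eval y := by
        intro x y
        rw [← MvPolynomial.eval_eq_eval_mv_eval', MvPolynomial.eval_rename]
        congr 2
        ext i
        refine Fin.lastCases ?_ (fun i => ?_) i
        · simp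
        · simp
      obtain ⟨k, hk⟩ : ∃ k, q.coeff k ≠ 0 := by
        by_contra hall
        push Not at hall
        exact hq (Polynomial.ext hall)
      obtain ⟨x, hx, hxk⟩ := Big.exists_eval_ne_zero (n := n)
        (X := {x | {y | (Fin.snoc x y : Fin (n + 1) → M) ∈ X}.Infinite}) h (q.coeff k) hk
      have hne : q.map (MvPolynomial.eval x) ≠ 0 := fun h0 => hxk (by
        rw [← Polynomial.coeff_map, h0, Polynomial.coeff_zero])
      obtain ⟨y, hy, hy'⟩ : ∃ y ∈ {y | (Fin.snoc x y : Fin (n + 1) → M) ∈ X},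
          (q.map (MvPolynomial.eval x)).eval y ≠ 0 := by
        by_contra hall
        push Not at hall
        classical
        refine hx (((q.map (MvPolynomial.eval x)).roots.toFinset.finite_toSet).subset fun y hy => ?_)
        simpa [hne] using hall y hy
      exact ⟨_, hy, by rw [hev]; exact hy'⟩

section Dim

variable {L : FirstOrder.Language.{u, v}} {ι : FirstOrder.Language.ring →ᴸ L} {K : Type w} [Field K]
  [Ring.CompatibleRing K] [L.Structure K] [ι.IsExpansionOn K] {α β : Type*}

theorem UDef.fibre_snoc {n : ℕ} {R : ∀ M : TM ι K, (α ⊕ Fin (n + 1) → M) → Prop}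
    (h : UDef L (fun M : TM ι K => M) R) : UDef L (fun M : TM ι K => M)
      (fun M (v : (α ⊕ Fin n) ⊕ Unit → M) => R M (Sum.elim (v ∘ Sum.inl ∘ Sum.inl)
        (Fin.snoc (v ∘ Sum.inl ∘ Sum.inr) (v (Sum.inr ())) : Fin (n + 1) → M))) :=
  (h.comap (Sum.elim (Sum.inl ∘ Sum.inl) (Fin.snoc (Sum.inl ∘ Sum.inr) (Sum.inr ()) :
      Fin (n + 1) → (α ⊕ Fin n) ⊕ Unit))).congr fun M v => by
    refine iff_of_eq (congrArg (R M) ?_)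
    ext (a | i)
    · rfl
    · refine Fin.lastCases ?_ (fun i => ?_) i <;> simp

theorem UDef.infinite_snoc (hK : IsAlgebraicallyBounded L (dclEmpty ι K)) {n : ℕ}
    {R : ∀ M : TM ι K, (α ⊕ Fin (n + 1) → M) → Prop} (h : UDef L (fun M : TM ι K => M) R) :
    UDef L (fun M : TM ι K => M) (fun M (v : α ⊕ Fin n → M) =>
      {y | R M (Sum.elim (v ∘ Sum.inl)
        (Fin.snoc (v ∘ Sum.inr) y : Fin (n + 1) → M))}.Infinite) :=
  UDef.infinite hK h.fibre_snoc

theorem UDef.big (hK : IsAlgebraicallyBounded L (dclEmpty ι K)) : ∀ {n : ℕ}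
    {R : ∀ M : TM ι K, (α ⊕ Fin n → M) → Prop}, UDef L (fun M : TM ι K => M) R →
    UDef L (fun M : TM ι K => M) (fun M (x : α → M) => Big n {z | R M (Sum.elim x z)})
  | 0, R, h => UDef.ex (R := fun (M : TM ι K) x z => R M (Sum.elim x z)) (h.congr fun M v =>
      iff_of_eq (congrArg (R M) (by ext (i | i) <;> rfl)))
  | n + 1, R, h => UDef.big hK (n := n) (R := fun M (v : α ⊕ Fin n → M) =>
      {y | R M (Sum.elim (v ∘ Sum.inl) (Fin.snoc (v ∘ Sum.inr) y : Fin (n + 1) → M))}.Infinite)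
      (UDef.infinite_snoc hK h)

theorem acl_mono {N : Type*} [L.Structure N] {A B : Set N} (h : A ⊆ B) : acl L A ⊆ acl L B :=
  fun _ ⟨S, hS, hf, hx⟩ => ⟨S, hS.mono h, hf, hx⟩

theorem mem_acl_of_finite {N : TM ι K} {A : Set N} {R : ∀ M : TM ι K, (β ⊕ Unit → M) → Prop}
    (h : UDef L (fun M : TM ι K => M) R) {x : β → N} (hx : ∀ b, x b ∈ A)
    (hf : {y | R N (Sum.elim x fun _ => y)}.Finite) {y : N} (hy : R N (Sum.elim x fun _ => y)) :
    y ∈ acl L A := by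
  obtain ⟨φ, hφ⟩ := h
  refine ⟨_, ?_, hf, hy⟩
  rw [Set.Definable₁, Set.definable_iff_exists_formula_sum]
  refine ⟨φ.relabel (Sum.map (fun b => ⟨x b, hx b⟩) fun _ => 0), ?_⟩
  ext v
  simp only [Set.mem_ofPred_eq, Formula.realize_relabel]
  rw [← hφ]
  refine iff_of_eq (congrArg φ.Realize ?_)
  ext (b | b) <;> rfl

theorem exists_spec_of_mem_acl (hK : IsAlgebraicallyBounded L (dclEmpty ι K)) {N : TM ι K}
    {A : Set N} {y : N} (hy : y ∈ acl L A) :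
    ∃ p : Polynomial (MvPolynomial A (dclEmpty ι K)),
      N.spec Subtype.val p ≠ 0 ∧ (N.spec Subtype.val p).eval y = 0 := by
  obtain ⟨S, hS, hf, hyS⟩ := hy
  rw [Set.Definable₁, Set.definable_iff_exists_formula_sum] at hS
  obtain ⟨φ, hφ⟩ := hS
  have hφ' : ∀ z, z ∈ S ↔ φ.Realize (Sum.elim Subtype.val fun _ => z) := fun z =>
    Set.ext_iff.1 hφ fun _ => z
  let R : ∀ M : TM ι K, (A ⊕ Unit → M) → Prop := fun M v =>
    φ.Realize (Sum.elim (v ∘ Sum.inl) fun _ => v (Sum.inr ()))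
  have hR : UDef L (fun M : TM ι K => M) R :=
    ((UDef.formula φ).comap (Sum.map id fun _ => ())).congr fun M v =>
      iff_of_eq (congrArg φ.Realize (by ext (i | i) <;> rfl))
  obtain ⟨m, _, p, hp⟩ := exists_polynomials hK hR
  obtain ⟨i, hi, hz⟩ := (hp N Subtype.val).2 (hf.subset fun z hz => (hφ' z).2 hz)
  exact ⟨p i, hi, hz y ((hφ' y).1 hyS)⟩

/-- If the fibre containing the last coordinate were finite, that coordinate would be algebraic over
`A` and the earlier ones. So the initial segment lies in the definable set of points with infinite
fibre, and induction applies. -/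
theorem big_of_notMem_acl (hK : IsAlgebraicallyBounded L (dclEmpty ι K)) {N : TM ι K} {A : Set N} :
    ∀ {n : ℕ} {R : ∀ M : TM ι K, (α ⊕ Fin n → M) → Prop}, UDef L (fun M : TM ι K => M) R →
      ∀ {b : α → N}, (∀ i, b i ∈ A) → ∀ {a : Fin n → N}, R N (Sum.elim b a) →
      (∀ j, a j ∉ acl L (A ∪ a '' {i | i < j})) → Big n {z | R N (Sum.elim b z)}
  | 0, _, _, _, _, a, ha, _ => ⟨a, ha⟩
  | n + 1, R, h, b, hb, a, ha, hind => by
      refine big_of_notMem_acl (n := n) hK (UDef.infinite_snoc hK h) hb (a := Fin.init a) ?_ ?_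
      · intro hf
        refine hind (Fin.last n) (mem_acl_of_finite h.fibre_snoc (x := Sum.elim b (Fin.init a))
          ?_ hf ?_)
        · rintro (i | i)
          · exact Or.inl (hb i)
          · exact Or.inr ⟨i.castSucc, Fin.castSucc_lt_last i, rfl⟩
        · rw [← Fin.snoc_init_self a] at ha
          exact ha
      · intro j hj
        refine hind j.castSucc (acl_mono (Set.union_subset_union_right _ ?_) hj)
        rintro _ ⟨i, hi, rfl⟩
        exact ⟨i.castSucc, by simpa using hi, rfl⟩

end Dim
end GenericDerivation

/-! ### Rank, algebraic independence and dimension. -/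

namespace GenericDerivation

section Dim

variable {L : FirstOrder.Language.{u, v}} {ι : FirstOrder.Language.ring →ᴸ L} {K : Type w} [Field K]
  [Ring.CompatibleRing K] [L.Structure K] [ι.IsExpansionOn K] {α β : Type*}

/-! ### Independence and algebraic independence -/

/-- Algebraic boundedness gives a polynomial over `dcl(∅)` and the parameters. Since the image of
`M` contains the interpretation of `dcl(∅)`, its coefficients lie in `M[B]`. -/
theorem isAlgebraic_of_mem_acl (hK : IsAlgebraicallyBounded L (dclEmpty ι K)) {M N : TM ι K}
    (f : M ↪ₑ[L] N) {B : Set N} {y : N} (hy : y ∈ acl L (Set.range f ∪ B)) :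
    letI := (TM.hom f).toAlgebra
    IsAlgebraic (Algebra.adjoin M B) y := by
  let := (TM.hom f).toAlgebra
  have hr : ∀ m : M, f m = algebraMap M N m := fun _ => rfl
  obtain ⟨p, hp, hpy⟩ := exists_spec_of_mem_acl hK hy
  have hmem : ∀ z : ↥(Set.range f ∪ B), (z : N) ∈ Algebra.adjoin M B := by
    rintro ⟨z, ⟨m, rfl⟩ | hz⟩
    · exact Subalgebra.algebraMap_mem _ m
    · exact Algebra.subset_adjoin hz
  let g : MvPolynomial ↥(Set.range f ∪ B) (dclEmpty ι K) →+* Algebra.adjoin M B :=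
    MvPolynomial.eval₂Hom ((algebraMap M (Algebra.adjoin M B)).comp M.sigma)
      fun z => ⟨z, hmem z⟩
  have hg : (algebraMap (Algebra.adjoin M B) N).comp g =
      MvPolynomial.eval₂Hom N.sigma Subtype.val := by
    refine MvPolynomial.ringHom_ext (fun r => ?_) fun z => ?_
    · simp only [g, RingHom.comp_apply, MvPolynomial.coe_eval₂Hom, MvPolynomial.eval₂_C]
      rw [← TM.map_sigma f, hr]
      rfl
    · simp [g]
  rw [TM.spec, ← hg, ← Polynomial.map_map] at hp hpy
  refine ⟨p.map g, fun h0 => hp (by rw [h0, Polynomial.map_zero]), ?_⟩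
  rwa [Polynomial.aeval_def, ← Polynomial.eval_map]

/-- The root set of a polynomial over `M[B]` is finite and definable over `M ∪ B`. The definability
of its coefficients is shown by induction on the generation of `M[B]`. -/
theorem mem_acl_of_isAlgebraic {M N : TM ι K} (f : M ↪ₑ[L] N) {B : Set N} {y : N}
    (hy : letI := (TM.hom f).toAlgebra
      IsAlgebraic (Algebra.adjoin M B) y) : y ∈ acl L (Set.range f ∪ B) := by
  let := (TM.hom f).toAlgebra
  have hr : ∀ m : M, f m = algebraMap M N m := fun _ => rfl
  have hy' : IsAlgebraic (Algebra.adjoin M B) y := hy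
  obtain ⟨p, hp, hpy⟩ := hy'
  have hc : ∀ c ∈ Algebra.adjoin M B, ∃ (g : ∀ N : TM ι K, (↥(Set.range f ∪ B) → N) → N),
      UFun L (fun N : TM ι K => N) g ∧ g N Subtype.val = c := by
    intro c hc
    induction hc using Algebra.adjoin_induction with
    | mem z hz => exact ⟨_, UFun.var ⟨z, Or.inr hz⟩, rfl⟩
    | algebraMap m => exact ⟨_, UFun.var ⟨_, Or.inl ⟨m, rfl⟩⟩, rfl⟩
    | add a b _ _ ha hb =>
      obtain ⟨g, hg, rfl⟩ := ha
      obtain ⟨k, hk, rfl⟩ := hb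
      exact ⟨_, UFun.add (T := fun N : TM ι K => N) hg hk, rfl⟩
    | mul a b _ _ ha hb =>
      obtain ⟨g, hg, rfl⟩ := ha
      obtain ⟨k, hk, rfl⟩ := hb
      exact ⟨_, UFun.mul (T := fun N : TM ι K => N) hg hk, rfl⟩
  choose g hg hgc using fun k => hc _ (p.coeff k).2
  let R : ∀ M : TM ι K, (↥(Set.range f ∪ B) ⊕ Unit → M) → Prop := fun M v =>
    ∑ k ∈ Finset.range (p.natDegree + 1), g k M (v ∘ Sum.inl) * v (Sum.inr ()) ^ k = 0
  have hR : UDef L (fun M : TM ι K => M) R :=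
    UDef.eq (UFun.sum (T := fun N : TM ι K => N) _ fun k _ =>
      UFun.mul (T := fun N : TM ι K => N) ((hg k).comap Sum.inl)
        (UFun.pow (T := fun N : TM ι K => N) (UFun.var _) k))
      (UFun.zero (T := fun N : TM ι K => N))
  have hp' : p.map (algebraMap (Algebra.adjoin M B) N) ≠ 0 := by
    rwa [Ne, Polynomial.map_eq_zero_iff Subtype.val_injective]
  have hRN : ∀ z, R N (Sum.elim Subtype.val fun _ => z) ↔
      (p.map (algebraMap (Algebra.adjoin M B) N)).eval z = 0 := by
    intro z
    rw [Polynomial.eval_map, Polynomial.eval₂_eq_sum_range]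
    simp only [R, Sum.elim_comp_inl, Sum.elim_inr, hgc]
    rfl
  refine mem_acl_of_finite hR (N := N) (x := Subtype.val) (fun z => z.2) ?_ ((hRN y).2 ?_)
  · classical
    refine (p.map (algebraMap (Algebra.adjoin M B) N)).roots.toFinset.finite_toSet.subset
      fun z hz => ?_
    simpa [hp'] using (hRN z).1 hz
  · rwa [Polynomial.eval_map, ← Polynomial.aeval_def]

theorem algebraicIndependent_of_eval₂_ne_zero {M N : TM ι K} (f : M ↪ₑ[L] N) {V : Type*}
    {a : V → N} (h : ∀ p : MvPolynomial V M, p ≠ 0 → p.eval₂ (TM.hom f) a ≠ 0) :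
    letI := (TM.hom f).toAlgebra
    AlgebraicIndependent M a := by
  let := (TM.hom f).toAlgebra
  rw [algebraicIndependent_iff]
  intro p hp
  by_contra h0
  exact h p h0 hp

/-- Coordinates are added one at a time; one that is algebraic over those already present would be
in their `acl`. -/
theorem AclIndependent.algebraicIndepOn {M N : TM ι K} (f : M ↪ₑ[L] N) {n : ℕ} {a : Fin n → N}
    {s : Finset (Fin n)} (h : AclIndependent L (Set.range f) a s) :
    letI := (TM.hom f).toAlgebra
    AlgebraicIndepOn M a (s : Set (Fin n)) := by
  let := (TM.hom f).toAlgebra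
  suffices H : ∀ t : Finset (Fin n), t ⊆ s → AlgebraicIndepOn M a (t : Set (Fin n)) from
    H s subset_rfl
  intro t
  induction t using Finset.induction_on with
  | empty =>
    intro _
    rw [Finset.coe_empty]
    have : IsEmpty (↥(∅ : Set (Fin n))) := inferInstance
    exact algebraicIndependent_empty_type_iff.2 (algebraMap M N).injective
  | insert i t hi ih =>
    intro hts
    rw [Finset.coe_insert, AlgebraicIndepOn.insert_iff (by simpa using hi)]
    refine ⟨ih ((Finset.subset_insert _ _).trans hts), fun halg => ?_⟩
    refine h i (hts (Finset.mem_insert_self _ _))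
      (acl_mono (Set.union_subset_union_right _ ?_) (mem_acl_of_isAlgebraic f halg))
    rintro _ ⟨j, hj, rfl⟩
    exact ⟨j, ⟨hts (Finset.mem_insert_of_mem hj), fun hji => hi (hji ▸ hj)⟩, rfl⟩

/-! ### The dimension -/

/-- A supremum of ranks that reaches the natural number `d` has a member that does, and the witness
can be expressed through the given `ψ` and `b`, although `dim` allows any presentation of the set.
-/
theorem exists_rk_le_of_le_dim {M : TM ι K} {n k : ℕ} (ψ : L.Formula (Fin n ⊕ Fin k))
    (b : Fin k → M) {d : ℕ}
    (h : ((d : ℕ∞) : WithBot ℕ∞) ≤ dim L {x : Fin n → M | ψ.Realize (Sum.elim x b)}) :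
    ∃ (N : TM ι K) (f : M ↪ₑ[L] N) (a : Fin n → N),
      ψ.Realize (Sum.elim a (f ∘ b)) ∧ d ≤ rk L (Set.range f) a := by
  have h1 : ∃ r ∈ {r : WithBot ℕ∞ | ∃ (k' : ℕ) (ψ' : L.Formula (Fin n ⊕ Fin k')) (b' : Fin k' → M),
      {x : Fin n → M | ψ.Realize (Sum.elim x b)} = {x | ψ'.Realize (Sum.elim x b')} ∧
      ∃ (N : Type (max u v w)) (_ : L.Structure N) (f : M ↪ₑ[L] N) (a : Fin n → N),
      ψ'.Realize (Sum.elim a (f ∘ b')) ∧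
      r = ((rk L (Set.range f) a : ℕ∞) : WithBot ℕ∞)}, ((d : ℕ∞) : WithBot ℕ∞) ≤ r := by
    by_contra hall
    push Not at hall
    -- Some member exceeds the predecessor of `d`, which is `⊥` when `d = 0`.
    rcases d with _ | d
    · have h2 : (⊥ : WithBot ℕ∞) < dim L {x : Fin n → M | ψ.Realize (Sum.elim x b)} :=
        lt_of_lt_of_le (WithBot.bot_lt_coe _) h
      obtain ⟨r, hr, -⟩ := lt_sSup_iff.1 h2
      have hr' := hall r hr
      obtain ⟨_, _, _, _, _, _, _, _, _, rfl⟩ := hr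
      exact absurd hr' (not_lt.2 (by exact_mod_cast Nat.zero_le _))
    · have h2 : ((d : ℕ∞) : WithBot ℕ∞) < dim L {x : Fin n → M | ψ.Realize (Sum.elim x b)} :=
        lt_of_lt_of_le (by exact_mod_cast Nat.lt_succ_self d) h
      obtain ⟨r, hr, hdr⟩ := lt_sSup_iff.1 h2
      have hr' := hall r hr
      obtain ⟨_, _, _, _, _, _, _, _, _, rfl⟩ := hr
      refine absurd hr' (not_lt.2 ?_)
      exact_mod_cast Nat.succ_le_of_lt (by exact_mod_cast hdr)
  obtain ⟨_, ⟨k', ψ', b', hX, N, _, f, a, ha, rfl⟩, hr⟩ := h1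
  refine ⟨TM.ofModel (M := N) ι ((f.theory_model_iff _).1 M.model), f, a, ?_, by exact_mod_cast hr⟩
  -- That two formulas define the same set is itself first order over the parameters, so it persists
  -- in `N`.
  have h3 : (Formula.iAlls (Fin n) (((ψ.relabel (Sum.elim Sum.inr (Sum.inl ∘ Sum.inl))).iff
      (ψ'.relabel (Sum.elim Sum.inr (Sum.inl ∘ Sum.inr)))) :
        L.Formula ((Fin k ⊕ Fin k') ⊕ Fin n))).Realize (Sum.elim b b') := by
    rw [Formula.realize_iAlls]
    intro x
    have := Set.ext_iff.1 hX x
    rw [Formula.realize_iff, Formula.realize_relabel, Formula.realize_relabel]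
    refine Iff.trans (iff_of_eq (congrArg ψ.Realize ?_))
      (this.trans (iff_of_eq (congrArg ψ'.Realize ?_))) <;> (ext (i | i) <;> rfl)
  rw [← f.map_formula, Formula.realize_iAlls] at h3
  have h4 := h3 a
  rw [Formula.realize_iff, Formula.realize_relabel, Formula.realize_relabel] at h4
  convert! h4.2 (by convert! ha using 1; ext (i | i) <;> rfl) using 1
  ext (i | i) <;> rfl

theorem le_rk_iff {N : Type*} [L.Structure N] {A : Set N} {n d : ℕ} {a : Fin n → N} :
    d ≤ rk L A a ↔ ∃ s : Finset (Fin n), AclIndependent L A a s ∧ s.card = d := by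
  classical
  constructor
  · intro h
    obtain ⟨s, hs, hd⟩ : ∃ s, AclIndependent L A a s ∧ d ≤ s.card := by
      rcases Nat.eq_zero_or_pos d with rfl | hd
      · exact ⟨∅, fun i hi => by simp at hi, Nat.zero_le _⟩
      · obtain ⟨s, hs, hd⟩ := (Finset.le_sup_iff (by simpa using hd)).1 h
        exact ⟨s, (Finset.mem_filter.1 hs).2, hd⟩
    obtain ⟨t, hts, ht⟩ := Finset.exists_subset_card_eq hd
    refine ⟨t, fun i hi h => hs i (hts hi) (acl_mono (Set.union_subset_union_right _ ?_) h), ht⟩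
    exact Set.image_mono fun j hj => ⟨hts hj.1, hj.2⟩
  · rintro ⟨s, hs, rfl⟩
    unfold rk
    exact Finset.le_sup (f := Finset.card) (Finset.mem_filter.2 ⟨Finset.mem_univ _, hs⟩)

theorem rk_le {N : Type*} [L.Structure N] (A : Set N) {n : ℕ} (a : Fin n → N) : rk L A a ≤ n := by
  obtain ⟨s, -, hs⟩ := le_rk_iff.1 (le_refl (rk L A a))
  rw [← hs]
  exact s.card_le_univ.trans_eq (Fintype.card_fin n)

theorem UDef.projection {n k d : ℕ} (ψ : L.Formula (Fin n ⊕ Fin k)) (g : Fin d → Fin n) :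
    UDef L (fun M : TM ι K => M) (fun M (v : Fin k ⊕ Fin d → M) =>
      ∃ z : Fin n → M, ψ.Realize (Sum.elim z (v ∘ Sum.inl)) ∧ ∀ i, z (g i) = v (Sum.inr i)) := by
  refine UDef.ex (R := fun (M : TM ι K) (v : Fin k ⊕ Fin d → M) (z : Fin n → M) =>
    ψ.Realize (Sum.elim z (v ∘ Sum.inl)) ∧ ∀ i, z (g i) = v (Sum.inr i)) (UDef.and ?_ ?_)
  · exact ((UDef.formula ψ).comap (Sum.elim Sum.inr (Sum.inl ∘ Sum.inl))).congr fun M v =>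
      iff_of_eq (congrArg ψ.Realize (by ext (i | i) <;> rfl))
  · exact UDef.iAll fun i => UDef.eq (UFun.var (Sum.inr (g i))) (UFun.var (Sum.inl (Sum.inr i)))

/-- A definable set has dimension at least `d` if and only if one of its coordinate projections
to `Mᵈ` is big. -/
theorem le_dim_iff (hK : IsAlgebraicallyBounded L (dclEmpty ι K)) {M : TM ι K} {n k : ℕ}
    (ψ : L.Formula (Fin n ⊕ Fin k)) (b : Fin k → M) (d : ℕ) :
    ((d : ℕ∞) : WithBot ℕ∞) ≤ dim L {x : Fin n → M | ψ.Realize (Sum.elim x b)} ↔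
      ∃ g : Fin d → Fin n, Function.Injective g ∧
        Big d {z : Fin d → M | ∃ x, ψ.Realize (Sum.elim x b) ∧ ∀ i, x (g i) = z i} := by
  constructor
  · intro h
    obtain ⟨N, f, a, ha, hd⟩ := exists_rk_le_of_le_dim ψ b h
    obtain ⟨s, hs, hsd⟩ := le_rk_iff.1 hd
    let g : Fin d ↪o Fin n := s.orderEmbOfFin hsd
    refine ⟨g, g.injective, ?_⟩
    -- Bigness of the projection is `L`-definable in the parameters, so it may be checked in `N`,
    -- where an independent point is available.
    have hbig := UDef.big hK (UDef.projection (ι := ι) (K := K) ψ g)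
    refine (hbig.elementary f b).1 ?_
    refine big_of_notMem_acl hK (UDef.projection (ι := ι) (K := K) ψ g) (b := f ∘ b)
      (A := Set.range f) (fun i => ⟨_, rfl⟩) (a := a ∘ g) ⟨a, ha, fun i => rfl⟩ fun j hj => ?_
    refine hs (g j) (s.orderEmbOfFin_mem hsd j)
      (acl_mono (Set.union_subset_union_right _ ?_) hj)
    rintro _ ⟨i, hi, rfl⟩
    exact ⟨g i, ⟨s.orderEmbOfFin_mem hsd i, fun h => hi.ne (g.injective h)⟩, rfl⟩
  · rintro ⟨g, hg, hbig⟩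
    let γ : L.Formula (M ⊕ ULift.{max u v w} (Fin n)) :=
      ψ.relabel (Sum.elim (Sum.inr ∘ ULift.up) (Sum.inl ∘ b))
    have hγ : ∀ (N : TM ι K) (f : M → N) (a : ULift.{max u v w} (Fin n) → N),
        γ.Realize (Sum.elim f a) ↔ ψ.Realize (Sum.elim (a ∘ ULift.up) (f ∘ b)) := by
      intro N f a
      rw [Formula.realize_relabel]
      refine iff_of_eq (congrArg ψ.Realize ?_)
      ext (i | i) <;> rfl
    -- The big projection is Zariski dense, so compactness yields a point of the set whose
    -- coordinates along `g` are algebraically independent over `M`.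
    obtain ⟨N, f, a, ha, hgen⟩ := M.exists_generic_realization (V := ULift.{max u v w} (Fin n))
      (V' := ULift.{max u v w} (Fin d)) (fun i => ⟨g i.down⟩) {γ} (by
        intro p hp
        obtain ⟨z, ⟨x, hx, hxz⟩, hz⟩ := hbig.exists_eval_ne_zero (MvPolynomial.rename ULift.down p)
          (by rw [← map_zero (MvPolynomial.rename ULift.down)]
              exact fun h0 => hp (MvPolynomial.rename_injective _ ULift.down_injective h0))
        refine ⟨x ∘ ULift.down, ?_, ?_⟩
        · rintro _ rfl
          exact (hγ M id _).2 hx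
        · rw [MvPolynomial.eval_rename] at hz
          rwa [show (x ∘ ULift.down) ∘ (fun i : ULift.{max u v w} (Fin d) => ⟨g i.down⟩) =
            z ∘ ULift.down from funext fun i => hxz i.down])
    let := (TM.hom f).toAlgebra
    have hind := algebraicIndependent_of_eval₂_ne_zero f hgen
    have hind' : AclIndependent L (Set.range f) (a ∘ ULift.up) (Finset.univ.image g) := by
      intro i hi hacl
      obtain ⟨j, -, rfl⟩ := Finset.mem_image.1 hi
      refine hind.transcendental_adjoin (i := ⟨j⟩) (s := {i | i ≠ ⟨j⟩}) (by simp)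
        (isAlgebraic_of_mem_acl hK f (acl_mono (Set.union_subset_union_right _ ?_) hacl))
      rintro _ ⟨i, ⟨hi, hne⟩, rfl⟩
      obtain ⟨i, -, rfl⟩ := Finset.mem_image.1 hi
      exact ⟨⟨i⟩, fun h => hne (by rw [ULift.up_injective h]), rfl⟩
    have hd : d ≤ rk L (Set.range f) (a ∘ ULift.up) :=
      le_rk_iff.2 ⟨_, hind', by rw [Finset.card_image_of_injective _ hg, Finset.card_fin]⟩
    refine le_trans (b := ((rk L (Set.range f) (a ∘ ULift.up) : ℕ∞) : WithBot ℕ∞))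
      (by exact_mod_cast hd) (le_sSup ?_)
    exact ⟨k, ψ, b, rfl, N, inferInstance, f, a ∘ ULift.up, (hγ N f a).1 (ha γ rfl), rfl⟩

theorem dim_le {M : TM ι K} {n : ℕ} (X : Set (Fin n → M)) :
    dim L X ≤ ((n : ℕ∞) : WithBot ℕ∞) := by
  refine sSup_le ?_
  rintro _ ⟨_, _, _, _, _, _, _, a, _, rfl⟩
  exact_mod_cast rk_le _ a

end Dim
end GenericDerivation

/-! ### Derivations of field extensions and density of products. -/

namespace GenericDerivation

/-! ### Extending derivations -/

section Derivations

theorem exists_lift_of_formallySmooth {A N B : Type*} [CommRing A] [CommRing N] [CommRing B]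
    [Algebra A N] [Algebra.FormallySmooth A N] (φ : A →+* B) (g : B →+* N)
    (hg : Function.Surjective g) (hker : IsNilpotent (RingHom.ker g))
    (h : g.comp φ = algebraMap A N) :
    ∃ l : N →+* B, (∀ x, g (l x) = x) ∧ ∀ x, l (algebraMap A N x) = φ x := by
  let := φ.toAlgebra
  let g' : B →ₐ[A] N := { g with commutes' := fun r => RingHom.congr_fun h r }
  let l := Algebra.FormallySmooth.liftOfSurjective (AlgHom.id A N) g' hg hker
  exact ⟨l, fun x => Algebra.FormallySmooth.liftOfSurjective_apply _ g' hg hker x,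
    fun x => l.commutes x⟩

/-- The ring homomorphism to the dual numbers that belongs to a derivation. -/
noncomputable def dualHom {M N : Type*} [CommRing M] [CommRing N] [Algebra M N]
    (D : Derivation ℤ M N) : M →+* TrivSqZeroExt N N where
  toFun m := TrivSqZeroExt.inl (algebraMap M N m) + TrivSqZeroExt.inr (D m)
  map_one' := by simp
  map_zero' := by simp
  map_add' x y := by ext <;> simp
  map_mul' x y := by
    ext
    · simp
    · simp [Algebra.smul_def (R := M) (A := N), mul_comm]

open scoped IntermediateField.algebraAdjoinAdjoin in
-- `N` is algebraic, hence separable in characteristic 0 and formally étale, over the field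
-- generated by the basis, and this field is a localization of the ring generated by it.
theorem formallySmooth_of_isTranscendenceBasis {M N V : Type*} [Field M] [Field N] [CharZero M]
    [Algebra M N] {a : V → N} (ha : IsTranscendenceBasis M a) :
    Algebra.FormallySmooth (Algebra.adjoin M (Set.range a)) N := by
  have h1 : Algebra.FormallySmooth (Algebra.adjoin M (Set.range a))
      (IntermediateField.adjoin M (Set.range a)) := .of_isLocalization (nonZeroDivisors _)
  have h2 : Algebra.IsAlgebraic (IntermediateField.adjoin M (Set.range a)) N :=
    ha.isAlgebraic_field
  have h3 : CharZero (IntermediateField.adjoin M (Set.range a)) :=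
    charZero_of_injective_algebraMap
      (algebraMap M (IntermediateField.adjoin M (Set.range a))).injective
  have : Algebra.FormallyEtale (IntermediateField.adjoin M (Set.range a)) N :=
    Algebra.FormallyEtale.of_isSeparable _ N
  exact .comp _ (IntermediateField.adjoin M (Set.range a)) _

/-- In characteristic `0`, a derivation extends to every extension field, with prescribed values
on an algebraically independent family. -/
theorem exists_derivation_extension {M N V : Type*} [Field M] [Field N] [CharZero M]
    [Algebra M N] (D : Derivation ℤ M N) {a : V → N} (ha : AlgebraicIndependent M a) (u : V → N) :
    ∃ D' : Derivation ℤ N N, (∀ m, D' (algebraMap M N m) = D m) ∧ ∀ i, D' (a i) = u i := by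
  classical
  obtain ⟨t, hat, ht⟩ := exists_isTranscendenceBasis_superset ha.to_subtype_range
  -- The added members of the transcendence basis may receive any value; `0` is chosen.
  let u' : t → N := fun x => if h : ∃ i, a i = x then u h.choose else 0
  have hu' : ∀ i (h : a i ∈ t), u' ⟨a i, h⟩ = u i := by
    intro i h
    have hex : ∃ j, a j = a i := ⟨i, rfl⟩
    simp only [u', dif_pos hex]
    rw [ha.injective hex.choose_spec]
  have := formallySmooth_of_isTranscendenceBasis ht
  let e := ht.1.aevalEquiv
  -- Derivations into `N` are ring homomorphisms to the dual numbers that lift the structure map. On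
  -- a polynomial ring such a lift is free on the variables.
  let φ₀ : MvPolynomial t M →+* TrivSqZeroExt N N :=
    MvPolynomial.eval₂Hom (dualHom D) fun x => TrivSqZeroExt.inl (x : N) + TrivSqZeroExt.inr (u' x)
  let φ := φ₀.comp e.symm.toAlgHom.toRingHom
  let g : TrivSqZeroExt N N →+* N := (TrivSqZeroExt.fstHom N N N : _ →+* N)
  have hgφ : g.comp φ = algebraMap _ N := by
    have h1 : g.comp φ₀ = (algebraMap _ N).comp e.toAlgHom.toRingHom := by
      refine MvPolynomial.ringHom_ext (fun m => ?_) fun x => ?_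
      · simp [g, φ₀, dualHom, e]
      · simp [g, φ₀, e]
    ext x
    obtain ⟨p, rfl⟩ := e.surjective x
    have h2 := RingHom.congr_fun h1 p
    simp only [RingHom.comp_apply] at h2
    simpa [φ] using! h2
  -- Formal smoothness extends the lift to all of `N`, since the kernel of the projection from the
  -- dual numbers has square zero.
  obtain ⟨l, hl1, hl2⟩ := exists_lift_of_formallySmooth φ g
    (fun x => ⟨TrivSqZeroExt.inl x, by simp [g]⟩) (by
      refine ⟨2, ?_⟩
      rw [pow_two, Ideal.zero_eq_bot, eq_bot_iff, Ideal.mul_le]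
      intro x hx y hy
      rw [Ideal.mem_bot]
      have hx' : x.fst = 0 := hx
      have hy' : y.fst = 0 := hy
      ext <;> simp [hx', hy']) hgφ
  have hl1' : ∀ x, (l x).fst = x := hl1
  have hl3 : ∀ p, l (e p : N) = φ₀ p := fun p => by
    have := hl2 (e p)
    simpa [φ] using! this
  refine ⟨Derivation.mk' ((AddMonoidHom.mk' (fun x => (l x).snd) fun x y => by
    rw [map_add, TrivSqZeroExt.snd_add]).toIntLinearMap) fun x y => ?_, fun m => ?_, fun i => ?_⟩
  · change (l (x * y)).snd = x • (l y).snd + y • (l x).snd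
    rw [map_mul, TrivSqZeroExt.snd_mul, hl1', hl1']
    simp [mul_comm]
  · change (l (algebraMap M N m)).snd = D m
    have := hl3 (MvPolynomial.C m)
    simp only [e, φ₀, MvPolynomial.coe_eval₂Hom, MvPolynomial.eval₂_C] at this
    rw [AlgebraicIndependent.aevalEquiv_apply_coe, MvPolynomial.aeval_C] at this
    rw [this]
    simp [dualHom]
  · change (l (a i)).snd = u i
    have hi : a i ∈ t := hat ⟨i, rfl⟩
    have := hl3 (MvPolynomial.X ⟨a i, hi⟩)
    simp only [e, φ₀, MvPolynomial.coe_eval₂Hom, MvPolynomial.eval₂_X] at this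
    rw [AlgebraicIndependent.aevalEquiv_apply_coe, MvPolynomial.aeval_X] at this
    rw [this]
    simp [hu']

end Derivations

/-! ### Products of dense sets -/

section Density

open MvPolynomial

/-- View `p` as a polynomial in the variables outside `s` whose coefficients are polynomials in
those of `s`, and choose `x` so that one nonzero coefficient survives. -/
theorem exists_block_eval_ne_zero {M V : Type*} [Field M] (s : Set V) [DecidablePred (· ∈ s)]
    {P : (V → M) → Prop}
    (h : ∀ r : MvPolynomial s M, r ≠ 0 → ∃ x, P x ∧ eval (fun i : s => x i) r ≠ 0)
    {p : MvPolynomial V M} (hp : p ≠ 0) :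
    ∃ x, P x ∧ aeval (fun i => if i ∈ s then C (x i) else X i : V → MvPolynomial V M) p ≠ 0 := by
  let e : V ≃ {i // ¬ i ∈ s} ⊕ s := ((Equiv.sumComm _ _).trans (Equiv.sumCompl (· ∈ s))).symm
  let q := sumAlgEquiv M _ _ (rename e p)
  have hq : q ≠ 0 := by
    simp only [q, Ne, EmbeddingLike.map_eq_zero_iff]
    rw [← map_zero (rename e)]
    exact fun h0 => hp (rename_injective _ e.injective h0)
  obtain ⟨m, hm⟩ : ∃ m, q.coeff m ≠ 0 := by
    by_contra hall
    push Not at hall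
    exact hq (MvPolynomial.ext _ _ hall)
  obtain ⟨x, hx, hne⟩ := h _ hm
  refine ⟨x, hx, fun h0 => ?_⟩
  have key : aeval (fun i => if i ∈ s then C (x i) else X i : V → MvPolynomial V M) p =
      rename Subtype.val (map (eval fun i : s => x i) q) := by
    have hhom : (aeval (R := M)
        (fun i => if i ∈ s then C (x i) else X i : V → MvPolynomial V M)).toRingHom =
        (rename Subtype.val : MvPolynomial {i // ¬ i ∈ s} M →ₐ[M] MvPolynomial V M).toRingHom.comp
          ((map (eval fun i : s => x i)).comp
            ((sumAlgEquiv M {i // ¬ i ∈ s} s).toAlgHom.toRingHom.comp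
              (rename e : _ →ₐ[M] _).toRingHom)) := by
      refine ringHom_ext (fun c => ?_) fun i => ?_
      · simp [sumAlgEquiv_C_inl]
      · by_cases hi : i ∈ s
        · have : e i = Sum.inr ⟨i, hi⟩ := by
            rw [Equiv.symm_apply_eq]; rfl
          simp [hi, this, sumAlgEquiv_X_inr]
        · have : e i = Sum.inl ⟨i, hi⟩ := by
            rw [Equiv.symm_apply_eq]; rfl
          simp [hi, this, sumAlgEquiv_X_inl]
    exact RingHom.congr_fun hhom p
  rw [key, ← map_zero (rename Subtype.val)] at h0
  have h1 := rename_injective _ Subtype.val_injective h0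
  apply hne
  rw [← coeff_map, h1, coeff_zero]

/-- A product of Zariski dense sets is Zariski dense. -/
theorem exists_eval_ne_zero_of_blocks {M V J : Type*} [Field M] (π : V → J)
    {P : J → (V → M) → Prop}
    (hloc : ∀ j x x', (∀ i, π i = j → x i = x' i) → P j x → P j x')
    (h : ∀ j (r : MvPolynomial {i | π i = j} M), r ≠ 0 → ∃ x, P j x ∧ eval (fun i : {i | π i = j} => x i) r ≠ 0)
    {p : MvPolynomial V M} (hp : p ≠ 0) : ∃ x, (∀ j, P j x) ∧ eval x p ≠ 0 := by
  classical
  have h0 : ∃ x, ∀ j, P j x := by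
    choose x hx _ using fun j => h j 1 one_ne_zero
    exact ⟨fun i => x (π i) i, fun j => hloc j _ _ (by rintro i rfl; rfl) (hx j)⟩
  have key : ∀ s : Finset J, ∃ x, (∀ j, P j x) ∧
      aeval (fun i => if π i ∈ s then C (x i) else X i : V → MvPolynomial V M) p ≠ 0 := by
    intro s
    induction s using Finset.induction_on with
    | empty =>
      obtain ⟨x, hx⟩ := h0
      exact ⟨x, hx, by simpa using! hp⟩
    | insert j s hj ih =>
      obtain ⟨x, hx, hne⟩ := ih
      obtain ⟨y, hy, hne'⟩ := exists_block_eval_ne_zero {i | π i = j} (h j) hne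
      refine ⟨fun i => if π i = j then y i else x i, fun k => ?_, ?_⟩
      · by_cases hk : k = j
        · subst hk
          exact hloc k _ _ (fun i hi => by simp [hi]) hy
        · exact hloc k _ _ (fun i hi => by simp [hi, hk]) (hx k)
      · convert! hne' using 1
        rw [← AlgHom.comp_apply]
        refine congrArg (fun φ : MvPolynomial V M →ₐ[M] MvPolynomial V M => φ p) ?_
        refine algHom_ext fun i => ?_
        by_cases hi : π i = j
        · simp [hi, hj]
        · by_cases his : π i ∈ s <;> simp [hi, his]
  -- Only finitely many blocks meet `p`; once they are specialized, `p` has become the constant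
  -- `eval x p`.
  obtain ⟨x, hx, hne⟩ := key (p.vars.image π)
  refine ⟨x, hx, fun h1 => hne ?_⟩
  have h2 : aeval (fun i => if π i ∈ p.vars.image π then C (x i) else X i :
      V → MvPolynomial V M) p = C (eval x p) := by
    have h3 : aeval (fun i => if π i ∈ p.vars.image π then C (x i) else X i :
        V → MvPolynomial V M) p = aeval (fun i => C (x i) : V → MvPolynomial V M) p := by
      refine eval₂Hom_congr' rfl (fun i hi _ => ?_) rfl
      exact if_pos (Finset.mem_image_of_mem π hi)
    rw [h3]
    exact aeval_algebraMap_apply (MvPolynomial V M) x p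
  rw [h2, h1, map_zero]

end Density
end GenericDerivation

/-! ### Existence of deep extensions. -/

namespace GenericDerivation

section DerivationModels

variable {L : FirstOrder.Language.{u, v}} {ι : FirstOrder.Language.ring →ᴸ L} {K : Type w} [Field K]
  [Ring.CompatibleRing K] [L.Structure K] [ι.IsExpansionOn K]
  {η : Derivation ℤ (dclEmpty ι K) (dclEmpty ι K)} {α β : Type*}

/-! ### Models with a derivation -/

variable (η) in
/-- A model of `T` with a derivation that extends `η`. -/
structure DM extends TM ι K where
  [ds : derLang.Structure carrier]
  dadd : ∀ x y : carrier, delta carrier (x + y) = delta carrier x + delta carrier y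
  dmul : ∀ x y : carrier, delta carrier (x * y) = x * delta carrier y + y * delta carrier x
  dext : ∀ a, delta carrier (toTM.sigma a) = toTM.sigma (η a)

attribute [instance] DM.ds

instance : CoeSort (DM η) (Type (max u v w)) := ⟨fun M => M.toTM.carrier⟩

/-- The derivation of a model. -/
noncomputable def DM.der (M : DM η) : Derivation ℤ M M :=
  Derivation.mk' (AddMonoidHom.mk' (delta M) M.dadd).toIntLinearMap M.dmul

theorem DM.der_apply (M : DM η) (x : M) : M.der x = delta M x := rfl

/-- The interpretation of `δ` by a given function. -/
abbrev derStructure {M : Type*} (δ : M → M) : derLang.Structure M where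
  funMap := fun {_} f x => match f with
    | DerFunc.delta => δ (x 0)
  RelMap := fun {_} r => (r : Empty).elim

/-- An elementary extension of a model with a derivation, with an extension of the derivation. -/
noncomputable abbrev DM.ofDerivation (M : DM η) {N : TM ι K} (f : M.toTM ↪ₑ[L] N)
    (D : Derivation ℤ N N) (h : ∀ m : M, D (f m) = f (delta M m)) : DM η :=
  { N with
    ds := derStructure D
    dadd := fun x y => map_add D x y
    dmul := fun x y => D.leibniz x y
    dext := fun a => by
      change D (N.sigma a) = N.sigma (η a)
      rw [← TM.map_sigma f, ← TM.map_sigma f, h, M.dext] }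

/-! ### Realizing instances of the scheme "deep" -/

theorem exists_formula_projection {n k : ℕ} (ψ : L.Formula (Fin (n + 1) ⊕ Fin k)) :
    ∃ φ : L.Formula (Fin n ⊕ Fin k), ∀ (M : TM ι K) (x : Fin n → M) (b : Fin k → M),
      φ.Realize (Sum.elim x b) ↔
        ∃ y : M, ψ.Realize (Sum.elim (Fin.snoc x y : Fin (n + 1) → M) b) := by
  have h : UDef L (fun M : TM ι K => M) (fun (M : TM ι K) (v : Fin n ⊕ Fin k → M) =>
      ∃ y : M, ψ.Realize (Sum.elim (Fin.snoc (v ∘ Sum.inl) y : Fin (n + 1) → M)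
        (v ∘ Sum.inr))) := by
    refine UDef.ex1 (R := fun (M : TM ι K) (v : Fin n ⊕ Fin k → M) y =>
      ψ.Realize (Sum.elim (Fin.snoc (v ∘ Sum.inl) y : Fin (n + 1) → M) (v ∘ Sum.inr))) ?_
    refine ((UDef.formula ψ).comap (Sum.elim (Fin.snoc (Sum.inl ∘ Sum.inl) (Sum.inr ()) :
      Fin (n + 1) → (Fin n ⊕ Fin k) ⊕ Unit) (Sum.inl ∘ Sum.inr))).congr fun M v => ?_
    refine iff_of_eq (congrArg ψ.Realize ?_)
    ext (i | i)
    · refine Fin.lastCases ?_ (fun i => ?_) i <;> simp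
    · rfl
  obtain ⟨φ, hφ⟩ := h
  exact ⟨φ, fun M x b => hφ M _⟩

theorem UDef.formula_swap {n k : ℕ} (ψ : L.Formula (Fin n ⊕ Fin k)) :
    UDef L (fun M : TM ι K => M) (fun (M : TM ι K) (v : Fin k ⊕ Fin n → M) =>
      ψ.Realize (Sum.elim (v ∘ Sum.inr) (v ∘ Sum.inl))) :=
  ((UDef.formula ψ).comap Sum.swap).congr fun M v =>
    iff_of_eq (congrArg ψ.Realize (by ext (i | i) <;> rfl))

/-- The big sets are the sets of full dimension. -/
theorem dim_eq_iff_big (hK : IsAlgebraicallyBounded L (dclEmpty ι K)) {M : TM ι K} {n k : ℕ}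
    (ψ : L.Formula (Fin n ⊕ Fin k)) (b : Fin k → M) :
    dim L {x : Fin n → M | ψ.Realize (Sum.elim x b)} = ((n : ℕ∞) : WithBot ℕ∞) ↔
      Big n {x : Fin n → M | ψ.Realize (Sum.elim x b)} := by
  constructor
  · intro h
    obtain ⟨N, f, a, ha, hd⟩ := exists_rk_le_of_le_dim ψ b h.ge
    obtain ⟨s, hs, hsd⟩ := le_rk_iff.1 hd
    -- All coordinates are independent, so bigness follows in the given order of variables;
    -- `le_dim_iff` would give it only up to a permutation.
    have hs' : s = Finset.univ := by
      rw [← Finset.card_eq_iff_eq_univ, hsd, Fintype.card_fin]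
    subst hs'
    refine ((UDef.big hK (UDef.formula_swap (ι := ι) (K := K) ψ)).elementary f b).1 ?_
    refine big_of_notMem_acl hK (UDef.formula_swap (ι := ι) (K := K) ψ) (b := f ∘ b)
      (A := Set.range f) (fun i => ⟨_, rfl⟩) (a := a) ha fun j hj => ?_
    refine hs j (Finset.mem_univ _) (acl_mono (Set.union_subset_union_right _ ?_) hj)
    rintro _ ⟨i, hi, rfl⟩
    exact ⟨i, ⟨Finset.mem_univ _, ne_of_lt hi⟩, rfl⟩
  · intro h
    refine le_antisymm (dim_le _) ((le_dim_iff hK ψ b n).2 ⟨id, Function.injective_id, ?_⟩)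
    exact h.mono fun x hx => ⟨x, hx, fun i => rfl⟩

/-- The hypothesis of an instance of the scheme "deep". -/
def DeepHyp {n k : ℕ} (ψ : L.Formula (Fin (n + 1) ⊕ Fin k)) (M : TM ι K) (b : Fin k → M) : Prop :=
  dim L {x : Fin n → M | ∃ y : M, ψ.Realize (Sum.elim (Fin.snoc x y : Fin (n + 1) → M) b)}
    = ((n : ℕ∞) : WithBot ℕ∞)

theorem deepHyp_iff_big (hK : IsAlgebraicallyBounded L (dclEmpty ι K)) {n k : ℕ}
    (ψ : L.Formula (Fin (n + 1) ⊕ Fin k)) (M : TM ι K) (b : Fin k → M) :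
    DeepHyp ψ M b ↔ Big n {x : Fin n → M |
      ∃ y : M, ψ.Realize (Sum.elim (Fin.snoc x y : Fin (n + 1) → M) b)} := by
  obtain ⟨φ, hφ⟩ := exists_formula_projection (ι := ι) (K := K) ψ
  have := dim_eq_iff_big hK φ b
  simp only [hφ] at this
  exact this

theorem UDef.deepHyp (hK : IsAlgebraicallyBounded L (dclEmpty ι K)) {n k : ℕ}
    (ψ : L.Formula (Fin (n + 1) ⊕ Fin k)) :
    UDef L (fun M : TM ι K => M) (fun M (b : Fin k → M) => DeepHyp ψ M b) := by
  obtain ⟨φ, hφ⟩ := exists_formula_projection (ι := ι) (K := K) ψ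
  refine (UDef.big hK (UDef.formula_swap (ι := ι) (K := K) φ)).congr fun M b => ?_
  rw [deepHyp_iff_big hK]
  simp only [Sum.elim_comp_inl, Sum.elim_comp_inr, hφ]

/-- One step of the chain: every instance of "deep" over `M` receives a tuple in `N`. All non-final
coordinates of all tuples are independent together, so a single derivation can turn every tuple into
a jet. -/
theorem DM.exists_extension_realizing [CharZero K] (hK : IsAlgebraicallyBounded L (dclEmpty ι K))
    (M : DM η) : ∃ (N : DM η) (f : M.toTM ↪ₑ[L] N.toTM), (∀ x : M, f (delta M x) = delta N (f x)) ∧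
      ∀ (n k : ℕ) (ψ : L.Formula (Fin (n + 1) ⊕ Fin k)) (b : Fin k → M), DeepHyp ψ M.toTM b →
        ∃ c : N, ψ.Realize (Sum.elim (fun i : Fin (n + 1) => (delta N)^[(i : ℕ)] c) (f ∘ b)) := by
  classical
  let J : Type (max u v w) := {j : Σ (n : ℕ) (k : ℕ), L.Formula (Fin (n + 1) ⊕ Fin k) × (Fin k → M) //
    DeepHyp j.2.2.1 M.toTM j.2.2.2}
  let V : Type (max u v w) := Σ j : J, Fin (j.1.1 + 1)
  -- The coordinates whose derivative is prescribed: all but the last of each tuple.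
  let V' : Type (max u v w) := Σ j : J, Fin j.1.1
  let e : V' → V := fun v => ⟨v.1, v.2.castSucc⟩
  let γ : J → L.Formula (M ⊕ V) := fun j =>
    j.1.2.2.1.relabel (Sum.elim (fun i => Sum.inr ⟨j, i⟩) (Sum.inl ∘ j.1.2.2.2))
  have hγ : ∀ (j : J) (N : TM ι K) (f : M → N) (a : V → N), (γ j).Realize (Sum.elim f a) ↔
      j.1.2.2.1.Realize (Sum.elim (fun i => a ⟨j, i⟩) (f ∘ j.1.2.2.2)) := by
    intro j N f a
    rw [Formula.realize_relabel]
    refine iff_of_eq (congrArg j.1.2.2.1.Realize ?_)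
    ext (i | i) <;> rfl
  obtain ⟨N, f, a, ha, hgen⟩ := M.toTM.exists_generic_realization e (Set.range γ) (by
    intro p hp
    -- Each block ranges over a big, hence Zariski dense, projection, so the product of the blocks
    -- is dense as well.
    obtain ⟨x, hx, hxp⟩ := exists_eval_ne_zero_of_blocks (V := V') (J := J) Sigma.fst
      (P := fun j x => ∃ y : M, j.1.2.2.1.Realize
        (Sum.elim (Fin.snoc (fun i => x ⟨j, i⟩) y : Fin (j.1.1 + 1) → M) j.1.2.2.2))
      (by
        rintro j x x' hxx' ⟨y, hy⟩
        exact ⟨y, by simpa only [hxx' ⟨j, _⟩ rfl] using hy⟩)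
      (by
        intro j r hr
        let e' : {v : V' | v.1 = j} ≃ Fin j.1.1 := Equiv.sigmaSubtype j
        obtain ⟨z, hz, hzr⟩ := ((deepHyp_iff_big hK _ _ _).1 j.2).exists_eval_ne_zero
          (MvPolynomial.rename e' r) (by
            rw [← map_zero (MvPolynomial.rename e')]
            exact fun h0 => hr (MvPolynomial.rename_injective _ e'.injective h0))
        refine ⟨fun v => if h : v.1 = j then z (e' ⟨v, h⟩) else 0, ?_, ?_⟩
        · obtain ⟨y, hy⟩ := hz
          refine ⟨y, ?_⟩
          convert! hy using 4 with i
          exact dif_pos rfl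
        · rw [MvPolynomial.eval_rename] at hzr
          convert! hzr using 3
          ext v
          exact dif_pos v.2) hp
    choose y hy using hx
    refine ⟨fun v => (Fin.snoc (fun i => x ⟨v.1, i⟩) (y v.1) : Fin (v.1.1.1 + 1) → M) v.2, ?_, ?_⟩
    · rintro _ ⟨j, rfl⟩
      exact (hγ j M.toTM id _).2 (hy j)
    · convert! hxp using 3
      ext v
      simp [e])
  let := (TM.hom f).toAlgebra
  have hind := algebraicIndependent_of_eval₂_ne_zero f hgen
  have := M.toTM.charZero
  -- Each independent coordinate is sent to its successor; nothing is prescribed for the final one.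
  obtain ⟨D, hD, hDa⟩ := exists_derivation_extension
    ((Algebra.linearMap M.toTM N).compDer M.der) hind (fun v => a ⟨v.1, v.2.succ⟩)
  have hDf : ∀ m : M, D (f m) = f (delta M m) := hD
  refine ⟨M.ofDerivation f D hDf, f, fun x => (hDf x).symm, fun n k ψ b hψ => ?_⟩
  let j : J := ⟨⟨n, k, ψ, b⟩, hψ⟩
  have hit : ∀ i : Fin (n + 1), D^[(i : ℕ)] (a ⟨j, 0⟩) = a ⟨j, i⟩ := by
    intro i
    induction i using Fin.induction with
    | zero => rfl
    | succ i ih =>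
      rw [Fin.val_succ, Function.iterate_succ_apply']
      rw [Fin.val_castSucc] at ih
      rw [ih]
      exact hDa ⟨j, i⟩
  refine ⟨a ⟨j, 0⟩, ?_⟩
  have h1 := (hγ j N f a).1 (ha _ ⟨j, rfl⟩)
  rwa [show (fun i => a ⟨j, i⟩) = fun i : Fin (n + 1) => D^[(i : ℕ)] (a ⟨j, 0⟩) from
    funext fun i => (hit i).symm] at h1

/-! ### Unions of elementary chains -/

/-- An embedding of models of `Tᵟ`, from an embedding that commutes with the derivations. -/
def deltaEmbedding {M N : DM η} (f : M.toTM ↪[L] N.toTM)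
    (hf : ∀ x : M, f (delta M x) = delta N (f x)) : M ↪[withDelta L] N where
  toFun := f
  inj' := f.injective
  map_fun' {k} s x := by
    rcases s with s | s
    · exact f.map_fun s x
    · cases s
      have h : ∀ (A : DM η) (y : Fin 1 → A), delta A (y 0) =
          @Structure.funMap (withDelta L) A _ 1 (Sum.inr DerFunc.delta) y := fun A y => by
        change Structure.funMap deltaSymbol ![y 0] = Structure.funMap deltaSymbol y
        congr 1
        ext i
        rw [Subsingleton.elim i 0]; rfl
      exact (congrArg f (h M x)).symm.trans ((hf (x 0)).trans (h N (f ∘ x)))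
  map_rel' {k} r x := by
    rcases r with r | r
    · exact f.map_rel r x
    · exact (r : Empty).elim

/-- The embedding for the language `L` that underlies an embedding for an expansion of `L`. -/
def reductEmbedding {L' : FirstOrder.Language.{u', v'}} (j : L →ᴸ L') {M N : Type*} [L.Structure M]
    [L'.Structure M] [j.IsExpansionOn M] [L.Structure N] [L'.Structure N] [j.IsExpansionOn N]
    (f : M ↪[L'] N) : M ↪[L] N where
  toFun := f
  inj' := f.injective
  map_fun' s x := by
    have := f.map_fun (j.onFunction s) x
    rwa [LHom.map_onFunction, LHom.map_onFunction] at this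
  map_rel' r x := by
    have := f.map_rel (j.onRelation r) x
    rwa [LHom.map_onRelation, LHom.map_onRelation] at this

theorem exists_elementary_natLERec {L' : FirstOrder.Language.{u', v'}} {G : ℕ → Type*}
    [∀ i, L.Structure (G i)] [∀ i, L'.Structure (G i)] (f : ∀ n, G n ↪[L'] G (n + 1))
    (hf : ∀ n, ∃ g : G n ↪ₑ[L] G (n + 1), ∀ x, g x = f n x) (i k : ℕ) (h : i ≤ k) :
    ∃ g : G i ↪ₑ[L] G k, ∀ x, g x = DirectedSystem.natLERec f i k h x := by
  induction k, h using Nat.le_induction with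
  | base => exact ⟨ElementaryEmbedding.refl L (G i), fun x => by simp [Nat.leRecOn_self]⟩
  | succ k h ih =>
    obtain ⟨g, hg⟩ := ih
    obtain ⟨g', hg'⟩ := hf k
    refine ⟨g'.comp g, fun x => ?_⟩
    rw [ElementaryEmbedding.comp_apply, hg', hg, DirectedSystem.coe_natLERec,
      DirectedSystem.coe_natLERec]
    exact (Nat.leRecOn_succ h _).symm

/-- Tarski's elementary chain theorem, with the limit taken in the larger language `L'` so that it
carries the derivation, while the maps are only assumed elementary for `L`. -/
theorem realize_directLimit_iff {L' : FirstOrder.Language.{u', v'}} (j : L →ᴸ L') {G : ℕ → Type*}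
    [∀ i, L.Structure (G i)] [∀ i, L'.Structure (G i)] [∀ i, j.IsExpansionOn (G i)]
    (f : ∀ n, G n ↪[L'] G (n + 1)) (hf : ∀ n, ∃ g : G n ↪ₑ[L] G (n + 1), ∀ x, g x = f n x)
    [L.Structure (Language.DirectLimit G (DirectedSystem.natLERec f))]
    [j.IsExpansionOn (Language.DirectLimit G (DirectedSystem.natLERec f))]
    {n : ℕ} (φ : L.BoundedFormula α n) : ∀ (i : ℕ) (x : α → G i) (xs : Fin n → G i),
      φ.Realize (Language.DirectLimit.of L' ℕ G (DirectedSystem.natLERec f) i ∘ x)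
        (Language.DirectLimit.of L' ℕ G (DirectedSystem.natLERec f) i ∘ xs) ↔ φ.Realize x xs := by
  induction φ with
  | falsum => exact fun _ _ _ => Iff.rfl
  | equal t₁ t₂ =>
    intro i x xs
    let g := reductEmbedding j (Language.DirectLimit.of L' ℕ G (DirectedSystem.natLERec f) i)
    simp only [BoundedFormula.Realize, ← Sum.comp_elim]
    change t₁.realize (g ∘ Sum.elim x xs) = t₂.realize (g ∘ Sum.elim x xs) ↔ _
    rw [HomClass.realize_term, HomClass.realize_term]
    exact g.injective.eq_iff
  | rel R ts =>
    intro i x xs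
    let g := reductEmbedding j (Language.DirectLimit.of L' ℕ G (DirectedSystem.natLERec f) i)
    simp only [BoundedFormula.Realize, ← Sum.comp_elim]
    change Structure.RelMap R (fun k => (ts k).realize (g ∘ Sum.elim x xs)) ↔ _
    simp only [HomClass.realize_term]
    exact g.map_rel R _
  | imp φ ψ ih₁ ih₂ => intro i x xs; simp only [BoundedFormula.realize_imp, ih₁, ih₂]
  | all φ ih =>
    intro i x xs
    simp only [BoundedFormula.realize_all]
    constructor
    · intro h y
      rw [← ih, Fin.comp_snoc]
      exact h _
    · intro h z
      obtain ⟨l, y, rfl⟩ := Language.DirectLimit.exists_of z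
      -- The new element and the old tuples are brought to a common stage, where elementarity of the
      -- transition map applies.
      obtain ⟨g, hg⟩ := exists_elementary_natLERec f hf i (max i l) (le_max_left _ _)
      have hof : ∀ a, Language.DirectLimit.of L' ℕ G (DirectedSystem.natLERec f) i a =
          Language.DirectLimit.of L' ℕ G (DirectedSystem.natLERec f) (max i l) (g a) := fun a => by
        rw [hg, Language.DirectLimit.of_f]
      rw [← Language.DirectLimit.of_f (hij := le_max_right i l),
        show Language.DirectLimit.of L' ℕ G (DirectedSystem.natLERec f) i ∘ x =
          Language.DirectLimit.of L' ℕ G (DirectedSystem.natLERec f) (max i l) ∘ (g ∘ x) from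
          funext fun a => hof _,
        show Language.DirectLimit.of L' ℕ G (DirectedSystem.natLERec f) i ∘ xs =
          Language.DirectLimit.of L' ℕ G (DirectedSystem.natLERec f) (max i l) ∘ (g ∘ xs) from
          funext fun a => hof _,
        ← Fin.comp_snoc, ih]
      have h2 := (g.map_boundedFormula φ.all x xs).2 (BoundedFormula.realize_all.2 h)
      exact BoundedFormula.realize_all.1 h2 _

/-- Every model with a derivation has an elementary extension, with an extension of the derivation,
that satisfies the scheme "deep". -/
theorem DM.exists_deep_extension [CharZero K] (hK : IsAlgebraicallyBounded L (dclEmpty ι K))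
    (M : DM η) : ∃ (N : DM η) (f : M.toTM ↪ₑ[L] N.toTM), (∀ x : M, f (delta M x) = delta N (f x)) ∧
      ∀ (n k : ℕ) (ψ : L.Formula (Fin (n + 1) ⊕ Fin k)), deepInstance ψ N (delta N) := by
  choose S F hF hS using DM.exists_extension_realizing (η := η) hK
  obtain ⟨G, rfl, g, hg, hSG⟩ : ∃ G : ℕ → DM η, G 0 = M ∧
      ∃ g : ∀ n, (G n).toTM ↪ₑ[L] (G (n + 1)).toTM,
        (∀ n (x : (G n).toTM), g n (@delta _ (G n).ds x) = @delta _ (G (n + 1)).ds (g n x)) ∧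
        ∀ l (n k : ℕ) (ψ : L.Formula (Fin (n + 1) ⊕ Fin k)) (b : Fin k → (G l).toTM),
          DeepHyp ψ (G l).toTM b → ∃ c : (G (l + 1)).toTM, ψ.Realize
            (Sum.elim (fun i : Fin (n + 1) => (@delta _ (G (l + 1)).ds)^[(i : ℕ)] c) (g l ∘ b)) :=
    ⟨fun n => Nat.rec M (fun _ A => S A) n, rfl, fun n => F _, fun n x => hF _ x,
      fun l => hS _⟩
  let g' : ∀ n, (G n).toTM ↪[withDelta L] (G (n + 1)).toTM := fun n =>
    deltaEmbedding (g n).toEmbedding (hg n)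
  have hgg' : ∀ n, ∃ h : (G n).toTM ↪ₑ[L] (G (n + 1)).toTM, ∀ x, h x = g' n x :=
    fun n => ⟨g n, fun _ => rfl⟩
  let U : Type (max u v w) :=
    Language.DirectLimit (fun n => (G n).toTM.carrier) (DirectedSystem.natLERec g')
  let o : ∀ i, (G i).toTM ↪[withDelta L] U := fun i =>
    Language.DirectLimit.of (withDelta L) ℕ (fun n => (G n).toTM.carrier) (DirectedSystem.natLERec g') i
  have hos : ∀ i (x : G i), o i (Structure.funMap (L := withDelta L) (Sum.inr DerFunc.delta) ![x]) =
      Structure.funMap (L := withDelta L) (Sum.inr DerFunc.delta) (o i ∘ ![x]) :=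
    fun i x => (o i).map_fun _ _
  let _ : L.Structure U := (LHom.sumInl : L →ᴸ withDelta L).reduct U
  have : (LHom.sumInl : L →ᴸ withDelta L).IsExpansionOn U := LHom.isExpansionOn_reduct _ _
  let _ : derLang.Structure U := (LHom.sumInr : derLang →ᴸ withDelta L).reduct U
  have hel : ∀ i, ∃ h : (G i).toTM ↪ₑ[L] U, ∀ x, h x = o i x := fun i =>
    ⟨⟨o i, fun n φ x => by
      have := realize_directLimit_iff (LHom.sumInl : L →ᴸ withDelta L) g' hgg' φ i x default
      unfold Formula.Realize
      convert! this using 2⟩, fun _ => rfl⟩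
  choose h hh using hel
  let U₁ : TM ι K := TM.ofModel (M := U) ι (((h 0).theory_model_iff _).1 (G 0).model)
  have hδ : ∀ i (x : G i), o i (delta (G i) x) = delta U (o i x) := fun i x => by
    refine (hos i x).trans ?_
    change Structure.funMap deltaSymbol (o i ∘ ![x]) = Structure.funMap deltaSymbol ![o i x]
    congr 1
    ext k
    rw [Subsingleton.elim k 0]; rfl
  have hof : ∀ {i j : ℕ} (hij : i ≤ j) (x : G i),
      o j (DirectedSystem.natLERec g' i j hij x) = o i x := fun _ _ => Language.DirectLimit.of_f
  -- A finite tuple appears at one stage; this reduces both the derivation axioms and the instances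
  -- of "deep" to finite stages.
  have hfin : ∀ {k : ℕ} (b : Fin k → U), ∃ i, ∃ b' : Fin k → G i, o i ∘ b' = b := fun b => by
    obtain ⟨i, y, hy⟩ := Language.DirectLimit.exists_quotient_mk'_sigma_mk'_eq _ _ b
    exact ⟨i, y, hy.symm⟩
  let U₂ : DM η :=
    { U₁ with
      dadd := fun x y => by
        obtain ⟨i, b, hb⟩ := hfin ![x, y]
        have hx : h i (b 0) = x := (hh i _).trans (congrFun hb 0)
        have hy : h i (b 1) = y := (hh i _).trans (congrFun hb 1)
        have hadd := (TM.hom (M := (G i).toTM) (N := U₁) (h i)).map_add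
        have h1 := hδ i (b 0 + b 1)
        rw [(G i).dadd, ← hh, ← hh] at h1
        rw [← hx, ← hy]
        refine (congrArg (delta U) (hadd (b 0) (b 1))).symm.trans (h1.symm.trans
          ((hadd _ _).trans ?_))
        rw [TM.hom_apply, TM.hom_apply, hh, hh, hh, hh, hδ, hδ]
      dmul := fun x y => by
        obtain ⟨i, b, hb⟩ := hfin ![x, y]
        have hx : h i (b 0) = x := (hh i _).trans (congrFun hb 0)
        have hy : h i (b 1) = y := (hh i _).trans (congrFun hb 1)
        have hadd := (TM.hom (M := (G i).toTM) (N := U₁) (h i)).map_add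
        have hmul := (TM.hom (M := (G i).toTM) (N := U₁) (h i)).map_mul
        have h1 := hδ i (b 0 * b 1)
        rw [(G i).dmul, ← hh, ← hh] at h1
        rw [← hx, ← hy]
        refine (congrArg (delta U) (hmul (b 0) (b 1))).symm.trans (h1.symm.trans
          ((hadd _ _).trans ?_))
        rw [hmul, hmul, TM.hom_apply, TM.hom_apply, TM.hom_apply, TM.hom_apply, hh, hh, hh, hh,
          hδ, hδ]
      dext := fun a => by
        have h1 : ∀ a, U₁.sigma a = h 0 ((G 0).toTM.sigma a) := fun a =>
          (TM.map_sigma (M := (G 0).toTM) (N := U₁) (h 0) a).symm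
        change delta U (U₁.sigma a) = U₁.sigma (η a)
        rw [h1, h1, hh, hh, ← (G 0).dext]
        exact (hδ 0 _).symm }
  refine ⟨U₂, h 0, fun x => by rw [hh, hh]; exact hδ 0 x, fun n k ψ b hb => ?_⟩
  obtain ⟨i, b', rfl⟩ := hfin b
  have hb' : DeepHyp ψ U₁ (o i ∘ b') := hb
  have hob : ∀ l (c : Fin k → G l), o l ∘ c = h l ∘ c := fun l c => funext fun x => (hh l _).symm
  -- The hypothesis of the instance is `L`-definable, so it descends to stage `i`; the witness
  -- appears at stage `i + 1`.
  rw [hob, (UDef.deepHyp hK ψ).elementary (M := (G i).toTM) (N := U₁) (h i)] at hb'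
  obtain ⟨c, hc⟩ := hSG i n k ψ b' hb'
  refine ⟨o (i + 1) c, ?_⟩
  have hit : ∀ m, (delta U)^[m] (o (i + 1) c) = o (i + 1) ((delta (G (i + 1)))^[m] c) := by
    intro m
    induction m with
    | zero => rfl
    | succ m ih => rw [Function.iterate_succ_apply', Function.iterate_succ_apply', ih, hδ]
  have h3 := ((h (i + 1)).map_formula ψ _).2 hc
  convert! h3 using 1
  ext (l | l)
  · exact (hit l).trans (hh _ _).symm
  · refine (hof (Nat.le_succ i) (b' l)).symm.trans ((hh (i + 1) _).symm.trans ?_)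
    refine congrArg (h (i + 1)) ?_
    rw [DirectedSystem.coe_natLERec]
    exact Nat.leRecOn_succ' (next := fun {k} => ⇑(g' k)) _

end DerivationModels
end GenericDerivation

/-! ### Elimination of quantifiers down to jets. -/

namespace GenericDerivation

section QuantifierElimination

variable {L : FirstOrder.Language.{u, v}} {ι : FirstOrder.Language.ring →ᴸ L} {K : Type w} [Field K]
  [Ring.CompatibleRing K] [L.Structure K] [ι.IsExpansionOn K]
  {η : Derivation ℤ (dclEmpty ι K) (dclEmpty ι K)} {α β β' γ κ : Type*}

/-! ### Implicit differentiation -/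

/-- On coefficients `δ` acts as the fixed `η`, so by the Leibniz rule the derivative of `c(x)` is
one `L`-definable function of `x` and `δx`, the same in all models. -/
theorem exists_ufun_delta_eval₂ (c : MvPolynomial β (dclEmpty ι K)) :
    ∃ h : ∀ M : TM ι K, (β ⊕ β → M) → M, UFun L (fun M : TM ι K => M) h ∧
      ∀ (M : DM η) (x : β → M), delta M (MvPolynomial.eval₂Hom M.sigma x c) =
        h M.toTM (Sum.elim x (delta M ∘ x)) := by
  induction c using MvPolynomial.induction_on with
  | C a => exact ⟨_, UFun.sigma (η a), fun M x => by simpa using M.dext a⟩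
  | add p q hp hq =>
    obtain ⟨g, hg, hg'⟩ := hp
    obtain ⟨k, hk, hk'⟩ := hq
    exact ⟨_, UFun.add (T := fun M : TM ι K => M) hg hk, fun M x => by
      rw [map_add, M.dadd, hg', hk']⟩
  | mul_X p b hp =>
    obtain ⟨g, hg, hg'⟩ := hp
    refine ⟨_, UFun.add (T := fun M : TM ι K => M)
      (UFun.mul (T := fun M : TM ι K => M) ((UFun.eval₂ p).comap Sum.inl) (UFun.var (Sum.inr b)))
      (UFun.mul (T := fun M : TM ι K => M) (UFun.var (Sum.inl b)) hg), fun M x => ?_⟩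
    rw [map_mul, M.dmul, hg']
    simp

/-- The chain rule for `q(x, y)`, with the term that is linear in `δy` split off so that the
equation can be solved for it. -/
theorem exists_ufun_delta_eval (q : Polynomial (MvPolynomial β (dclEmpty ι K))) :
    ∃ h : ∀ M : TM ι K, ((β ⊕ β) ⊕ Unit → M) → M, UFun L (fun M : TM ι K => M) h ∧
      ∀ (M : DM η) (x : β → M) (y : M), delta M ((M.spec x q).eval y) =
        h M.toTM (Sum.elim (Sum.elim x (delta M ∘ x)) fun _ => y) +
          (M.spec x (Polynomial.derivative q)).eval y * delta M y := by
  induction q using Polynomial.induction_on' with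
  | add p q hp hq =>
    obtain ⟨g, hg, hg'⟩ := hp
    obtain ⟨k, hk, hk'⟩ := hq
    refine ⟨_, UFun.add (T := fun M : TM ι K => M) hg hk, fun M x y => ?_⟩
    have h1 := hg' M x y
    have h2 := hk' M x y
    simp only [TM.spec, Polynomial.derivative_add, Polynomial.map_add, Polynomial.eval_add] at h1 h2 ⊢
    rw [M.dadd, h1, h2]
    ring
  | monomial n c =>
    obtain ⟨g, hg, hg'⟩ := exists_ufun_delta_eval₂ (η := η) c
    refine ⟨_, UFun.mul (T := fun M : TM ι K => M) (hg.comap Sum.inl)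
      (UFun.pow (T := fun M : TM ι K => M) (UFun.var (Sum.inr ())) n), fun M x y => ?_⟩
    have hpow : delta M (y ^ n) = n * y ^ (n - 1) * delta M y := by
      rw [← M.der_apply, M.der.leibniz_pow, M.der_apply]
      simp [mul_assoc]
    simp only [TM.spec, Polynomial.map_monomial, Polynomial.eval_monomial,
      Polynomial.derivative_monomial, M.dmul, hg', hpow, map_mul, map_natCast, Sum.elim_inr,
      Sum.elim_comp_inl]
    ring

/-- In characteristic 0, a root of multiplicity `e + 1` is a simple root of the `e`-th derivative.
This replaces the minimal polynomial in implicit differentiation. -/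
theorem exists_iterate_derivative {M : Type*} [Field M] [CharZero M] {q : Polynomial M} (hq : q ≠ 0)
    {y : M} (hy : q.eval y = 0) : ∃ e < q.natDegree, (Polynomial.derivative^[e] q).eval y = 0 ∧
      (Polynomial.derivative^[e + 1] q).eval y ≠ 0 := by
  classical
  have hpos := (Polynomial.rootMultiplicity_pos hq).2 hy
  have key := fun n => Polynomial.lt_rootMultiplicity_iff_isRoot_iterate_derivative (t := y) (n := n) hq
  obtain ⟨e, he⟩ : ∃ e, q.rootMultiplicity y = e + 1 := ⟨_, (Nat.sub_add_cancel hpos).symm⟩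
  refine ⟨e, ?_, (key e).1 (by omega) e le_rfl, fun h => ?_⟩
  · have h1 := Polynomial.card_roots' q
    have h2 := Multiset.count_le_card y q.roots
    rw [Polynomial.count_roots] at h2
    omega
  · have h1 : e + 1 < q.rootMultiplicity y := (key _).2 fun m hm => by
      rcases Nat.le_succ_iff.1 hm with hm | rfl
      · exact (key e).1 (by omega) m hm
      · exact h
    omega

/-- The derivative of an element of a finite set that is definable over `x` is definable from
`x`, `δx` and this element. -/
theorem exists_udef_delta [CharZero K] (hK : IsAlgebraicallyBounded L (dclEmpty ι K))
    {R : ∀ M : TM ι K, (β ⊕ Unit → M) → Prop} (h : UDef L (fun M : TM ι K => M) R) :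
    ∃ G : ∀ M : TM ι K, ((β ⊕ β) ⊕ Fin 2 → M) → Prop, UDef L (fun M : TM ι K => M) G ∧
      ∀ (M : DM η) (x : β → M) (y : M), R M.toTM (Sum.elim x fun _ => y) →
        {y | R M.toTM (Sum.elim x fun _ => y)}.Finite → ∀ z,
          G M.toTM (Sum.elim (Sum.elim x (delta M ∘ x)) ![y, z]) ↔ z = delta M y := by
  obtain ⟨m, N, p, hp⟩ := exists_polynomials hK h
  choose g hg hg' using fun q : Polynomial (MvPolynomial β (dclEmpty ι K)) =>
    exists_ufun_delta_eval (η := η) q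
  let q : Fin m → ℕ → Polynomial (MvPolynomial β (dclEmpty ι K)) :=
    fun i e => Polynomial.derivative^[e] (p i)
  -- `y` is a simple root of the `e`-th derivative of some `p i`, and `z` solves the linear equation
  -- obtained by applying `δ` to this relation. Bounding `e` by the degree keeps the disjunction
  -- finite.
  refine ⟨fun M v => ∃ i, ∃ e : Fin (p i).natDegree,
    (M.spec (v ∘ Sum.inl ∘ Sum.inl) (q i e)).eval (v (Sum.inr 0)) = 0 ∧
    (M.spec (v ∘ Sum.inl ∘ Sum.inl) (q i (e + 1))).eval (v (Sum.inr 0)) ≠ 0 ∧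
    g (q i e) M (v ∘ Sum.map id fun _ => 0) +
      (M.spec (v ∘ Sum.inl ∘ Sum.inl) (q i (e + 1))).eval (v (Sum.inr 0)) * v (Sum.inr 1) = 0,
    ?_, ?_⟩
  · have hu : ∀ q, UFun L (fun M : TM ι K => M) (fun M (v : (β ⊕ β) ⊕ Fin 2 → M) =>
        (M.spec (v ∘ Sum.inl ∘ Sum.inl) q).eval (v (Sum.inr 0))) := fun q =>
      (UFun.eval_spec q).comap (Sum.map Sum.inl fun _ => 0)
    refine UDef.iEx fun i => UDef.iEx fun e => ?_
    refine UDef.and (UDef.eq (hu _) (UFun.zero (T := fun M : TM ι K => M)))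
      (UDef.and (UDef.eq (hu _) (UFun.zero (T := fun M : TM ι K => M))).not
        (UDef.eq (UFun.add (T := fun M : TM ι K => M) ((hg _).comap _)
          (UFun.mul (T := fun M : TM ι K => M) (hu _) (UFun.var _)))
          (UFun.zero (T := fun M : TM ι K => M))))
  · intro M x y hy hfin z
    have := M.toTM.charZero
    have hsum : Sum.elim (Sum.elim x (delta M ∘ x)) ![y, z] ∘ Sum.map id (fun _ : Unit => 0) =
        Sum.elim (Sum.elim x (delta M ∘ x)) fun _ => y := by
      ext (i | i) <;> rfl
    have hq : ∀ i e, Polynomial.derivative (q i e) = q i (e + 1) := fun i e =>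
      (Function.iterate_succ_apply' _ _ _).symm
    have hspec : ∀ i e, M.spec x (q i e) = Polynomial.derivative^[e] (M.spec x (p i)) := fun i e =>
      (Polynomial.iterate_derivative_map _ _ _).symm
    have h0 : delta M (0 : M) = 0 := M.der.map_zero
    change (∃ i, ∃ e : Fin (p i).natDegree, (M.spec x (q i e)).eval y = 0 ∧
      (M.spec x (q i (e + 1))).eval y ≠ 0 ∧ g (q i e) M.toTM
        (Sum.elim (Sum.elim x (delta M ∘ x)) ![y, z] ∘ Sum.map id fun _ => 0) +
        (M.spec x (q i (e + 1))).eval y * z = 0) ↔ _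
    rw [hsum]
    constructor
    -- Every admissible pair `(i, e)` gives the correct derivative, so the choice of the pair is
    -- immaterial.
    · rintro ⟨i, e, he, he', hz⟩
      have h1 := hg' (q i e) M x y
      rw [he, h0, hq] at h1
      exact mul_left_cancel₀ he' (add_left_cancel (hz.trans h1))
    · rintro rfl
      obtain ⟨i, hi, hroot⟩ := (hp M.toTM x).2 hfin
      obtain ⟨e, he, h1, h2⟩ := exists_iterate_derivative hi (hroot y hy)
      rw [← hspec] at h1 h2
      refine ⟨i, ⟨e, he.trans_le (M.natDegree_spec_le x (p i))⟩, h1, h2, ?_⟩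
      have h3 := hg' (q i e) M x y
      rw [h1, h0, hq] at h3
      exact h3.symm

/-! ### Elements that are definable from given tuples -/

/-- The elements `g i` are defined over the tuples `X i` by one `L`-formula. -/
def Det {I : Type*} {M : I → DM η} (X : ∀ i, β → M i) (g : ∀ i, M i) : Prop :=
  ∃ G : ∀ M : TM ι K, (β ⊕ Unit → M) → Prop, UDef L (fun M : TM ι K => M) G ∧
    ∀ i z, G (M i).toTM (Sum.elim (X i) fun _ => z) ↔ z = g i

section Det

variable {I : Type*} {M : I → DM η} {X : ∀ i, β → M i}

theorem Det.coord (b : β) : Det X (fun i => X i b) :=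
  ⟨_, UDef.eq (UFun.var (Sum.inr ())) (UFun.var (Sum.inl b)), fun _ _ => Iff.rfl⟩

/-- Elements definable over `X` can be eliminated from a predicate by quantifying over their values;
the finite support reduces this to finitely many. -/
theorem Det.exists_udef {g : κ → ∀ i, M i} (hg : ∀ k, Det X (g k))
    {R : ∀ M : TM ι K, (κ ⊕ γ → M) → Prop} (hR : UDef L (fun M : TM ι K => M) R) :
    ∃ R' : ∀ M : TM ι K, (β ⊕ γ → M) → Prop, UDef L (fun M : TM ι K => M) R' ∧
      ∀ i (z : γ → M i), R' (M i).toTM (Sum.elim (X i) z) ↔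
        R (M i).toTM (Sum.elim (fun k => g k i) z) := by
  classical
  choose G hG hGi using hg
  obtain ⟨s, S, hS, hRS⟩ := hR.finite_support
  refine ⟨fun N v => ∃ y : s → N, (∀ a : s, Sum.elim
      (fun k => G k N (Sum.elim (v ∘ Sum.inl) fun _ => y a)) (fun c => y a = v (Sum.inr c)) (a : κ ⊕ γ))
      ∧ S N y, ?_, fun i z => ?_⟩
  · refine UDef.ex (R := fun (N : TM ι K) (v : β ⊕ γ → N) (y : s → N) => (∀ a : s, Sum.elim
      (fun k => G k N (Sum.elim (v ∘ Sum.inl) fun _ => y a)) (fun c => y a = v (Sum.inr c)) (a : κ ⊕ γ))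
      ∧ S N y) (UDef.and (UDef.iAll fun a => ?_) (hS.comap _))
    obtain ⟨k | c, ha⟩ := a
    · refine ((hG k).comap (Sum.elim (Sum.inl ∘ Sum.inl) fun _ => Sum.inr ⟨Sum.inl k, ha⟩)).congr
        fun N v => iff_of_eq (congrArg (G k N) (by ext (b | b) <;> rfl))
    · exact UDef.eq (UFun.var (Sum.inr (⟨Sum.inr c, ha⟩ : s)))
        (UFun.var (Sum.inl (Sum.inr c)))
  · rw [hRS]
    constructor
    · rintro ⟨y, hy, hSy⟩
      convert hSy using 2 with ⟨k | c, ha⟩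
      · exact ((hGi k i _).1 (hy ⟨Sum.inl k, ha⟩)).symm
      · exact (hy ⟨Sum.inr c, ha⟩).symm
    · intro h
      refine ⟨_, ?_, h⟩
      intro ⟨a, ha⟩
      rcases a with k | c
      · exact (hGi k i _).2 rfl
      · rfl

/-- Implicit differentiation expresses `δg` through `Y`, `δY` and `g`, which are all definable over
`X`. The finite set over `Y` need not single out `g`, since `X` does. -/
theorem Det.delta_of_finite [CharZero K] (hK : IsAlgebraicallyBounded L (dclEmpty ι K))
    {Y : β' → ∀ i, M i} (hY : ∀ b, Det X (Y b)) (hY' : ∀ b, Det X (fun i => delta (M i) (Y b i)))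
    {g : ∀ i, M i} (hg : Det X g) {R : ∀ M : TM ι K, (β' ⊕ Unit → M) → Prop}
    (hR : UDef L (fun M : TM ι K => M) R)
    (hRg : ∀ i, R (M i).toTM (Sum.elim (fun b => Y b i) fun _ => g i))
    (hfin : ∀ i, {y | R (M i).toTM (Sum.elim (fun b => Y b i) fun _ => y)}.Finite) :
    Det X (fun i => delta (M i) (g i)) := by
  obtain ⟨G, hG, hGi⟩ := exists_udef_delta (η := η) hK hR
  obtain ⟨S, hS, hSi⟩ := Det.exists_udef (X := X) (g := Sum.elim (Sum.elim Y
      fun b i => delta (M i) (Y b i)) fun _ : Unit => g) (γ := Unit) (by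
    rintro ((b | b) | b)
    exacts [hY b, hY' b, hg]) (R := fun N v => G N (v ∘ Sum.elim (Sum.inl ∘ Sum.inl)
      ![Sum.inl (Sum.inr ()), Sum.inr ()])) (hG.comap _)
  refine ⟨S, hS, fun i z => ?_⟩
  rw [hSi, ← hGi (M i) _ _ (hRg i) (hfin i)]
  refine iff_of_eq (congrArg (G (M i).toTM) ?_)
  ext ((b | b) | b)
  · rfl
  · rfl
  · fin_cases b <;> rfl

/-- Definability over `X` puts `g` in a singleton definable over `X`, so implicit differentiation
applies. -/
theorem Det.delta [CharZero K] (hK : IsAlgebraicallyBounded L (dclEmpty ι K))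
    (hX : ∀ b, Det X (fun i => delta (M i) (X i b))) {g : ∀ i, M i} (hg : Det X g) :
    Det X (fun i => delta (M i) (g i)) := by
  obtain ⟨G, hG, hGi⟩ := hg
  refine Det.delta_of_finite hK (Y := fun b i => X i b) (fun b => Det.coord b) hX ⟨G, hG, hGi⟩ hG
    (fun i => (hGi i _).2 rfl) fun i => ?_
  simp only [hGi]
  exact Set.finite_singleton _

end Det

/-! ### Quantifier elimination -/

/-- The jets of a tuple. -/
def jet (M : DM η) (x : α → M) : α × ℕ → M := fun a => (delta M)^[a.2] (x a.1)

/-- The scheme "deep" holds in `M`. -/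
def DM.IsDeep (M : DM η) : Prop :=
  ∀ (n k : ℕ) (ψ : L.Formula (Fin (n + 1) ⊕ Fin k)), deepInstance ψ M (delta M)

/-- In the models that satisfy the scheme "deep", the predicate `P` is defined by an `L`-formula
in the jets. -/
def JetDef (P : ∀ M : DM η, (α → M) → Prop) : Prop :=
  ∃ R : ∀ M : TM ι K, (α × ℕ → M) → Prop, UDef L (fun M : TM ι K => M) R ∧
    ∀ M : DM η, M.IsDeep → ∀ x, P M x ↔ R M.toTM (jet M x)

theorem JetDef.congr {P Q : ∀ M : DM η, (α → M) → Prop} (h : JetDef P)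
    (e : ∀ M : DM η, M.IsDeep → ∀ x, P M x ↔ Q M x) : JetDef Q := by
  obtain ⟨R, hR, hP⟩ := h
  exact ⟨R, hR, fun M hM x => (e M hM x).symm.trans (hP M hM x)⟩

theorem JetDef.or {P Q : ∀ M : DM η, (α → M) → Prop} (hP : JetDef P) (hQ : JetDef Q) :
    JetDef (fun M x => P M x ∨ Q M x) := by
  obtain ⟨R, hR, hP⟩ := hP
  obtain ⟨S, hS, hQ⟩ := hQ
  exact ⟨_, hR.or hS, fun M hM x => or_congr (hP M hM x) (hQ M hM x)⟩

theorem JetDef.imp {P Q : ∀ M : DM η, (α → M) → Prop} (hP : JetDef P) (hQ : JetDef Q) :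
    JetDef (fun M x => P M x → Q M x) := by
  obtain ⟨R, hR, hP⟩ := hP
  obtain ⟨S, hS, hQ⟩ := hQ
  exact ⟨_, hR.imp hS, fun M hM x => imp_congr (hP M hM x) (hQ M hM x)⟩

theorem JetDef.not {P : ∀ M : DM η, (α → M) → Prop} (hP : JetDef P) :
    JetDef (fun M x => ¬ P M x) := by
  obtain ⟨R, hR, hP⟩ := hP
  exact ⟨_, hR.not, fun M hM x => not_congr (hP M hM x)⟩

theorem UDef.exists_formula_fin {R : ∀ M : TM ι K, (α ⊕ γ → M) → Prop}
    (h : UDef L (fun M : TM ι K => M) R) :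
    ∃ (k : ℕ) (g : Fin k → α) (φ : L.Formula (γ ⊕ Fin k)), ∀ (M : TM ι K) x y,
      R M (Sum.elim x y) ↔ φ.Realize (Sum.elim y (x ∘ g)) := by
  classical
  obtain ⟨s, R', ⟨φ, hφ⟩, hR⟩ := h.finite_support
  let e := Fintype.equivFin s.toLeft
  refine ⟨_, fun i => (e.symm i : α), φ.relabel (fun a : s => match a with
    | ⟨Sum.inl b, hb⟩ => Sum.inr (e ⟨b, by simpa using hb⟩)
    | ⟨Sum.inr c, _⟩ => Sum.inl c), fun M x y => ?_⟩
  rw [hR, ← hφ, Formula.realize_relabel]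
  refine iff_of_eq (congrArg φ.Realize ?_)
  ext ⟨b | u, hb⟩ <;> simp

theorem DM.IsDeep.exists_of_big {M : DM η} (hM : M.IsDeep)
    (hK : IsAlgebraicallyBounded L (dclEmpty ι K)) {m : ℕ}
    {R : ∀ M : TM ι K, (α ⊕ Fin (m + 1) → M) → Prop} (h : UDef L (fun M : TM ι K => M) R)
    (x : α → M) (hx : Big m {z : Fin m → M | ∃ y : M,
      R M.toTM (Sum.elim x (Fin.snoc z y : Fin (m + 1) → M))}) :
    ∃ c : M, R M.toTM (Sum.elim x fun i => (delta M)^[(i : ℕ)] c) := by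
  obtain ⟨k, g, φ, hφ⟩ := h.exists_formula_fin
  simp only [hφ] at hx ⊢
  exact hM m k φ (x ∘ g) ((deepHyp_iff_big hK φ M.toTM (x ∘ g)).2 hx)

/-- The jet of length `m` of an element. -/
def shortJet (M : DM η) (m : ℕ) (c : M) : Fin m → M := fun i => (delta M)^[(i : ℕ)] c

theorem shortJet_succ (M : DM η) (m : ℕ) (c : M) :
    shortJet M (m + 1) c = (Fin.snoc (shortJet M m c) ((delta M)^[m] c) : Fin (m + 1) → M) := by
  ext i
  refine Fin.lastCases ?_ (fun i => ?_) i <;> simp [shortJet]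

theorem UDef.ex_snoc {m : ℕ} {R : ∀ M : TM ι K, (α ⊕ Fin (m + 1) → M) → Prop}
    (h : UDef L (fun M : TM ι K => M) R) : UDef L (fun M : TM ι K => M)
      (fun M (v : α ⊕ Fin m → M) =>
        ∃ y : M, R M (Sum.elim (v ∘ Sum.inl) (Fin.snoc (v ∘ Sum.inr) y : Fin (m + 1) → M))) :=
  UDef.ex1 (R := fun (M : TM ι K) (v : α ⊕ Fin m → M) y =>
    R M (Sum.elim (v ∘ Sum.inl) (Fin.snoc (v ∘ Sum.inr) y : Fin (m + 1) → M))) h.fibre_snoc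

/-- If the element `δᵏc` lies in a finite set definable over the previous derivatives, then all
derivatives of `c` are definable over the first ones. -/
theorem det_iterate_delta [CharZero K] (hK : IsAlgebraicallyBounded L (dclEmpty ι K)) {k : ℕ}
    {R : ∀ M : TM ι K, ((α × ℕ) ⊕ Fin (k + 1) → M) → Prop} (hR : UDef L (fun M : TM ι K => M) R)
    {I : Type*} {M : I → DM η} {x : ∀ i, α → M i} {c : ∀ i, M i}
    (hRc : ∀ i, R (M i).toTM (Sum.elim (jet (M i) (x i)) (shortJet (M i) (k + 1) (c i))))
    (hfin : ∀ i, {y | R (M i).toTM (Sum.elim (jet (M i) (x i))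
      (Fin.snoc (shortJet (M i) k (c i)) y : Fin (k + 1) → M i))}.Finite) (j : ℕ) :
    Det (fun i => Sum.elim (jet (M i) (x i)) (shortJet (M i) (k + 1) (c i)))
      (fun i => (delta (M i))^[j] (c i)) := by
  set X : ∀ i, (α × ℕ) ⊕ Fin (k + 1) → M i :=
    fun i => Sum.elim (jet (M i) (x i)) (shortJet (M i) (k + 1) (c i)) with hX
  have hjet : ∀ a, Det X (fun i => delta (M i) (jet (M i) (x i) a)) := fun a => by
    have := Det.coord (X := X) (Sum.inl (a.1, a.2 + 1))
    simpa [hX, jet, Function.iterate_succ_apply'] using this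
  have hle : ∀ j ≤ k, Det X (fun i => (delta (M i))^[j] (c i)) := fun j hj =>
    Det.coord (X := X) (Sum.inr ⟨j, by omega⟩)
  -- The first new derivative comes from differentiating the finite set that contains `δᵏc`. After
  -- that the derivatives of all entries of `X` are definable over `X`, so `Det.delta` can be
  -- iterated.
  have hk : Det X (fun i => (delta (M i))^[k + 1] (c i)) := by
    simp only [Function.iterate_succ_apply']
    refine Det.delta_of_finite hK (Y := Sum.elim (fun a i => jet (M i) (x i) a)
      (fun (j : Fin k) i => shortJet (M i) k (c i) j)) ?_ ?_ (hle k le_rfl) hR.fibre_snoc ?_ ?_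
    · rintro (a | j)
      · exact Det.coord (Sum.inl a)
      · exact hle j j.2.le
    · rintro (a | j)
      · exact hjet a
      · have := hle (j + 1) j.2
        simpa [shortJet, Function.iterate_succ_apply'] using this
    · intro i
      have := hRc i
      rw [shortJet_succ] at this
      exact this
    · exact hfin
  have hall : ∀ j, Det X (fun i => (delta (M i))^[k + 1 + j] (c i)) := by
    intro j
    induction j with
    | zero => exact hk
    | succ j ih =>
      simp only [← add_assoc, Function.iterate_succ_apply']
      refine Det.delta hK ?_ ih
      rintro (a | ⟨j, hj⟩)
      · exact hjet a
      · have : Det X (fun i => (delta (M i))^[j + 1] (c i)) := by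
          rcases Nat.lt_or_ge j k with h | h
          · exact hle _ h
          · rwa [show j = k by omega]
        simpa [hX, shortJet, Function.iterate_succ_apply'] using this
  rcases Nat.lt_or_ge k j with h | h
  · obtain ⟨l, rfl⟩ := Nat.exists_eq_add_of_lt h
    rw [add_right_comm]
    exact hall l
  · exact hle j h

/-- The non-generic case of the elimination: a short jet in a set that is not big meets a finite
fibre at some coordinate. Induction on `k` looks for this coordinate from the top. There all later
derivatives become definable, and the elimination for lower order, given as `ih`, finishes. -/
theorem jetDef_exists_of_not_big [CharZero K] (hK : IsAlgebraicallyBounded L (dclEmpty ι K)) {m : ℕ}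
    (ih : ∀ k ≤ m, ∀ S : ∀ M : TM ι K, ((α × ℕ) ⊕ Fin k → M) → Prop,
      UDef L (fun M : TM ι K => M) S → JetDef (fun (M : DM η) (x : α → M) =>
        ∃ c : M, S M.toTM (Sum.elim (jet M x) (shortJet M k c))))
    {S : ∀ M : TM ι K, ((α × ℕ) ⊕ Fin (m + 1) → M) → Prop} (hS : UDef L (fun M : TM ι K => M) S) :
    ∀ k ≤ m, ∀ R : ∀ M : TM ι K, ((α × ℕ) ⊕ Fin k → M) → Prop, UDef L (fun M : TM ι K => M) R →
      JetDef (fun (M : DM η) (x : α → M) => ∃ c : M,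
        S M.toTM (Sum.elim (jet M x) (shortJet M (m + 1) c)) ∧
        R M.toTM (Sum.elim (jet M x) (shortJet M k c)) ∧
        ¬ Big k {z | R M.toTM (Sum.elim (jet M x) z)}) := by
  intro k
  induction k generalizing S with
  | zero =>
    intro _ R _
    refine ⟨_, UDef.false, fun M _ x => iff_of_false ?_ id⟩
    rintro ⟨c, -, hc, hb⟩
    exact hb ⟨_, hc⟩
  | succ k ihk =>
    intro hk R hR
    -- The family of all configurations with a finite fibre, over all models, so that definability
    -- over this family yields a single formula `S'`.
    let I : Type _ := {t : Σ M : DM η, (α → M) × M //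
      R t.1.toTM (Sum.elim (jet t.1 t.2.1) (shortJet t.1 (k + 1) t.2.2)) ∧
      {y | R t.1.toTM (Sum.elim (jet t.1 t.2.1)
        (Fin.snoc (shortJet t.1 k t.2.2) y : Fin (k + 1) → t.1))}.Finite}
    have hdet := det_iterate_delta hK hR (I := I) (M := fun t => t.1.1) (x := fun t => t.1.2.1)
      (c := fun t => t.1.2.2) (fun t => t.2.1) (fun t => t.2.2)
    obtain ⟨S', hS', hSS'⟩ := Det.exists_udef (γ := Empty) (X := fun t : I => Sum.elim
      (jet t.1.1 t.1.2.1) (shortJet t.1.1 (k + 1) t.1.2.2)) (g := Sum.elim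
      (fun a (t : I) => jet t.1.1 t.1.2.1 a) (fun (j : Fin (m + 1)) (t : I) =>
        (delta t.1.1)^[(j : ℕ)] t.1.2.2)) (by
      rintro (a | j)
      · exact Det.coord (Sum.inl a)
      · exact hdet j) (R := fun N v => S N (v ∘ Sum.inl)) (hS.comap _)
    -- Infinite fibre: the shorter jet lies in the set of points with infinite fibre, which is not
    -- big by the definition of `Big`. The condition `R` is kept by absorbing it into `S`.
    have h1 := ihk (S := fun N v => S N v ∧
      R N (v ∘ Sum.map id (Fin.castLE (Nat.succ_le_succ (Nat.le_of_succ_le hk)))))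
      (hS.and (hR.comap _)) (by omega) _ (UDef.infinite_snoc hK hR)
    -- Finite fibre: `S` is rewritten as a condition on the jet of length `k + 1 ≤ m`.
    have h2 := ih (k + 1) hk (fun N v => S' N (v ∘ Sum.elim id Empty.elim) ∧ R N v ∧
      (¬ {y | R N (Sum.elim (v ∘ Sum.inl) (Fin.snoc (fun j : Fin k => v (Sum.inr j.castSucc)) y :
        Fin (k + 1) → N))}.Infinite) ∧
      ¬ Big (k + 1) {z | R N (Sum.elim (v ∘ Sum.inl) z)})
      ((hS'.comap _).and (hR.and (((UDef.infinite_snoc hK hR).comap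
        (Sum.map id Fin.castSucc)).not.and ((UDef.big hK hR).comap Sum.inl).not)))
    refine (h1.or h2).congr fun M _ x => ?_
    have hinit : ∀ c : M, (fun j : Fin k => shortJet M (k + 1) c j.castSucc) = shortJet M k c :=
      fun _ => rfl
    have hSS'' : ∀ c : M, R M.toTM (Sum.elim (jet M x) (shortJet M (k + 1) c)) →
        {y | R M.toTM (Sum.elim (jet M x) (Fin.snoc (shortJet M k c) y : Fin (k + 1) → M))}.Finite →
        (S' M.toTM (Sum.elim (jet M x) (shortJet M (k + 1) c) ∘ Sum.elim id Empty.elim) ↔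
          S M.toTM (Sum.elim (jet M x) (shortJet M (m + 1) c))) := by
      intro c hc hf
      have h3 := hSS' ⟨⟨M, x, c⟩, hc, hf⟩ Empty.elim
      convert! h3 using 2
      · ext (i | i)
        · rfl
        · exact i.elim
      · ext (i | i) <;> rfl
    constructor
    · rintro (⟨c, ⟨hc, hc'⟩, -, hb⟩ | ⟨c, hc, hc', hf, hb⟩)
      · refine ⟨c, hc, ?_, hb⟩
        convert! hc' using 2
        ext (i | i) <;> rfl
      · exact ⟨c, (hSS'' c hc' (Set.not_infinite.1 hf)).1 hc, hc', hb⟩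
    · rintro ⟨c, hc, hc', hb⟩
      by_cases hf : {y | R M.toTM (Sum.elim (jet M x)
          (Fin.snoc (shortJet M k c) y : Fin (k + 1) → M))}.Infinite
      · refine Or.inl ⟨c, ⟨hc, ?_⟩, hf, hb⟩
        convert! hc' using 2
        ext (i | i) <;> rfl
      · exact Or.inr ⟨c, (hSS'' c hc' (Set.not_infinite.1 hf)).2 hc, hc', hf, hb⟩

/-- Strong induction on the length of the jet. If the projection that forgets the top derivative is
big, deepness provides a solution; otherwise any solution is non-generic and the problem reduces to
shorter jets. -/
theorem jetDef_exists_shortJet [CharZero K] (hK : IsAlgebraicallyBounded L (dclEmpty ι K)) (m : ℕ) :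
    ∀ S : ∀ M : TM ι K, ((α × ℕ) ⊕ Fin m → M) → Prop, UDef L (fun M : TM ι K => M) S →
      JetDef (fun (M : DM η) (x : α → M) =>
        ∃ c : M, S M.toTM (Sum.elim (jet M x) (shortJet M m c))) := by
  induction m using Nat.strong_induction_on with
  | _ m ih =>
    intro S hS
    rcases m with _ | m
    · refine ⟨_, hS.comap (Sum.elim id Fin.elim0), fun M _ x => ?_⟩
      have : ∀ c : M, Sum.elim (jet M x) (shortJet M 0 c) = jet M x ∘ Sum.elim id Fin.elim0 := by
        intro c
        ext (i | i)
        · rfl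
        · exact i.elim0
      simp only [this]
      exact ⟨fun ⟨_, h⟩ => h, fun h => ⟨0, h⟩⟩
    · have hbig : JetDef (fun (M : DM η) (x : α → M) => Big m {z : Fin m → M | ∃ y : M,
          S M.toTM (Sum.elim (jet M x) (Fin.snoc z y : Fin (m + 1) → M))}) :=
        ⟨_, UDef.big hK hS.ex_snoc, fun M _ x => Iff.rfl⟩
      refine (hbig.or (jetDef_exists_of_not_big hK (fun k hk => ih k (by omega)) hS m le_rfl _
        hS.ex_snoc)).congr fun M hM x => ?_
      constructor
      · rintro (h | ⟨c, hc, -⟩)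
        · exact hM.exists_of_big hK hS (jet M x) h
        · exact ⟨c, hc⟩
      · rintro ⟨c, hc⟩
        by_cases hb : Big m {z : Fin m → M | ∃ y : M,
          S M.toTM (Sum.elim (jet M x) (Fin.snoc z y : Fin (m + 1) → M))}
        · exact Or.inl hb
        · refine Or.inr ⟨c, hc, ⟨(delta M)^[m] c, ?_⟩, hb⟩
          rw [shortJet_succ] at hc
          exact hc

theorem JetDef.ex1 [CharZero K] (hK : IsAlgebraicallyBounded L (dclEmpty ι K))
    {P : ∀ M : DM η, (α → M) → M → Prop}
    (h : JetDef (fun (M : DM η) (v : α ⊕ Unit → M) => P M (v ∘ Sum.inl) (v (Sum.inr ())))) :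
    JetDef (fun (M : DM η) (v : α → M) => ∃ c, P M v c) := by
  classical
  obtain ⟨R, hR, hP⟩ := h
  obtain ⟨s, S, hS, hRS⟩ := hR.finite_support
  obtain ⟨m, hm⟩ : ∃ m, ∀ a ∈ s, a.2 < m :=
    ⟨s.sup Prod.snd + 1, fun a ha => Nat.lt_succ_of_le (Finset.le_sup (f := Prod.snd) ha)⟩
  let e : s → (α × ℕ) ⊕ Fin m := fun a => match a with
    | ⟨(Sum.inl b, n), _⟩ => Sum.inl (b, n)
    | ⟨(Sum.inr _, n), ha⟩ => Sum.inr ⟨n, hm _ ha⟩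
  refine (jetDef_exists_shortJet hK m _ (hS.comap e)).congr fun M hM x => exists_congr fun c => ?_
  have h1 := hP M hM (Sum.elim x fun _ => c)
  refine Iff.trans ?_ h1.symm
  rw [hRS]
  refine iff_of_eq (congrArg (S M.toTM) ?_)
  ext ⟨⟨b | b, n⟩, ha⟩ <;> rfl

/-- The symbol `δ` may be applied to arbitrary `L`-terms, whose derivatives need not be terms in the
jets; `Det.delta` still makes them definable over the jets, without deepness. -/
theorem det_term [CharZero K] (hK : IsAlgebraicallyBounded L (dclEmpty ι K))
    (t : (withDelta L).Term α) : Det (fun i : Σ M : DM η, (α → M) => jet i.1 i.2)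
      (fun i => t.realize i.2) := by
  induction t with
  | var a => exact Det.coord (X := fun i : Σ M : DM η, (α → M) => jet i.1 i.2) (a, 0)
  | func f ts ih =>
    rcases f with f | f
    · obtain ⟨S, hS, h⟩ := Det.exists_udef ih (R := fun (N : TM ι K) (v : _ ⊕ Unit → N) =>
        v (Sum.inr ()) = Structure.funMap f fun k => v (Sum.inl k)) (UDef.eq (UFun.var _)
          (UFun.term (Term.func f fun k => Term.var (Sum.inl k))))
      exact ⟨S, hS, fun i z => h i _⟩
    · cases f
      have := Det.delta hK (fun a => by
        have := Det.coord (X := fun i : Σ M : DM η, (α → M) => jet i.1 i.2) (a.1, a.2 + 1)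
        simpa only [jet, Function.iterate_succ_apply'] using this) (ih 0)
      convert! this using 2 with i
      change Structure.funMap deltaSymbol _ = Structure.funMap deltaSymbol _
      congr 1
      ext k
      rw [Subsingleton.elim k 0]; rfl

theorem jetDef_atomic [CharZero K] (hK : IsAlgebraicallyBounded L (dclEmpty ι K))
    {t : κ → (withDelta L).Term α} {R : ∀ M : TM ι K, (κ → M) → Prop}
    (hR : UDef L (fun M : TM ι K => M) R) :
    JetDef (fun (M : DM η) (x : α → M) => R M.toTM fun k => (t k).realize x) := by
  obtain ⟨S, hS, h⟩ := Det.exists_udef (γ := Empty) (fun k => det_term (η := η) hK (t k))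
    (R := fun N v => R N (v ∘ Sum.inl)) (hR.comap _)
  refine ⟨_, hS.comap (Sum.elim id Empty.elim), fun M _ x => ((h ⟨M, x⟩ Empty.elim).symm.trans ?_)⟩
  refine iff_of_eq (congrArg (S M.toTM) ?_)
  ext (i | i)
  · rfl
  · exact i.elim

/-- In the models that satisfy the scheme "deep", every formula in the language with a derivation
is equivalent to an `L`-formula in the jets of its variables. -/
theorem jetDef_realize [CharZero K] (hK : IsAlgebraicallyBounded L (dclEmpty ι K)) {n : ℕ}
    (φ : (withDelta L).BoundedFormula α n) :
    JetDef (fun (M : DM η) (v : α ⊕ Fin n → M) => φ.Realize (v ∘ Sum.inl) (v ∘ Sum.inr)) := by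
  induction φ with
  | falsum => exact ⟨_, UDef.false, fun M _ x => Iff.rfl⟩
  | equal t₁ t₂ =>
    refine (jetDef_atomic (η := η) hK (t := ![t₁, t₂]) (R := fun M v => v 0 = v 1)
      (UDef.eq (UFun.var _) (UFun.var _))).congr fun M _ v => ?_
    simp only [BoundedFormula.Realize, Sum.elim_comp_inl_inr]
    rfl
  | rel r ts =>
    rcases r with r | r
    · refine (jetDef_atomic (η := η) hK (t := ts) (UDef.formula
        (Relations.formula r fun k => Term.var k))).congr fun M _ v => ?_
      simp only [BoundedFormula.Realize, Sum.elim_comp_inl_inr, Formula.realize_rel, Term.realize_var]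
      rfl
    · exact (r : Empty).elim
  | imp φ ψ ih₁ ih₂ => exact ih₁.imp ih₂
  | all φ ih =>
    obtain ⟨R, hR, hP⟩ := ih.not
    refine (JetDef.ex1 (η := η) hK (P := fun M v c => ¬ φ.Realize (v ∘ Sum.inl)
      (Fin.snoc (v ∘ Sum.inr) c : Fin _ → M)) ⟨_, hR.comap (Prod.map (Sum.elim (Sum.inl ∘ Sum.inl)
        (Fin.snoc (Sum.inl ∘ Sum.inr) (Sum.inr ()) : Fin _ → _)) id), fun M hM v => ?_⟩).not.congr
      fun M _ v => ?_
    · have h1 := hP M hM (v ∘ (Sum.elim (Sum.inl ∘ Sum.inl)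
        (Fin.snoc (Sum.inl ∘ Sum.inr) (Sum.inr ()) : Fin _ → _)))
      refine Iff.trans (iff_of_eq ?_) h1
      simp only [Function.comp_assoc, Sum.elim_comp_inl, Sum.elim_comp_inr, Fin.comp_snoc]
    · simp only [BoundedFormula.realize_all, not_exists, not_not]

end QuantifierElimination
end GenericDerivation

/-! ### Bare models of `Tᵟ`, theories given by schemes, and definable dimension. -/

namespace GenericDerivation

section Bridge

variable {L : FirstOrder.Language.{u, v}} {ι : FirstOrder.Language.ring →ᴸ L} {K : Type w} [Field K]
  [Ring.CompatibleRing K] [L.Structure K] [ι.IsExpansionOn K]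
  {η : Derivation ℤ (dclEmpty ι K) (dclEmpty ι K)} {α β κ : Type*}

/-! ### Models of `Tᵟ` -/

theorem realize_forallClosure {L' : FirstOrder.Language.{u, v}} {M : Type*} [L'.Structure M] {n : ℕ}
    (θ : L'.Formula (Fin n)) : M ⊨ forallClosure θ ↔ ∀ x : Fin n → M, θ.Realize x := by
  rw [Sentence.Realize, forallClosure, Formula.realize_iAlls]
  refine forall_congr' fun x => ?_
  rw [Formula.realize_relabel]
  rfl

section Realize

variable {M : Type*} [L.Structure M] [derLang.Structure M]

theorem realize_deltaTerm {α : Type} (t : (withDelta L).Term α) (x : α → M) :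
    (deltaTerm t).realize x = delta M (t.realize x) := by
  rw [deltaTerm, Functions.apply₁, Term.realize_func]
  change Structure.funMap deltaSymbol _ = Structure.funMap deltaSymbol _
  congr 1
  ext i
  rw [Subsingleton.elim i 0]
  rfl

variable [Field M] [Ring.CompatibleRing M] [ι.IsExpansionOn M]

theorem realize_addTerm {α : Type} (s t : (withDelta L).Term α) (x : α → M) :
    (addTerm ι s t).realize x = s.realize x + t.realize x := by
  rw [addTerm, Term.realize_functions_apply₂, LHom.map_onFunction, LHom.map_onFunction,
    Ring.CompatibleRing.funMap_add]
  rfl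

theorem realize_mulTerm {α : Type} (s t : (withDelta L).Term α) (x : α → M) :
    (mulTerm ι s t).realize x = s.realize x * t.realize x := by
  rw [mulTerm, Term.realize_functions_apply₂, LHom.map_onFunction, LHom.map_onFunction,
    Ring.CompatibleRing.funMap_mul]
  rfl

theorem realize_deltaAdd : M ⊨ deltaAdd ι ↔ ∀ x y : M, delta M (x + y) = delta M x + delta M y := by
  rw [deltaAdd, realize_forallClosure]
  simp only [Formula.realize_equal, realize_deltaTerm, realize_addTerm, Term.realize_var]
  exact ⟨fun h x y => h ![x, y], fun h x => h _ _⟩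

theorem realize_deltaMul : M ⊨ deltaMul ι ↔
    ∀ x y : M, delta M (x * y) = x * delta M y + y * delta M x := by
  rw [deltaMul, realize_forallClosure]
  simp only [Formula.realize_equal, realize_deltaTerm, realize_addTerm, realize_mulTerm,
    Term.realize_var]
  exact ⟨fun h x y => h ![x, y], fun h x => h _ _⟩

end Realize

theorem realize_deltaSends {M : Type*} [L.Structure M] [derLang.Structure M]
    (φ ψ : L.Formula (Fin 1)) : M ⊨ deltaSends φ ψ ↔
      ∀ x y : M, φ.Realize (fun _ => x) → ψ.Realize (fun _ => y) → delta M x = y := by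
  rw [deltaSends, realize_forallClosure]
  simp only [Formula.realize_imp, LHom.realize_onFormula, Formula.realize_relabel,
    Formula.realize_equal, realize_deltaTerm, Term.realize_var]
  exact ⟨fun h x y => h ![x, y], fun h x => h (x 0) (x 1)⟩

theorem DM.model_Tdelta (M : DM η) : M ⊨ Tdelta ι η := by
  refine ⟨fun φ hφ => ?_⟩
  rcases hφ with (hφ | rfl | rfl) | ⟨a, φ, ψ, hφ, hψ, rfl⟩
  · exact ((LHom.onTheory_model _ _).2 M.model).realize_of_mem _ hφ
  · exact realize_deltaAdd.2 M.dadd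
  · exact realize_deltaMul.2 M.dmul
  · rw [realize_deltaSends]
    intro x y hx hy
    rw [M.toTM.sigma_iff hφ] at hx
    rw [M.toTM.sigma_iff hψ] at hy
    rw [hx, hy, M.dext]

/-- A model of `Tᵟ` with its field structure. -/
abbrev DM.ofModel (M : Type (max u v w)) [Field M] [Ring.CompatibleRing M] [L.Structure M]
    [derLang.Structure M] [ι.IsExpansionOn M] (h : M ⊨ Tdelta ι η) : DM η :=
  let N : TM ι K := ⟨M, (LHom.onTheory_model (LHom.sumInl : L →ᴸ withDelta L) _).1
    (h.mono fun _ hφ => Or.inl (Or.inl hφ))⟩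
  { N with
    dadd := realize_deltaAdd.1 (h.realize_of_mem _ (Or.inl (Or.inr (Or.inl rfl))))
    dmul := realize_deltaMul.1 (h.realize_of_mem _ (Or.inl (Or.inr (Or.inr rfl))))
    dext := fun a => (realize_deltaSends _ _).1 (h.realize_of_mem _ (Or.inr
      ⟨a, dclFormula a, dclFormula (η a), realize_dclFormula a, realize_dclFormula (η a), rfl⟩)) _ _
      ((N.sigma_iff (realize_dclFormula a) _).2 rfl)
      ((N.sigma_iff (realize_dclFormula (η a)) _).2 rfl) }

/-- A bare `Lᵟ`-structure is the sum of its two reducts, and the theory supplies the field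
structure; this allows all arguments to be carried out in `DM`. -/
theorem exists_dm_equiv (M : Type (max u v w)) [S : (withDelta L).Structure M]
    (h : M ⊨ Tdelta ι η) : ∃ A : DM η, Nonempty (A ≃[withDelta L] M) := by
  obtain ⟨S₁, S₂, rfl⟩ : ∃ (S₁ : L.Structure M) (S₂ : derLang.Structure M),
      L.sumStructure derLang M = S := by
    refine ⟨(LHom.sumInl : L →ᴸ withDelta L).reduct M, (LHom.sumInr : derLang →ᴸ withDelta L).reduct M,
      ?_⟩
    ext n f x
    · rcases f with f | f <;> rfl
    · rcases f with f | f <;> rfl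
  have hT : M ⊨ L.completeTheory K := (LHom.onTheory_model (LHom.sumInl : L →ᴸ withDelta L) _).1
    (h.mono fun _ hφ => Or.inl (Or.inl hφ))
  let N : TM ι K := TM.ofModel ι hT
  let _ : Field M := N.fld
  let _ : Ring.CompatibleRing M := N.cring
  have : ι.IsExpansionOn M := N.expn
  exact ⟨DM.ofModel M h, ⟨Language.Equiv.refl (withDelta L) M⟩⟩

/-- First-orderness guarantees that each instance contributes at least one sentence to the theory.
-/
theorem model_withScheme_iff {S : Set (DiffProperty.{u, v, max u v w} L)}
    (hS : IsFirstOrder ι (Tdelta ι η) S) (A : DM η) :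
    A ⊨ withScheme ι (Tdelta ι η) S ↔ ∀ P ∈ S, P A (delta A) := by
  constructor
  · intro h P hP
    obtain ⟨σ, hσ⟩ := hS P hP
    exact (hσ A A.model_Tdelta).1 (h.realize_of_mem _ (Or.inr ⟨P, hP, hσ⟩))
  · intro h
    refine ⟨fun φ hφ => ?_⟩
    rcases hφ with hφ | ⟨P, hP, hσ⟩
    · exact A.model_Tdelta.realize_of_mem _ hφ
    · exact (hσ A A.model_Tdelta).2 (h P hP)

theorem sameModels_withScheme {S S' : Set (DiffProperty.{u, v, max u v w} L)}
    (hS : IsFirstOrder ι (Tdelta ι η) S) (hS' : IsFirstOrder ι (Tdelta ι η) S')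
    (h : ∀ A : DM η, (∀ P ∈ S, P A (delta A)) ↔ ∀ P ∈ S', P A (delta A)) :
    SameModels.{u, v, max u v w} (withScheme ι (Tdelta ι η) S) (withScheme ι (Tdelta ι η) S') := by
  intro M _
  by_cases hM : M ⊨ Tdelta ι η
  · obtain ⟨A, ⟨e⟩⟩ := exists_dm_equiv M hM
    rw [← e.toElementaryEmbedding.theory_model_iff, ← e.toElementaryEmbedding.theory_model_iff,
      model_withScheme_iff hS, model_withScheme_iff hS', h]
  · exact iff_of_false (fun h => hM (h.mono Set.subset_union_left))
      fun h => hM (h.mono Set.subset_union_left)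

theorem exists_expresses {P : DiffProperty.{u, v, max u v w} L}
    (h : UDef (withDelta L) (fun M : DM η => M) (fun M (_ : Empty → M) => P M (delta M))) :
    ∃ σ, Expresses ι (Tdelta ι η) σ P := by
  obtain ⟨φ, hφ⟩ := h
  exact ⟨φ, fun M _ _ _ _ _ hM => hφ (DM.ofModel M hM) default⟩

/-! ### Definability of the dimension -/

theorem eq_of_forall_natCast_le {x y : WithBot ℕ∞}
    (h : ∀ d : ℕ, ((d : ℕ∞) : WithBot ℕ∞) ≤ x ↔ ((d : ℕ∞) : WithBot ℕ∞) ≤ y) : x = y := by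
  induction x with
  | bot =>
    induction y with
    | bot => rfl
    | coe y => exact absurd ((h 0).2 (by simp)) (by simp)
  | coe x =>
    induction y with
    | bot => exact absurd ((h 0).1 (by simp)) (by simp)
    | coe y =>
      simp only [WithBot.coe_le_coe] at h
      exact congrArg _ (ENat.eq_of_forall_natCast_le_iff h)

theorem UDef.le_dim (hK : IsAlgebraicallyBounded L (dclEmpty ι K)) {n : ℕ}
    {R : ∀ M : TM ι K, (κ ⊕ Fin n → M) → Prop} (h : UDef L (fun M : TM ι K => M) R) (d : ℕ) :
    UDef L (fun M : TM ι K => M) (fun M (x : κ → M) =>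
      ((d : ℕ∞) : WithBot ℕ∞) ≤ dim L {y | R M (Sum.elim x y)}) := by
  obtain ⟨k, g, φ, hφ⟩ := h.exists_formula_fin
  refine (UDef.iEx (J := {f : Fin d → Fin n // Function.Injective f}) fun f =>
    (UDef.big hK (UDef.projection (ι := ι) (K := K) φ f.1)).comap g).congr fun M x => ?_
  simp only [hφ]
  rw [le_dim_iff hK]
  exact ⟨fun ⟨f, hf⟩ => ⟨f.1, f.2, hf⟩, fun ⟨f, hf, hb⟩ => ⟨⟨f, hf⟩, hb⟩⟩

theorem UDef.dim_eq_dim (hK : IsAlgebraicallyBounded L (dclEmpty ι K)) {n : ℕ}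
    {R S : ∀ M : TM ι K, (κ ⊕ Fin n → M) → Prop} (hR : UDef L (fun M : TM ι K => M) R)
    (hS : UDef L (fun M : TM ι K => M) S) :
    UDef L (fun M : TM ι K => M) (fun M (x : κ → M) =>
      dim L {y | R M (Sum.elim x y)} = dim L {y | S M (Sum.elim x y)}) := by
  refine (UDef.iAll (J := Fin (n + 1)) fun d => (hR.le_dim hK d).iff (hS.le_dim hK d)).congr
    fun M x => ⟨fun h => eq_of_forall_natCast_le fun d => ?_, fun h d => by rw [h]⟩
  -- Dimensions in `n`-space are at most `n`, so comparing finitely many thresholds suffices.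
  by_cases hd : d < n + 1
  · exact h ⟨d, hd⟩
  · have h1 : ∀ X : Set (Fin n → M), ¬ ((d : ℕ∞) : WithBot ℕ∞) ≤ dim L X := fun X hX => by
      have := hX.trans (dim_le (ι := ι) (K := K) X)
      rw [WithBot.coe_le_coe, Nat.cast_le] at this
      omega
    exact iff_of_false (h1 _) (h1 _)

theorem UDef.dim_eq_natCast (hK : IsAlgebraicallyBounded L (dclEmpty ι K)) {n : ℕ}
    {R : ∀ M : TM ι K, (κ ⊕ Fin n → M) → Prop} (hR : UDef L (fun M : TM ι K => M) R) (d : ℕ) :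
    UDef L (fun M : TM ι K => M) (fun M (x : κ → M) =>
      dim L {y | R M (Sum.elim x y)} = ((d : ℕ∞) : WithBot ℕ∞)) := by
  refine ((hR.le_dim hK d).and (hR.le_dim hK (d + 1)).not).congr fun M x => ?_
  generalize dim L {y | R M (Sum.elim x y)} = r
  induction r with
  | bot => simp
  | coe r =>
    rw [WithBot.coe_le_coe, WithBot.coe_le_coe, WithBot.coe_inj]
    induction r with
    | top => simp
    | coe r =>
      simp only [Nat.cast_le, Nat.cast_inj]
      omega

/-! ### Definability in the language with a derivation -/

theorem UDef.toDelta {R : ∀ M : TM ι K, (α → M) → Prop} (h : UDef L (fun M : TM ι K => M) R) :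
    UDef (withDelta L) (fun M : DM η => M) (fun M v => R M.toTM v) :=
  (h.restrict DM.toTM).lhom LHom.sumInl

theorem UFun.delta {g : ∀ M : DM η, (α → M) → M} (h : UFun (withDelta L) (fun M : DM η => M) g) :
    UFun (withDelta L) (fun M : DM η => M) (fun M v => delta M (g M v)) := by
  have h1 : UFun (withDelta L) (fun M : DM η => M) (fun (M : DM η) (v : Unit → M) =>
      GenericDerivation.delta M (v ())) := by
    have := UFun.term (C := fun M : DM η => M) (deltaTerm (L := L) (Term.var ()))
    simpa only [realize_deltaTerm, Term.realize_var] using this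
  exact h1.subst fun _ => h

theorem UDef.jetDef [CharZero K] (hK : IsAlgebraicallyBounded L (dclEmpty ι K))
    {P : ∀ M : DM η, (α → M) → Prop} (h : UDef (withDelta L) (fun M : DM η => M) P) :
    JetDef P := by
  obtain ⟨φ, hφ⟩ := h
  obtain ⟨R, hR, h⟩ := jetDef_realize (η := η) hK φ
  refine ⟨_, hR.comap (Prod.map (Sum.elim id Fin.elim0) id), fun M hM x => ?_⟩
  rw [← hφ]
  refine Iff.trans ?_ ((h M hM (Sum.elim x Fin.elim0)).trans (iff_of_eq (congrArg (R M.toTM) ?_)))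
  · change φ.Realize x ↔ BoundedFormula.Realize φ (Sum.elim x Fin.elim0 ∘ Sum.inl) _
    rw [Sum.elim_comp_inl, Formula.Realize]
    exact iff_of_eq (congrArg _ (Subsingleton.elim _ _))
  · ext ⟨a | a, n⟩
    · rfl
    · exact a.elim0

/-- An extension of models that satisfy the scheme "deep" is elementary if it is elementary for the
language `L`. -/
theorem UDef.iff_of_elementary [CharZero K] (hK : IsAlgebraicallyBounded L (dclEmpty ι K))
    {M N : DM η} (hM : M.IsDeep) (hN : N.IsDeep) (f : M.toTM ↪ₑ[L] N.toTM)
    (hf : ∀ x : M, f (GenericDerivation.delta M x) = GenericDerivation.delta N (f x))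
    {P : ∀ M : DM η, (α → M) → Prop} (h : UDef (withDelta L) (fun M : DM η => M) P)
    (x : α → M) : P N (f ∘ x) ↔ P M x := by
  obtain ⟨R, hR, hP⟩ := h.jetDef hK
  rw [hP N hN, hP M hM, ← hR.elementary f]
  refine iff_of_eq (congrArg (R N.toTM) ?_)
  ext ⟨a, n⟩
  change (GenericDerivation.delta N)^[n] (f (x a)) = f ((GenericDerivation.delta M)^[n] (x a))
  exact (Function.Semiconj.iterate_right (f := f) hf n (x a)).symm

end Bridge
end GenericDerivation

/-! ### The schemes as first-order sentences. -/

namespace GenericDerivation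

/-! ### Families of polynomials -/

section Polynomials

open MvPolynomial

variable {M J : Type*} [Field M] [Fintype J] {n m : ℕ}

/-- The polynomial with exponents `s` and coefficients `c`. -/
noncomputable def polyOf (s : J → Fin n →₀ ℕ) (c : J → M) : MvPolynomial (Fin n) M :=
  ∑ j, monomial (s j) (c j)

theorem eval_polyOf (s : J → Fin n →₀ ℕ) (c : J → M) (x : Fin n → M) :
    eval x (polyOf s c) = ∑ j, c j * ∏ i, x i ^ s j i := by
  simp only [polyOf, map_sum, eval_monomial, Finsupp.prod_pow]

theorem eval_pderiv_polyOf (s : J → Fin n →₀ ℕ) (c : J → M) (x : Fin n → M) (l : Fin n) :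
    eval x (pderiv l (polyOf s c)) =
      ∑ j, c j * (s j l : M) * ∏ i, x i ^ (s j - Finsupp.single l 1 : Fin n →₀ ℕ) i := by
  simp only [polyOf, map_sum, pderiv_monomial, eval_monomial, Finsupp.prod_pow]

theorem coeff_coeffDelta {δ : M → M} (h0 : δ 0 = 0) (p : MvPolynomial (Fin n) M) (s : Fin n →₀ ℕ) :
    (coeffDelta δ p).coeff s = δ (p.coeff s) := by
  classical
  simp only [coeffDelta, coeff_sum, coeff_monomial, Finset.sum_ite_eq', mem_support_iff, ite_not]
  split_ifs with h
  · rw [h, h0]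
  · rfl

/-- Exponents in `s` may repeat, so a coefficient can be a sum of several `c j`; additivity of `δ`
is what is used. -/
theorem coeffDelta_polyOf {δ : M → M} (hadd : ∀ x y, δ (x + y) = δ x + δ y)
    (s : J → Fin n →₀ ℕ) (c : J → M) : coeffDelta δ (polyOf s c) = polyOf s (δ ∘ c) := by
  classical
  let δ' : M →+ M := AddMonoidHom.mk' δ hadd
  have h0 : δ 0 = 0 := δ'.map_zero
  ext t
  rw [coeff_coeffDelta h0]
  change δ' _ = _
  simp only [polyOf, coeff_sum, map_sum, coeff_monomial]
  refine Finset.sum_congr rfl fun j _ => ?_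
  split_ifs
  · rfl
  · exact h0

theorem eval_twist (δ : M → M) (p : MvPolynomial (Fin n) M) (x y : Fin n → M) :
    eval (Sum.elim x y) (twist δ p) =
      eval x (coeffDelta δ p) + ∑ l, eval x (pderiv l p) * y l := by
  simp [twist, eval_rename]

/-- The chain rule. It shows that `(x, Dx)` lies on the twisted tangent bundle whenever `x` is a
zero of the polynomials. -/
theorem eval_twist_derivation (D : Derivation ℤ M M) (p : MvPolynomial (Fin n) M) (x : Fin n → M) :
    eval (Sum.elim x (D ∘ x)) (twist D p) = D (eval x p) := by
  classical
  have h0 := D.map_zero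
  have hadd : ∀ p q : MvPolynomial (Fin n) M, coeffDelta D (p + q) = coeffDelta D p + coeffDelta D q := fun p q => by
    ext t
    simp only [coeff_coeffDelta h0, coeff_add, map_add]
  rw [eval_twist]
  induction p using MvPolynomial.induction_on with
  | C a =>
    have : coeffDelta D (C a) = (C (D a) : MvPolynomial (Fin n) M) := by
      ext t
      simp only [coeff_coeffDelta h0, coeff_C]
      split_ifs
      · rfl
      · exact h0
    simp [this]
  | add p q hp hq =>
    rw [hadd, map_add, map_add, map_add, ← hp, ← hq]
    simp only [map_add, add_mul, Finset.sum_add_distrib]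
    ring
  | mul_X p i hp =>
    have : coeffDelta D (p * X i) = coeffDelta D p * X i := by
      ext t
      simp only [coeff_coeffDelta h0, coeff_mul_X']
      split_ifs
      · rfl
      · exact h0
    rw [this, map_mul, map_mul, D.leibniz, ← hp]
    simp only [Derivation.leibniz, pderiv_X, smul_eq_mul, map_add, map_mul, eval_X, add_mul,
      Finset.sum_add_distrib, Function.comp_apply, mul_add, Finset.mul_sum]
    rw [Finset.sum_eq_single i (by intro b _ hb; simp [hb.symm]) (by simp)]
    simp only [Pi.single_eq_same, map_one]
    have : ∀ l, x i * (eval x (pderiv l p) * D (x l)) = x i * eval x (pderiv l p) * D (x l) :=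
      fun l => (mul_assoc _ _ _).symm
    simp only [this]
    ring

theorem exists_eq_polyOf {d : ℕ} {p : MvPolynomial (Fin n) M} (hp : p.totalDegree ≤ d)
    {s : J → Fin n →₀ ℕ} (hs : Function.Injective s) (hsd : ∀ e : Fin n →₀ ℕ, e.degree ≤ d → ∃ j, s j = e) :
    p = polyOf s fun j => p.coeff (s j) := by
  classical
  ext e
  simp only [polyOf, coeff_sum, coeff_monomial]
  by_cases he : p.coeff e = 0
  · rw [he]
    refine (Finset.sum_eq_zero fun j _ => ?_).symm
    split_ifs with h
    · rw [h, he]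
    · rfl
  · obtain ⟨j, rfl⟩ := hsd e ((le_totalDegree (mem_support_iff.2 he)).trans hp)
    rw [Finset.sum_eq_single j (fun b _ hb => if_neg fun h => hb (hs h)) (by simp), if_pos rfl]

theorem totalDegree_polyOf_le {d : ℕ} {s : J → Fin n →₀ ℕ} (hs : ∀ j, (s j).degree ≤ d) (c : J → M) :
    (polyOf s c).totalDegree ≤ d := by
  refine totalDegree_finsetSum_le fun j _ => (totalDegree_monomial_le _ _).trans ?_
  exact hs j

theorem mem_tangentSpace {p : Fin m → MvPolynomial (Fin n) M} {x y : Fin n → M} :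
    y ∈ tangentSpace p x ↔ ∀ i, ∑ l, eval x (pderiv l (p i)) * y l = 0 := by
  rw [tangentSpace, LinearMap.mem_ker, Matrix.mulVecLin_apply, funext_iff]
  rfl

end Polynomials

/-- Linear independence is unfolded so that the dimension of the tangent space becomes visibly first
order. -/
theorem le_finrank_iff {k V : Type*} [Field k] [AddCommGroup V] [Module k V] [FiniteDimensional k V]
    {S : Submodule k V} {r : ℕ} : r ≤ Module.finrank k S ↔ ∃ v : Fin r → V, (∀ i, v i ∈ S) ∧
      ∀ c : Fin r → k, ∑ i, c i • v i = 0 → ∀ i, c i = 0 := by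
  constructor
  · intro h
    obtain ⟨v, hv⟩ := exists_linearIndependent_of_le_finrank h
    refine ⟨fun i => v i, fun i => (v i).2, fun c hc => ?_⟩
    exact Fintype.linearIndependent_iff.1 (hv.map' S.subtype S.ker_subtype) c hc
  · rintro ⟨v, hv, h⟩
    have h1 : LinearIndependent k v := Fintype.linearIndependent_iff.2 h
    have h2 : LinearIndependent k (fun i => (⟨v i, hv i⟩ : S)) := .of_comp S.subtype h1
    simpa using h2.fintype_card_le_finrank

section Schemes

variable {L : FirstOrder.Language.{u, v}} {ι : FirstOrder.Language.ring →ᴸ L} {K : Type w} [Field K]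
  [Ring.CompatibleRing K] [L.Structure K] [ι.IsExpansionOn K]
  {η : Derivation ℤ (dclEmpty ι K) (dclEmpty ι K)} {α β κ : Type*}

/-! ### Definability of zero sets, twisted tangent bundles and tangent spaces -/

section Family

variable {J : Type*} [Fintype J] {n m : ℕ}

/-- The tuple of polynomials with exponents `s` and coefficients `c`. -/
noncomputable def polys {M : Type*} [Field M] (s : J → Fin n →₀ ℕ) (c : Fin m × J → M) :
    Fin m → MvPolynomial (Fin n) M := fun i => polyOf s fun j => c (i, j)

theorem UFun.eval_polyOf (s : J → Fin n →₀ ℕ) : UFun L (fun M : TM ι K => M)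
    (fun M (v : J ⊕ Fin n → M) => MvPolynomial.eval (v ∘ Sum.inr) (polyOf s (v ∘ Sum.inl))) := by
  simp only [GenericDerivation.eval_polyOf]
  exact UFun.sum (T := fun M : TM ι K => M) _ fun j _ => UFun.mul (T := fun M : TM ι K => M)
    (UFun.var (Sum.inl j)) (UFun.prod (T := fun M : TM ι K => M) _ fun i _ =>
      UFun.pow (T := fun M : TM ι K => M) (UFun.var (Sum.inr i)) _)

theorem UFun.eval_pderiv_polyOf (s : J → Fin n →₀ ℕ) (l : Fin n) : UFun L (fun M : TM ι K => M)
    (fun M (v : J ⊕ Fin n → M) =>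
      MvPolynomial.eval (v ∘ Sum.inr) (MvPolynomial.pderiv l (polyOf s (v ∘ Sum.inl)))) := by
  simp only [GenericDerivation.eval_pderiv_polyOf]
  exact UFun.sum (T := fun M : TM ι K => M) _ fun j _ => UFun.mul (T := fun M : TM ι K => M)
    (UFun.mul (T := fun M : TM ι K => M) (UFun.var (Sum.inl j))
      (UFun.natCast (T := fun M : TM ι K => M) _))
    (UFun.prod (T := fun M : TM ι K => M) _ fun i _ =>
      UFun.pow (T := fun M : TM ι K => M) (UFun.var (Sum.inr i)) _)

theorem UDef.mem_zeroSet (s : J → Fin n →₀ ℕ) : UDef L (fun M : TM ι K => M)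
    (fun M (v : (Fin m × J) ⊕ Fin n → M) => v ∘ Sum.inr ∈ zeroSet (polys s (v ∘ Sum.inl))) :=
  UDef.iAll fun i => UDef.eq ((UFun.eval_polyOf s).comap (Sum.map (Prod.mk i) id))
    (UFun.zero (T := fun M : TM ι K => M))

/-- The points `(x, y)` of the twisted tangent bundle of the tuple of polynomials with coefficients
`c`, where `c'` is the derivative of `c`. -/
def TwistedMem {M : Type*} [Field M] (s : J → Fin n →₀ ℕ) (c c' : Fin m × J → M)
    (x y : Fin n → M) : Prop :=
  x ∈ zeroSet (polys s c) ∧ ∀ i, MvPolynomial.eval x (polys s c' i) +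
    ∑ l, MvPolynomial.eval x (MvPolynomial.pderiv l (polys s c i)) * y l = 0

theorem twistedMem_iff {M : Type*} [Field M] {δ : M → M} (hadd : ∀ x y, δ (x + y) = δ x + δ y)
    (s : J → Fin n →₀ ℕ) (c : Fin m × J → M) (x y : Fin n → M) :
    TwistedMem s c (δ ∘ c) x y ↔ (x, y) ∈ twistedTangentBundle δ (polys s c) := by
  refine and_congr Iff.rfl (forall_congr' fun i => ?_)
  rw [eval_twist, show coeffDelta δ (polys s c i) = polys s (δ ∘ c) i from
    coeffDelta_polyOf hadd _ _]

theorem UDef.twistedMem (s : J → Fin n →₀ ℕ) : UDef L (fun M : TM ι K => M)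
    (fun M (v : ((Fin m × J) ⊕ (Fin m × J)) ⊕ (Fin n ⊕ Fin n) → M) =>
      TwistedMem s (v ∘ Sum.inl ∘ Sum.inl) (v ∘ Sum.inl ∘ Sum.inr) (v ∘ Sum.inr ∘ Sum.inl)
        (v ∘ Sum.inr ∘ Sum.inr)) := by
  refine UDef.and ((UDef.mem_zeroSet s).comap (Sum.map Sum.inl Sum.inl)) (UDef.iAll fun i => ?_)
  refine UDef.eq (UFun.add (T := fun M : TM ι K => M) ((UFun.eval_polyOf s).comap
    (Sum.map (Sum.inr ∘ Prod.mk i) Sum.inl)) (UFun.sum (T := fun M : TM ι K => M) _ fun l _ =>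
      UFun.mul (T := fun M : TM ι K => M) ((UFun.eval_pderiv_polyOf s l).comap
        (Sum.map (Sum.inl ∘ Prod.mk i) Sum.inl)) (UFun.var (Sum.inr (Sum.inr l)))))
    (UFun.zero (T := fun M : TM ι K => M))

theorem UDef.le_finrank_tangentSpace (s : J → Fin n →₀ ℕ) (r : ℕ) : UDef L (fun M : TM ι K => M)
    (fun M (v : (Fin m × J) ⊕ Fin n → M) =>
      r ≤ Module.finrank M (tangentSpace (polys s (v ∘ Sum.inl)) (v ∘ Sum.inr))) := by
  have h : UDef L (fun M : TM ι K => M) (fun M (v : (Fin m × J) ⊕ Fin n → M) =>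
      ∃ z : Fin r × Fin n → M, (∀ k i, ∑ l, MvPolynomial.eval (v ∘ Sum.inr)
        (MvPolynomial.pderiv l (polys s (v ∘ Sum.inl) i)) * z (k, l) = 0) ∧
        ∀ c : Fin r → M, (∀ l, ∑ k, c k * z (k, l) = 0) → ∀ k, c k = 0) := by
    refine UDef.ex (R := fun (M : TM ι K) (v : (Fin m × J) ⊕ Fin n → M) (z : Fin r × Fin n → M) =>
      (∀ k i, ∑ l, MvPolynomial.eval (v ∘ Sum.inr)
        (MvPolynomial.pderiv l (polys s (v ∘ Sum.inl) i)) * z (k, l) = 0) ∧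
        ∀ c : Fin r → M, (∀ l, ∑ k, c k * z (k, l) = 0) → ∀ k, c k = 0) (UDef.and ?_ ?_)
    · refine UDef.iAll fun k => UDef.iAll fun i => UDef.eq (UFun.sum (T := fun M : TM ι K => M) _
        fun l _ => UFun.mul (T := fun M : TM ι K => M) ((UFun.eval_pderiv_polyOf s l).comap
          (Sum.inl ∘ Sum.map (Prod.mk i) id)) (UFun.var _)) (UFun.zero (T := fun M : TM ι K => M))
    · refine UDef.all (R := fun (M : TM ι K) (v : ((Fin m × J) ⊕ Fin n) ⊕ (Fin r × Fin n) → M)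
        (c : Fin r → M) => (∀ l, ∑ k, c k * v (Sum.inr (k, l)) = 0) → ∀ k, c k = 0) (UDef.imp ?_ ?_)
      · exact UDef.iAll fun l => UDef.eq (UFun.sum (T := fun M : TM ι K => M) _
          fun k _ => UFun.mul (T := fun M : TM ι K => M) (UFun.var (Sum.inr k))
            (UFun.var (Sum.inl (Sum.inr (k, l))))) (UFun.zero (T := fun M : TM ι K => M))
      · exact UDef.iAll fun k => UDef.eq (UFun.var (Sum.inr k)) (UFun.zero (T := fun M : TM ι K => M))
  refine h.congr fun M v => ?_
  rw [le_finrank_iff]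
  simp only [mem_tangentSpace]
  constructor
  · rintro ⟨z, hz, hc⟩
    refine ⟨fun k l => z (k, l), hz, fun c h => hc c fun l => ?_⟩
    simpa using congrFun h l
  · rintro ⟨z, hz, hc⟩
    refine ⟨fun p => z p.1 p.2, hz, fun c h => hc c ?_⟩
    ext l
    simpa using h l

theorem UDef.finrank_tangentSpace (s : J → Fin n →₀ ℕ) (r : ℕ) : UDef L (fun M : TM ι K => M)
    (fun M (v : (Fin m × J) ⊕ Fin n → M) =>
      Module.finrank M (tangentSpace (polys s (v ∘ Sum.inl)) (v ∘ Sum.inr)) = r) :=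
  ((UDef.le_finrank_tangentSpace s r).and (UDef.le_finrank_tangentSpace s (r + 1)).not).congr
    fun M v => by omega

end Family

/-! ### The schemes are first order -/

theorem fst_image_fibre {M : Type*} [L.Structure M] {n k : ℕ}
    (ψ : L.Formula ((Fin n ⊕ Fin n) ⊕ Fin k)) (b : Fin k → M) :
    Prod.fst '' fibre ψ b = {x | ∃ y, ψ.Realize (Sum.elim (Sum.elim x y) b)} := by
  ext x
  constructor
  · rintro ⟨⟨x, y⟩, h, rfl⟩
    exact ⟨y, h⟩
  · rintro ⟨y, h⟩
    exact ⟨(x, y), h, rfl⟩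

theorem UDef.fst_fibre {n k : ℕ} (ψ : L.Formula ((Fin n ⊕ Fin n) ⊕ Fin k)) :
    UDef L (fun M : TM ι K => M) (fun M (v : Fin k ⊕ Fin n → M) =>
      ∃ y : Fin n → M, ψ.Realize (Sum.elim (Sum.elim (v ∘ Sum.inr) y) (v ∘ Sum.inl))) := by
  refine UDef.ex (R := fun (M : TM ι K) (v : Fin k ⊕ Fin n → M) (y : Fin n → M) =>
    ψ.Realize (Sum.elim (Sum.elim (v ∘ Sum.inr) y) (v ∘ Sum.inl))) ?_
  refine ((UDef.formula ψ).comap (Sum.elim (Sum.elim (Sum.inl ∘ Sum.inr) Sum.inr)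
    (Sum.inl ∘ Sum.inl))).congr fun M v => iff_of_eq (congrArg ψ.Realize ?_)
  ext ((i | i) | i) <;> rfl

theorem UFun.iterate_delta {g : ∀ M : DM η, (α → M) → M}
    (h : UFun (withDelta L) (fun M : DM η => M) g) (i : ℕ) :
    UFun (withDelta L) (fun M : DM η => M) (fun M v => (GenericDerivation.delta M)^[i] (g M v)) := by
  induction i with
  | zero => exact h
  | succ i ih => simpa only [Function.iterate_succ_apply'] using ih.delta

/-- The conclusion of the schemes "wide" and "PP". -/
theorem UDef.exists_mem_fibre {n k : ℕ} (ψ : L.Formula ((Fin n ⊕ Fin n) ⊕ Fin k)) :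
    UDef (withDelta L) (fun M : DM η => M) (fun M (b : Fin k → M) =>
      ∃ c : Fin n → M, (c, GenericDerivation.delta M ∘ c) ∈ fibre ψ b) := by
  refine UDef.ex (R := fun (M : DM η) (b : Fin k → M) (c : Fin n → M) =>
    (c, GenericDerivation.delta M ∘ c) ∈ fibre ψ b) ?_
  refine (UDef.subst (UDef.formula ψ).toDelta (g := Sum.elim (Sum.elim (fun i M v => v (Sum.inr i))
    fun i (M : DM η) v => GenericDerivation.delta M (v (Sum.inr i))) fun i M v => v (Sum.inl i)) ?_).congr
    fun M v => iff_of_eq (congrArg ψ.Realize ?_)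
  · rintro ((i | i) | i)
    · exact UFun.var _
    · exact (UFun.var _).delta
    · exact UFun.var _
  · ext ((i | i) | i) <;> rfl

theorem isFirstOrder_deepScheme (hK : IsAlgebraicallyBounded L (dclEmpty ι K)) :
    IsFirstOrder ι (Tdelta ι η) (deepScheme.{u, v, max u v w} L) := by
  rintro _ ⟨n, k, ψ, rfl⟩
  refine exists_expresses (UDef.all (R := fun (M : DM η) (_ : Empty → M) (b : Fin k → M) =>
    DeepHyp ψ M.toTM b → ∃ c : M, ψ.Realize (Sum.elim (fun i : Fin (n + 1) =>
      (delta M)^[(i : ℕ)] c) b)) (UDef.imp ((UDef.deepHyp hK ψ).toDelta.comap Sum.inr) ?_))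
  refine UDef.ex1 (R := fun (M : DM η) (v : Empty ⊕ Fin k → M) (c : M) =>
    ψ.Realize (Sum.elim (fun i : Fin (n + 1) => (delta M)^[(i : ℕ)] c) (v ∘ Sum.inr))) ?_
  refine (UDef.subst (UDef.formula ψ).toDelta (g := Sum.elim (fun (i : Fin (n + 1)) (M : DM η) v =>
    (delta M)^[(i : ℕ)] (v (Sum.inr ()))) fun i M v => v (Sum.inl (Sum.inr i))) ?_).congr
    fun M v => iff_of_eq (congrArg ψ.Realize ?_)
  · rintro (i | i)
    · exact (UFun.var _).iterate_delta i
    · exact UFun.var _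
  · ext (i | i) <;> rfl

theorem isFirstOrder_wideScheme (hK : IsAlgebraicallyBounded L (dclEmpty ι K)) :
    IsFirstOrder ι (Tdelta ι η) (wideScheme.{u, v, max u v w} L) := by
  rintro _ ⟨n, k, ψ, rfl⟩
  refine exists_expresses (UDef.all (R := fun (M : DM η) (_ : Empty → M) (b : Fin k → M) =>
    dim L (Prod.fst '' fibre ψ b) = ((n : ℕ∞) : WithBot ℕ∞) →
    ∃ c : Fin n → M, (c, delta M ∘ c) ∈ fibre ψ b) (UDef.imp ?_ ((UDef.exists_mem_fibre ψ).comap _)))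
  simp only [fst_image_fibre]
  exact ((UDef.fst_fibre ψ).dim_eq_natCast hK n).toDelta.comap Sum.inr

/-- The hypotheses of an instance of the scheme "PP", for polynomials with exponents `s` and
coefficients `c`, where `c'` is the derivative of `c`. -/
def PPHyp {J : Type*} [Fintype J] {m n k : ℕ} (ψ : L.Formula ((Fin n ⊕ Fin n) ⊕ Fin k))
    (s : J → Fin n →₀ ℕ) (M : TM ι K) (c c' : Fin m × J → M) (b : Fin k → M) : Prop :=
  (∃ x, x ∈ zeroSet (polys s c)) ∧
  (∀ x y, ψ.Realize (Sum.elim (Sum.elim x y) b) → TwistedMem s c c' x y) ∧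
  (∀ x, (∃ y, ψ.Realize (Sum.elim (Sum.elim x y) b)) → x ∈ zeroSet (polys s c) ∧
    ∃ r : Fin (n + 1), Module.finrank M (tangentSpace (polys s c) x) = r ∧
      dim L (zeroSet (polys s c)) = (((r : ℕ) : ℕ∞) : WithBot ℕ∞)) ∧
  dim L {x | ∃ y, ψ.Realize (Sum.elim (Sum.elim x y) b)} = dim L (zeroSet (polys s c))

/-- Because `c'` is a separate argument, the hypotheses form a predicate in `L` alone. They
therefore pass to elementary extensions on which no derivation has been chosen yet. -/
theorem UDef.ppHyp (hK : IsAlgebraicallyBounded L (dclEmpty ι K)) {J : Type*} [Fintype J]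
    {m n k : ℕ} (ψ : L.Formula ((Fin n ⊕ Fin n) ⊕ Fin k)) (s : J → Fin n →₀ ℕ) :
    UDef L (fun M : TM ι K => M) (fun M (v : ((Fin m × J) ⊕ (Fin m × J)) ⊕ Fin k → M) =>
      PPHyp ψ s M (v ∘ Sum.inl ∘ Sum.inl) (v ∘ Sum.inl ∘ Sum.inr) (v ∘ Sum.inr)) := by
  refine UDef.and ?_ (UDef.and ?_ (UDef.and ?_ ?_))
  · refine UDef.ex (R := fun (M : TM ι K) (v : ((Fin m × J) ⊕ (Fin m × J)) ⊕ Fin k → M)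
      (x : Fin n → M) => x ∈ zeroSet (polys s (v ∘ Sum.inl ∘ Sum.inl))) ?_
    exact (UDef.mem_zeroSet s).comap (Sum.map (Sum.inl ∘ Sum.inl) id)
  · refine UDef.all (R := fun (M : TM ι K) (v : ((Fin m × J) ⊕ (Fin m × J)) ⊕ Fin k → M)
      (x : Fin n → M) => ∀ y, ψ.Realize (Sum.elim (Sum.elim x y) (v ∘ Sum.inr)) →
        TwistedMem s (v ∘ Sum.inl ∘ Sum.inl) (v ∘ Sum.inl ∘ Sum.inr) x y) ?_
    refine UDef.all (R := fun (M : TM ι K) (v : (((Fin m × J) ⊕ (Fin m × J)) ⊕ Fin k) ⊕ Fin n → M)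
      (y : Fin n → M) => ψ.Realize (Sum.elim (Sum.elim (v ∘ Sum.inr) y) (v ∘ Sum.inl ∘ Sum.inr)) →
        TwistedMem s (v ∘ Sum.inl ∘ Sum.inl ∘ Sum.inl) (v ∘ Sum.inl ∘ Sum.inl ∘ Sum.inr)
          (v ∘ Sum.inr) y) (UDef.imp ?_ ?_)
    · refine ((UDef.formula ψ).comap (Sum.elim (Sum.elim (Sum.inl ∘ Sum.inr) Sum.inr)
        (Sum.inl ∘ Sum.inl ∘ Sum.inr))).congr fun M v => iff_of_eq (congrArg ψ.Realize ?_)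
      ext ((i | i) | i) <;> rfl
    · exact (UDef.twistedMem s).comap (Sum.elim (Sum.inl ∘ Sum.inl ∘ Sum.inl)
        (Sum.elim (Sum.inl ∘ Sum.inr) Sum.inr))
  · refine UDef.all (R := fun (M : TM ι K) (v : ((Fin m × J) ⊕ (Fin m × J)) ⊕ Fin k → M)
      (x : Fin n → M) => (∃ y, ψ.Realize (Sum.elim (Sum.elim x y) (v ∘ Sum.inr))) →
        x ∈ zeroSet (polys s (v ∘ Sum.inl ∘ Sum.inl)) ∧
        ∃ r : Fin (n + 1), Module.finrank M (tangentSpace (polys s (v ∘ Sum.inl ∘ Sum.inl)) x) = r ∧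
          dim L (zeroSet (polys s (v ∘ Sum.inl ∘ Sum.inl))) = (((r : ℕ) : ℕ∞) : WithBot ℕ∞))
      (UDef.imp ?_ (UDef.and ?_ (UDef.iEx fun r => UDef.and ?_ ?_)))
    · exact (UDef.fst_fibre ψ).comap (Sum.map Sum.inr id)
    · exact (UDef.mem_zeroSet s).comap (Sum.map (Sum.inl ∘ Sum.inl) id)
    · exact (UDef.finrank_tangentSpace s r).comap (Sum.map (Sum.inl ∘ Sum.inl) id)
    · exact ((UDef.mem_zeroSet s).dim_eq_natCast hK r).comap (Sum.inl ∘ Sum.inl ∘ Sum.inl)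
  · exact UDef.dim_eq_dim hK (κ := ((Fin m × J) ⊕ (Fin m × J)) ⊕ Fin k)
      ((UDef.fst_fibre ψ).comap (Sum.map Sum.inr id))
      ((UDef.mem_zeroSet s).comap (Sum.map (Sum.inl ∘ Sum.inl) id))

theorem ppHyp_iff {J : Type*} [Fintype J] {m n k : ℕ} (ψ : L.Formula ((Fin n ⊕ Fin n) ⊕ Fin k))
    (s : J → Fin n →₀ ℕ) (M : DM η) (c : Fin m × J → M) (b : Fin k → M) :
    PPHyp ψ s M.toTM c (delta M ∘ c) b ↔ (zeroSet (polys s c)).Nonempty ∧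
      fibre ψ b ⊆ twistedTangentBundle (delta M) (polys s c) ∧
      Prod.fst '' fibre ψ b ⊆ reg L (polys s c) ∧
      dim L (Prod.fst '' fibre ψ b) = dim L (zeroSet (polys s c)) := by
  rw [fst_image_fibre]
  refine and_congr Iff.rfl (and_congr ?_ (and_congr ?_ Iff.rfl))
  · simp only [twistedMem_iff M.dadd]
    exact ⟨fun h z hz => h z.1 z.2 hz, fun h x y hz => h hz⟩
  · refine forall_congr' fun x => imp_congr Iff.rfl (and_congr Iff.rfl ⟨?_, fun h => ?_⟩)
    · rintro ⟨r, hr, hd⟩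
      rw [hr, hd]
    · have h1 := (tangentSpace (polys s c) x).finrank_le
      rw [Module.finrank_fin_fun] at h1
      exact ⟨⟨_, Nat.lt_succ_of_le h1⟩, rfl, h.symm⟩

/-- The exponents of the monomials of degree at most `d`. -/
abbrev Exponents (n d : ℕ) : Type := {e : Fin n →₀ ℕ // e.degree ≤ d}

instance (n d : ℕ) : Finite (Exponents n d) := (Finsupp.finite_of_degree_le d).to_subtype

noncomputable instance (n d : ℕ) : Fintype (Exponents n d) := Fintype.ofFinite _

/-- Polynomials of bounded degree are tuples of coefficients of a fixed finite length, so the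
quantifier over them is first order. -/
theorem ppInstance_iff {m d n k : ℕ} (ψ : L.Formula ((Fin n ⊕ Fin n) ⊕ Fin k)) (M : DM η) :
    ppInstance m d ψ M (delta M) ↔ ∀ (c : Fin m × Exponents n d → M) (b : Fin k → M),
      PPHyp ψ Subtype.val M.toTM c (delta M ∘ c) b →
        ∃ x : Fin n → M, (x, delta M ∘ x) ∈ fibre ψ b := by
  simp only [ppHyp_iff]
  constructor
  · intro h c b ⟨h1, h2, h3, h4⟩
    exact h (polys Subtype.val c) b (fun i => totalDegree_polyOf_le (fun j => j.2) _) h1 h2 h3 h4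
  · intro h p b hp h1 h2 h3 h4
    obtain ⟨c, rfl⟩ : ∃ c : Fin m × Exponents n d → M, p = polys Subtype.val c :=
      ⟨fun i => (p i.1).coeff (i.2 : Fin n →₀ ℕ), funext fun i => exists_eq_polyOf (hp i) Subtype.val_injective
        fun e he => ⟨⟨e, he⟩, rfl⟩⟩
    exact h c b ⟨h1, h2, h3, h4⟩

theorem isFirstOrder_ppScheme (hK : IsAlgebraicallyBounded L (dclEmpty ι K)) :
    IsFirstOrder ι (Tdelta ι η) (ppScheme.{u, v, max u v w} L) := by
  rintro _ ⟨m, d, n, k, ψ, rfl⟩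
  refine exists_expresses (UDef.congr ?_ fun M _ => (ppInstance_iff ψ M).symm)
  refine UDef.all (R := fun (M : DM η) (_ : Empty → M) (c : Fin m × Exponents n d → M) =>
    ∀ b : Fin k → M, PPHyp ψ Subtype.val M.toTM c (delta M ∘ c) b →
      ∃ x : Fin n → M, (x, delta M ∘ x) ∈ fibre ψ b) ?_
  refine UDef.all (R := fun (M : DM η) (v : Empty ⊕ (Fin m × Exponents n d) → M) (b : Fin k → M) =>
    PPHyp ψ Subtype.val M.toTM (v ∘ Sum.inr) (delta M ∘ v ∘ Sum.inr) b →
      ∃ x : Fin n → M, (x, delta M ∘ x) ∈ fibre ψ b) (UDef.imp ?_ ((UDef.exists_mem_fibre ψ).comap _))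
  refine (UDef.subst (UDef.ppHyp hK ψ Subtype.val).toDelta (g := Sum.elim (Sum.elim
    (fun i M v => v (Sum.inl (Sum.inr i))) fun i (M : DM η) v => delta M (v (Sum.inl (Sum.inr i))))
    fun i M v => v (Sum.inr i)) ?_).congr fun M v => Iff.rfl
  rintro ((i | i) | i)
  · exact UFun.var _
  · exact (UFun.var _).delta
  · exact UFun.var _

end Schemes
end GenericDerivation

/-! ### Equivalence of the schemes and the model completion. -/

namespace GenericDerivation

section Comparison

variable {L : FirstOrder.Language.{u, v}} {ι : FirstOrder.Language.ring →ᴸ L} {K : Type w} [Field K]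
  [Ring.CompatibleRing K] [L.Structure K] [ι.IsExpansionOn K]
  {η : Derivation ℤ (dclEmpty ι K) (dclEmpty ι K)}

/-! ### Comparison of the schemes -/

theorem exists_formula_fst_fibre {n k : ℕ} (ψ : L.Formula ((Fin n ⊕ Fin n) ⊕ Fin k)) :
    ∃ φ : L.Formula (Fin n ⊕ Fin k), ∀ (M : TM ι K) (x : Fin n → M) (b : Fin k → M),
      φ.Realize (Sum.elim x b) ↔ ∃ y : Fin n → M, ψ.Realize (Sum.elim (Sum.elim x y) b) := by
  obtain ⟨φ, hφ⟩ := (UDef.fst_fibre (ι := ι) (K := K) ψ).comap Sum.swap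
  exact ⟨φ, fun M x b => hφ M _⟩

/-- With the empty tuple of polynomials, `W` is the whole space, every point is regular, and the
twisted tangent bundle imposes no condition. -/
theorem wideInstance_of_pp (M : DM η) (hK : IsAlgebraicallyBounded L (dclEmpty ι K))
    {n k : ℕ} {ψ : L.Formula ((Fin n ⊕ Fin n) ⊕ Fin k)} (h : ppInstance 0 0 ψ M (delta M)) :
    wideInstance ψ M (delta M) := by
  intro b hb
  have hZ : zeroSet (Fin.elim0 : Fin 0 → MvPolynomial (Fin n) M) = Set.univ :=
    Set.eq_univ_of_forall fun x i => i.elim0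
  -- Bigness is inherited from the projection of `X`, which has full dimension by assumption.
  have hdim : dim L (Set.univ : Set (Fin n → M)) = ((n : ℕ∞) : WithBot ℕ∞) := by
    obtain ⟨φ, hφ⟩ := exists_formula_fst_fibre (ι := ι) (K := K) ψ
    have h1 := dim_eq_iff_big hK (M := M.toTM) φ b
    simp only [hφ] at h1
    have h2 := dim_eq_iff_big hK (M := M.toTM) (⊤ : L.Formula (Fin n ⊕ Fin 0)) default
    simp only [Formula.realize_top, Set.ofPred_true] at h2
    rw [fst_image_fibre] at hb
    exact h2.2 ((h1.1 hb).mono (Set.subset_univ _))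
  refine h Fin.elim0 b (fun i => i.elim0) ?_ ?_ ?_ ?_
  · rw [hZ]
    exact ⟨0, trivial⟩
  · exact fun z _ => ⟨fun i => i.elim0, fun i => i.elim0⟩
  · intro x _
    refine ⟨fun i => i.elim0, ?_⟩
    rw [hZ, hdim, show tangentSpace (Fin.elim0 : Fin 0 → MvPolynomial (Fin n) M) x = ⊤ from
      eq_top_iff.2 fun y _ => mem_tangentSpace.2 fun i => i.elim0]
    simp
  · rw [hZ, hdim, hb]

/-- The set of pairs `(x, y)` such that `x` followed by the last entry of `y` lies in `Z`, and `y`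
is otherwise the shift of `x`, has the same projection as `Z`. A point `(c, δc)` on it is a jet of
`c 0`. -/
theorem isDeep_of_wide (M : DM η) (h : ∀ (n k : ℕ) (ψ : L.Formula ((Fin n ⊕ Fin n) ⊕ Fin k)),
    wideInstance ψ M (delta M)) (hK : IsAlgebraicallyBounded L (dclEmpty ι K)) : M.IsDeep := by
  intro n k ψ b hb
  -- For `n = 0` the tuple `y` has no last entry; then "deep" only asks for an element of the
  -- nonempty set `Z`.
  rcases n with _ | n
  · obtain ⟨x, y, hy⟩ := (deepHyp_iff_big hK ψ M.toTM b).1 hb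
    refine ⟨y, ?_⟩
    convert hy using 2
    ext i
    rw [show i = Fin.last 0 from Fin.ext (by simp), Fin.snoc_last]
    rfl
  · have hX : UDef L (fun M : TM ι K => M) (fun (M : TM ι K)
        (v : (Fin (n + 1) ⊕ Fin (n + 1)) ⊕ Fin k → M) =>
        ψ.Realize (Sum.elim (Fin.snoc (v ∘ Sum.inl ∘ Sum.inl) (v (Sum.inl (Sum.inr (Fin.last n)))) :
          Fin (n + 2) → M) (v ∘ Sum.inr)) ∧
        ∀ i : Fin n, v (Sum.inl (Sum.inr i.castSucc)) = v (Sum.inl (Sum.inl i.succ))) := by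
      refine UDef.and (((UDef.formula ψ).comap (Sum.elim (Fin.snoc (Sum.inl ∘ Sum.inl)
        (Sum.inl (Sum.inr (Fin.last n)))) Sum.inr)).congr fun M v =>
          iff_of_eq (congrArg ψ.Realize ?_)) (UDef.iAll fun i => UDef.eq (UFun.var _) (UFun.var _))
      rw [Sum.comp_elim, Fin.comp_snoc]
    obtain ⟨χ, hχ⟩ := hX
    obtain ⟨c, hc⟩ := h (n + 1) k χ b (by
      rw [← hb, fst_image_fibre]
      congr 1
      ext x
      constructor
      · rintro ⟨y, hy⟩
        exact ⟨_, ((hχ M.toTM _).1 hy).1⟩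
      · rintro ⟨y, hy⟩
        refine ⟨Fin.snoc (fun i : Fin n => x i.succ) y, (hχ M.toTM _).2 ⟨?_, fun i => ?_⟩⟩
        · simp only [Sum.elim_inl, Sum.elim_inr, Fin.snoc_last]
          exact hy
        · simp)
    obtain ⟨h1, h2⟩ := (hχ M.toTM _).1 hc
    have hit : ∀ i : Fin (n + 1), c i = (delta M)^[(i : ℕ)] (c 0) := by
      intro i
      induction i using Fin.induction with
      | zero => rfl
      | succ i ih =>
        rw [Fin.val_succ, Function.iterate_succ_apply']
        rw [Fin.val_castSucc] at ih
        rw [← ih]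
        exact (h2 i).symm
    refine ⟨c 0, ?_⟩
    refine (iff_of_eq (congrArg ψ.Realize ?_)).2 h1
    refine congrArg (Sum.elim · b) (funext fun i => ?_)
    refine Fin.lastCases ?_ (fun i => ?_) i
    · rw [Fin.snoc_last, Fin.val_last, Function.iterate_succ_apply']
      exact congrArg (delta M) (hit (Fin.last n)).symm
    · rw [Fin.snoc_castSucc]
      exact (hit i).symm

theorem TwistedMem.sub_mem {J : Type*} [Fintype J] {n m : ℕ} {M : Type*} [Field M]
    {s : J → Fin n →₀ ℕ} {c c' : Fin m × J → M} {x y z : Fin n → M} (hy : TwistedMem s c c' x y)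
    (hz : TwistedMem s c c' x z) : y - z ∈ tangentSpace (polys s c) x := by
  refine mem_tangentSpace.2 fun i => ?_
  simp only [Pi.sub_apply, mul_sub, Finset.sum_sub_distrib]
  exact sub_eq_zero.2 (add_left_cancel ((hy.2 i).trans (hz.2 i).symm))

/-- At a point of a variety, with as many algebraically independent coordinates as the dimension of
the tangent space, every point of the twisted tangent space is given by a derivation. -/
theorem exists_derivation_of_twistedMem {J : Type*} [Fintype J] {n m : ℕ} {M N : Type*} [Field M]
    [Field N] [CharZero M] [Algebra M N] (D : Derivation ℤ M M) {e : J → Fin n →₀ ℕ}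
    {c : Fin m × J → M} {x y : Fin n → N}
    (hy : TwistedMem e (algebraMap M N ∘ c) (algebraMap M N ∘ D ∘ c) x y) {s : Finset (Fin n)}
    (hs : AlgebraicIndepOn M x (s : Set (Fin n)))
    (hfin : Module.finrank N (tangentSpace (polys e (algebraMap M N ∘ c)) x) = s.card) :
    ∃ D' : Derivation ℤ N N, (∀ a, D' (algebraMap M N a) = algebraMap M N (D a)) ∧
      ∀ i, D' (x i) = y i := by
  set T := tangentSpace (polys e (algebraMap M N ∘ c)) x
  have hex : ∀ u : s → N, ∃ D' : Derivation ℤ N N,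
      (∀ a, D' (algebraMap M N a) = algebraMap M N (D a)) ∧ ∀ i : s, D' (x i) = u i := fun u =>
    exists_derivation_extension ((Algebra.linearMap M N).compDer D) hs u
  -- By the chain rule, every extension of `D` gives a point of the twisted fibre over `x`, and this
  -- fibre is a translate of `T`.
  have htw : ∀ D' : Derivation ℤ N N, (∀ a, D' (algebraMap M N a) = algebraMap M N (D a)) →
      TwistedMem e (algebraMap M N ∘ c) (algebraMap M N ∘ D ∘ c) x (D' ∘ x) := by
    intro D' hD'
    rw [show algebraMap M N ∘ D ∘ c = D' ∘ algebraMap M N ∘ c from funext fun i => (hD' _).symm,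
      twistedMem_iff D'.map_add]
    refine ⟨hy.1, fun i => ?_⟩
    rw [eval_twist_derivation, hy.1 i, D'.map_zero]
  let ρ : T →ₗ[N] (s → N) := (LinearMap.funLeft N N (Subtype.val : s → Fin n)).comp T.subtype
  -- The values on the independent coordinates are free, so differences of two extensions of `D`
  -- realize every vector; equality of dimensions then makes `ρ` injective.
  have hsurj : Function.Surjective ρ := by
    intro u
    obtain ⟨D₁, h₁, h₁'⟩ := hex u
    obtain ⟨D₂, h₂, h₂'⟩ := hex 0
    refine ⟨⟨_, (htw D₁ h₁).sub_mem (htw D₂ h₂)⟩, ?_⟩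
    ext i
    change D₁ (x i) - D₂ (x i) = u i
    rw [h₁', h₂', Pi.zero_apply, sub_zero]
  have hinj : Function.Injective ρ :=
    (LinearMap.injective_iff_surjective_of_finrank_eq_finrank (by simpa using hfin)).2 hsurj
  obtain ⟨D', h, h'⟩ := hex fun i => y i
  refine ⟨D', h, fun i => ?_⟩
  have h0 : (⟨_, (htw D' h).sub_mem hy⟩ : T) = 0 := hinj (by
    rw [map_zero]
    ext i
    exact sub_eq_zero.2 (h' i))
  exact sub_eq_zero.1 (congrFun (congrArg Subtype.val h0) i)

/-- The solution is first constructed in an extension, where a generic point of the projection of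
`X` gets a suitable derivation. It descends because `M` is `Lᵟ`-elementary in any deep,
`L`-elementary extension that respects the derivation. -/
theorem ppInstance_of_isDeep [CharZero K] (hK : IsAlgebraicallyBounded L (dclEmpty ι K)) {M : DM η}
    (hM : M.IsDeep) (m d : ℕ) {n k : ℕ} (ψ : L.Formula ((Fin n ⊕ Fin n) ⊕ Fin k)) :
    ppInstance m d ψ M (delta M) := by
  rw [ppInstance_iff]
  intro c b hpp
  obtain ⟨φ, hφ⟩ := exists_formula_fst_fibre (ι := ι) (K := K) ψ
  obtain ⟨h1, -, h3, h4⟩ := id hpp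
  -- Nonemptiness of `W` excludes dimension `⊥`. So the projection of `X`, of the same dimension, is
  -- nonempty too, and regularity of one of its points shows that `dim W` is a natural number `r`.
  have hZ0 : (((0 : ℕ) : ℕ∞) : WithBot ℕ∞) ≤ dim L (zeroSet (polys Subtype.val c)) := by
    obtain ⟨k', g, θ, hθ⟩ := (UDef.mem_zeroSet (L := L) (ι := ι) (K := K) (m := m)
      (Subtype.val : Exponents n d → _)).exists_formula_fin
    have h5 := le_dim_iff hK (M := M.toTM) θ (c ∘ g) 0
    simp only [← hθ, Sum.elim_comp_inl, Sum.elim_comp_inr] at h5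
    obtain ⟨x, hx⟩ := h1
    exact h5.2 ⟨Fin.elim0, fun i => i.elim0, default, x, hx, fun i => i.elim0⟩
  have hφ' : {x | ∃ y, ψ.Realize (Sum.elim (Sum.elim x y) b)} =
      {x : Fin n → M | φ.Realize (Sum.elim x b)} := by
    ext x
    exact (hφ M.toTM x b).symm
  have hle : ∀ r : ℕ, ((r : ℕ∞) : WithBot ℕ∞) ≤ dim L (zeroSet (polys Subtype.val c)) →
      ((r : ℕ∞) : WithBot ℕ∞) ≤ dim L {x : Fin n → M | φ.Realize (Sum.elim x b)} := by
    rw [← hφ', h4]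
    exact fun _ h => h
  obtain ⟨-, -, -, x, hx, -⟩ := (le_dim_iff hK (M := M.toTM) φ b 0).1 (hle 0 hZ0)
  obtain ⟨-, r, -, hr⟩ := h3 x ((hφ M.toTM x b).1 hx)
  obtain ⟨N, f, a, ha, hrk⟩ := exists_rk_le_of_le_dim (M := M.toTM) φ b (hle r hr.ge)
  obtain ⟨y, hy⟩ := (hφ N _ _).1 ha
  obtain ⟨s, hs, hsr⟩ := le_rk_iff.1 hrk
  -- In `N` the point `a` is therefore still regular and `(a, y)` still satisfies the twisted
  -- equations, with the coefficients and their derivatives taken from `M`.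
  have hppN : PPHyp ψ Subtype.val N (f ∘ c) (f ∘ delta M ∘ c) (f ∘ b) :=
    ((UDef.ppHyp hK ψ Subtype.val).elementary f (Sum.elim (Sum.elim c (delta M ∘ c)) b)).2 hpp
  have hrN : dim L (zeroSet (polys Subtype.val (f ∘ c))) = (((r : ℕ) : ℕ∞) : WithBot ℕ∞) :=
    (((UDef.mem_zeroSet (m := m) (Subtype.val : Exponents n d → _)).dim_eq_natCast hK r).elementary f
      c).2 hr
  obtain ⟨-, r', hr', hr''⟩ := hppN.2.2.1 a ⟨y, hy⟩
  have hrr : (r' : ℕ) = r := by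
    rw [hr''] at hrN
    exact_mod_cast hrN
  have := M.toTM.charZero
  let := (TM.hom f).toAlgebra
  obtain ⟨D, hD, hDa⟩ := exists_derivation_of_twistedMem M.der (hppN.2.1 a y hy)
    (AclIndependent.algebraicIndepOn f hs) (hr'.trans (hrr.trans hsr.symm))
  -- The extension with `Da = y` need not be deep, so it is enlarged once more before the
  -- elimination is used.
  obtain ⟨N', g, hg, hN'⟩ := DM.exists_deep_extension hK (M.ofDerivation f D hD)
  have hgf : ∀ x : M, (g.comp f) (delta M x) = delta N' ((g.comp f) x) := fun x => by
    have h5 := hg (f x)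
    rw [ElementaryEmbedding.comp_apply, ElementaryEmbedding.comp_apply, ← h5]
    exact congrArg g (hD x).symm
  refine ((UDef.exists_mem_fibre ψ).iff_of_elementary hK hM hN' (g.comp f) hgf b).1 ⟨g ∘ a, ?_⟩
  have h5 := (g.map_formula ψ _).2 hy
  change ψ.Realize _
  convert! h5 using 1
  ext ((i | i) | i)
  · rfl
  · exact (hg (a i)).symm.trans (congrArg g (hDa i))
  · rfl

theorem isDeep_iff_pp [CharZero K] (hK : IsAlgebraicallyBounded L (dclEmpty ι K)) (M : DM η) :
    (∀ P ∈ ppScheme.{u, v, max u v w} L, P M (delta M)) ↔ M.IsDeep := by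
  constructor
  · exact fun h => isDeep_of_wide M (fun n k ψ =>
      wideInstance_of_pp M hK (h _ ⟨0, 0, n, k, ψ, rfl⟩)) hK
  · rintro h _ ⟨m, d, n, k, ψ, rfl⟩
    exact ppInstance_of_isDeep hK h m d ψ

theorem isDeep_iff_wide [CharZero K] (hK : IsAlgebraicallyBounded L (dclEmpty ι K)) (M : DM η) :
    (∀ P ∈ wideScheme.{u, v, max u v w} L, P M (delta M)) ↔ M.IsDeep := by
  constructor
  · exact fun h => isDeep_of_wide M (fun n k ψ => h _ ⟨n, k, ψ, rfl⟩) hK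
  · rintro h _ ⟨n, k, ψ, rfl⟩
    exact wideInstance_of_pp M hK (ppInstance_of_isDeep hK h 0 0 ψ)

theorem isDeep_iff_deep (M : DM η) :
    (∀ P ∈ deepScheme.{u, v, max u v w} L, P M (delta M)) ↔ M.IsDeep := by
  constructor
  · exact fun h n k ψ => h _ ⟨n, k, ψ, rfl⟩
  · rintro h _ ⟨n, k, ψ, rfl⟩
    exact h n k ψ

theorem model_TPP_iff [CharZero K] (hK : IsAlgebraicallyBounded L (dclEmpty ι K)) (M : DM η) :
    M ⊨ TPP ι η ↔ M.IsDeep := by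
  rw [TPP, model_withScheme_iff (isFirstOrder_ppScheme hK), isDeep_iff_pp hK]

/-! ### The model completion -/

theorem embedding_delta {M N : DM η} (f : M ↪[withDelta L] N) (x : M) :
    f (delta M x) = delta N (f x) := by
  refine (f.map_fun (Sum.inr DerFunc.delta) ![x]).trans ?_
  change Structure.funMap deltaSymbol (f ∘ ![x]) = Structure.funMap deltaSymbol ![f x]
  congr 1
  ext k
  rw [Subsingleton.elim k 0]; rfl

theorem exists_dm_embedding_of_embedding {M : DM η} {B : Type (max u v w)}
    [(withDelta L).Structure B] (hB : B ⊨ Tdelta ι η) (f : M ↪[withDelta L] B) :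
    ∃ (N : DM η) (e : N ≃[withDelta L] B) (f' : M ↪[withDelta L] N), ∀ x, e (f' x) = f x := by
  obtain ⟨N, ⟨e⟩⟩ := exists_dm_equiv B hB
  exact ⟨N, e, e.symm.toEmbedding.comp f, fun x => e.apply_symm_apply _⟩

/-- By the elimination, the truth of `ψ` at the image of a tuple of `A` is decided by an `L`-formula
at its jet, and the jet already lies in `A`. -/
theorem isModelCompletion_TPP [CharZero K] (hK : IsAlgebraicallyBounded L (dclEmpty ι K))
    (hT : IsModelComplete.{u, v, max u v w} (L.completeTheory K)) :
    IsModelCompletion.{u, v, max u v w} (Tdelta ι η) (TPP ι η) where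
  models A _ h := h.mono Set.subset_union_left
  extends_to A _ hA := by
    obtain ⟨M, ⟨e⟩⟩ := exists_dm_equiv A hA
    obtain ⟨N, f, hf, hN⟩ := DM.exists_deep_extension hK M
    exact ⟨N, inferInstance, (model_TPP_iff hK N).2 hN,
      ⟨(deltaEmbedding f.toEmbedding hf).comp e.symm.toEmbedding⟩⟩
  elementarilyEquivalent_over A B C _ _ _ hA hB hC f g n ψ a := by
    obtain ⟨M, ⟨e⟩⟩ := exists_dm_equiv A hA
    obtain ⟨R, hR, hψ⟩ := UDef.jetDef (η := η) hK (UDef.formula ψ)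
    have key : ∀ (B : Type (max u v w)) [(withDelta L).Structure B], B ⊨ TPP ι η →
        ∀ f : A ↪[withDelta L] B, ψ.Realize (f ∘ a) ↔ R M.toTM (jet M (e.symm ∘ a)) := by
      intro B _ hB f
      obtain ⟨N, e', f', hf'⟩ := exists_dm_embedding_of_embedding
        (hB.mono Set.subset_union_left : B ⊨ Tdelta ι η) (f.comp e.toEmbedding)
      have hN : N.IsDeep := (model_TPP_iff hK N).1 ((e'.toElementaryEmbedding.theory_model_iff _).2 hB)
      -- The only use of model completeness of `T`: the `L`-embedding is elementary, so `R` can be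
      -- evaluated in `M`, which need not be deep.
      let j : M.toTM ↪ₑ[L] N.toTM :=
        ⟨f', fun n χ x => hT M N M.model N.model (reductEmbedding LHom.sumInl f') n χ x⟩
      have h1 : f ∘ a = e' ∘ f' ∘ e.symm ∘ a := by
        ext i
        refine Eq.trans ?_ (hf' _).symm
        exact congrArg f (e.apply_symm_apply (a i)).symm
      rw [h1, StrongHomClass.realize_formula e']
      refine (hψ N hN _).trans (Iff.trans ?_ (hR.elementary j _))
      refine iff_of_eq (congrArg (R N.toTM) ?_)
      ext ⟨i, l⟩
      exact (Function.Semiconj.iterate_right (f := f') (embedding_delta f') l (e.symm (a i))).symm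
    rw [key B hB f, key C hC g]

end Comparison
end GenericDerivation

open GenericDerivation

theorem mainTheorem6 {L : FirstOrder.Language.{u, v}}
    (ι : FirstOrder.Language.ring →ᴸ L) {K : Type w} [Field K] [CharZero K]
    [Ring.CompatibleRing K] [L.Structure K] [ι.IsExpansionOn K]
    (hK : IsAlgebraicallyBounded L (dclEmpty ι K))
    (η : Derivation ℤ (dclEmpty ι K) (dclEmpty ι K)) :
    -- the three schemes are first order, modulo `Tᵟ`
    (IsFirstOrder ι (Tdelta ι η)
        (ppScheme.{u, v, max u v w} L) ∧
      IsFirstOrder ι (Tdelta ι η)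
        (wideScheme.{u, v, max u v w} L) ∧
      IsFirstOrder ι (Tdelta ι η)
        (deepScheme.{u, v, max u v w} L)) ∧
    -- the Pierce-Pillay scheme axiomatizes the same theory as the schemes "wide" and "deep"
    (SameModels.{u, v, max u v w}
        (TPP ι η) (TWide ι η) ∧
      SameModels.{u, v, max u v w}
        (TPP ι η) (TDeep ι η)) ∧
    -- if `T` is model complete, this theory is the model completion of `Tᵟ`
    (IsModelComplete.{u, v, max u v w} (L.completeTheory K) →
      IsModelCompletion.{u, v, max u v w}
        (Tdelta ι η) (TPP ι η)) := by
  refine ⟨⟨isFirstOrder_ppScheme hK, isFirstOrder_wideScheme hK, isFirstOrder_deepScheme hK⟩,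
    ⟨sameModels_withScheme (isFirstOrder_ppScheme hK) (isFirstOrder_wideScheme hK) fun M => ?_,
      sameModels_withScheme (isFirstOrder_ppScheme hK) (isFirstOrder_deepScheme hK) fun M => ?_⟩,
    isModelCompletion_TPP hK⟩
  · rw [isDeep_iff_pp hK, isDeep_iff_wide hK]
  · rw [isDeep_iff_pp hK, isDeep_iff_deep]
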